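/- Let $I=[0,1]$ with Lebesgue measure, and let $X,Y$ be $L^2(I)$-valued random variables with $\mathrm E\|X\|^2<\infty$, $\mathrm E\|Y\|^2<\infty$, satisfying the functional linear regression model $$\mathrm E(Y\mid X)(s)=\mathrm E\{Y(s)\}+\int_I b(s,t)\,[X(t)-\mathrm E\{X(t)\}]\,dt$$ (an equality of $L^2(I)$-valued random variables) with $b\in L^2(I^2)$; write $|||R|||^2=\iint_{I^2} R^2(s,t)\,ds\,dt$ and $(f\otimes g)(s,t)=f(s)g(t)$. Let $K(s,t)=\mathrm{Cov}\{X(s),X(t)\}$, let $\kappa_1\ge\kappa_2\ge\cdots$ (tending to $0$) and $\{\phi_k\}_{k\ge1}$ (an orthonormal basis of $L^2(I)$) be the eigenvalues and eigenfunctions of the integral operator with kernel $K$, and put $\xi_k=\int_I[X(t)-\mathrm E\{X(t)\}]\phi_k(t)\,dt$, $b_{j,k}=\iint b\,(\phi_j\otimes\phi_k)$ and $\mathcal E=Y-\mathrm E(Y\mid X)$. Suppose that there are constants $\alpha>1$, $\beta>\alpha/2+1$, $\gamma>1/2$, $C_1>1$ such that $$\mathrm E(\|\mathcal E\|^2\mid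 X)\le C_1\ \text{a.s.},\qquad \mathrm E(\xi_k^4)\le C_1\kappa_k^2,\qquad \kappa_k\le C_1k^{-\alpha},\qquad \kappa_k-\kappa_{k+1}\ge C_1^{-1}k^{-\alpha-1},\qquad |b_{j,k}|\le C_1j^{-\gamma}k^{-\beta}$$ for all $j,k\ge1$, and suppose furthermore that $\gamma>\beta/2+1$. Let $(X_1,Y_1),(X_2,Y_2),\dots$ be independent copies of $(X,Y)$. For each $n$ let $\overline X=n^{-1}\sum_{i=1}^nX_i$ and $\hat K(s,t)=n^{-1}\sum_{i=1}^n\{X_i(s)-\overline X(s)\}\{X_i(t)-\overline X(t)\}$, let $\hat\kappa_1\ge\hat\kappa_2\ge\cdots\ge0$ (tending to $0$) and $\{\hat\phi_k\}_{k\ge1}$ (an orthonormal basis of $L^2(I)$) be eigenvalues and eigenfunctions of the integral operator with kernel $\hat K$, chosen in any way, and set $\hat\xi_{i,k}=\int_I\{X_i-\overline X\}\hat\phi_k$, $\hat\eta_{i,j}=\int_I Y_i\hat\phi_j$ and $$\tilde b=\sum_{j=1}^{m_{n,1}}\sum_{k=1}^{m_{n,2}}\tilde b_{j,k}\,\hat\phi_j\otimes\hat\phi_k,\qquad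 \tilde b_{j,k}=\frac{n^{-1}\sum_{i=1}^n\hat\eta_{i,j}\hat\xi_{i,k}}{\hat\kappa_k}$$ (with $\tilde b_{j,k}=0$, say, if $\hat\kappa_k=0$). (i) For all sequences of positive integers $m_{n,1}\to\infty$, $m_{n,2}\to\infty$ with $\max\{m_{n,1},m_{n,2}\}=o\{n^{1/(2\alpha+2)}\}$, $$|||\tilde b-b|||^2=O_{\mathrm P}\bigl\{n^{-1}(m_{n,1}+m_{n,2}^{\alpha+1})+m_{n,1}^{-2\gamma+1}+m_{n,2}^{-2\beta+1}\bigr\}.$$ (ii) For all sequences of positive integers with $m_{n,1}\sim\min\{n^{1/(2\gamma)},(n/\log n)^{1/(2\alpha+2)}\}$ and $m_{n,2}\sim n^{1/(\alpha+2\beta)}$, where $a_n\sim c_n$ means that $a_n/c_n$ is bounded and bounded away from zero for large $n$, $$|||\tilde b-b|||^2=O_{\mathrm P}\bigl[\max\{(n/\log n)^{-(2\gamma-1)/(2\alpha+2)},\,n^{-(2\gamma-1)/(2\gamma)},\,n^{-(2\beta-1)/(\alpha+2\beta)}\}\bigr].$$ -/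

import Mathlib

open MeasureTheory ProbabilityTheory Filter Topology Asymptotics
open scoped unitInterval

noncomputable section

namespace FunctionalRegression

/-- The real Hilbert space `L²(I)`, `I = [0,1]` with Lebesgue measure. -/
abbrev L2I : Type := Lp ℝ 2 (volume : Measure I)

/-- The real Hilbert space `L²(I²)`; its norm is `|||·|||`. -/
abbrev L2II : Type := Lp ℝ 2 (volume : Measure (I × I))

/-- Random elements of `L²(I)` are measurable for the Borel σ-field of `L²(I)`. -/
instance instMeasurableSpaceL2I : MeasurableSpace L2I := borel L2I

instance instBorelSpaceL2I : BorelSpace L2I := ⟨rfl⟩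

theorem memLp_tensor (f g : L2I) :
    MemLp (fun p : I × I => f p.1 * g p.2) 2 (volume : Measure (I × I)) := by
  have hf : AEStronglyMeasurable (f : I → ℝ) volume := Lp.aestronglyMeasurable f
  have hg : AEStronglyMeasurable (g : I → ℝ) volume := Lp.aestronglyMeasurable g
  have hm : AEStronglyMeasurable (fun p : I × I => f p.1 * g p.2)
      (volume : Measure (I × I)) := by
    rw [Measure.volume_eq_prod]
    exact hf.comp_fst.mul hg.comp_snd
  rw [memLp_two_iff_integrable_sq hm, Measure.volume_eq_prod]
  have h := ((memLp_two_iff_integrable_sq hf).1 (Lp.memLp f)).mul_prod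
    ((memLp_two_iff_integrable_sq hg).1 (Lp.memLp g))
  refine h.congr (Eventually.of_forall fun p => ?_)
  simp only [mul_pow]

/-- `(f ⊗ g)(s,t) = f(s) g(t)`, as an element of `L²(I²)`. -/
def tensor (f g : L2I) : L2II := (memLp_tensor f g).toLp _

/-- The integral operator with kernel `R`: `s ↦ ∫ R(s,t) h(t) dt`. -/
def kernelApply (R : L2II) (h : L2I) (s : I) : ℝ := ∫ t : I, R (s, t) * h t

/-- `(κ, φ)` is a spectral system of the integral operator with kernel `R`: the eigenvalues `κ`
are non-increasing and tend to zero (so they are nonnegative), and the orthonormal basis `φ` of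
`L²(I)` consists of corresponding eigenfunctions. Indices start at `0`: the pair with index `k`
here is the `(k+1)`-st eigenpair. -/
structure IsSpectralSystem (R : L2II) (κ : ℕ → ℝ) (φ : HilbertBasis ℕ ℝ L2I) : Prop where
  antitone : Antitone κ
  tendsto_zero : Tendsto κ atTop (𝓝 0)
  eigen : ∀ k, kernelApply R (φ k) =ᵐ[volume] fun s => κ k * φ k s

section Population

variable {Ω : Type*} [MeasurableSpace Ω]

/-- The mean function `E{X(·)}`, as an element of `L²(I)`. -/
def meanFn (P : Measure Ω) (X : Ω → L2I) : L2I := ∫ ω, X ω ∂P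

/-- The covariance function `K(s,t) = Cov{X(s), X(t)}`, as an element of `L²(I²)`. -/
def covKernel (P : Measure Ω) (X : Ω → L2I) : L2II :=
  ∫ ω, tensor (X ω - meanFn P X) (X ω - meanFn P X) ∂P

/-- The principal component scores `ξ_k = ∫ [X(t) - E{X(t)}] φ_k(t) dt`. -/
def score (P : Measure Ω) (X : Ω → L2I) (φ : HilbertBasis ℕ ℝ L2I) (k : ℕ) (ω : Ω) : ℝ :=
  inner ℝ (φ k) (X ω - meanFn P X)

/-- `E(Y | X)`, the conditional expectation of the `L²(I)`-valued `Y` given the σ-field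
generated by `X`. -/
def condMean (P : Measure Ω) (X Y : Ω → L2I) : Ω → L2I :=
  P[Y | MeasurableSpace.comap X inferInstance]

/-- The functional linear regression model with coefficient function `b`: `X` and `Y` are
square integrable random elements of `L²(I)` and
`E(Y | X)(s) = E{Y(s)} + ∫ b(s,t) [X(t) - E{X(t)}] dt`. -/
structure IsLinearModel (P : Measure Ω) (X Y : Ω → L2I) (b : L2II) : Prop where
  measurable_X : Measurable X
  measurable_Y : Measurable Y
  memLp_X : MemLp X 2 P
  memLp_Y : MemLp Y 2 P
  regression : ∀ᵐ ω ∂P, ∀ᵐ s : I,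
    condMean P X Y ω s = meanFn P Y s + kernelApply b (X ω - meanFn P X) s

/-- The coefficients `b_{j,k} = ∬ b(s,t) φ_j(s) φ_k(t) ds dt`. -/
def coeff (b : L2II) (φ : HilbertBasis ℕ ℝ L2I) (j k : ℕ) : ℝ :=
  inner ℝ (tensor (φ j) (φ k)) b

/-- The regularity conditions with constants `α, β, γ, C`. Here `κ k` and `φ k` are the
`(k+1)`-st eigenvalue and eigenfunction, whence the shifts `k + 1`. -/
structure IsRegular (P : Measure Ω) (X Y : Ω → L2I) (b : L2II)
    (κ : ℕ → ℝ) (φ : HilbertBasis ℕ ℝ L2I) (α β γ C : ℝ) : Prop where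
  one_lt_alpha : 1 < α
  lt_beta : α / 2 + 1 < β
  lt_gamma : 1 / 2 < γ
  one_lt_C : 1 < C
  /-- `E(‖ℰ‖² | X) ≤ C` almost surely, where `ℰ = Y - E(Y | X)`. -/
  error_moment : ∀ᵐ ω ∂P,
    (P[fun ω' => ‖Y ω' - condMean P X Y ω'‖ ^ 2 | MeasurableSpace.comap X inferInstance]) ω ≤ C
  score_integrable : ∀ k, Integrable (fun ω => score P X φ k ω ^ 4) P
  score_moment : ∀ k, ∫ ω, score P X φ k ω ^ 4 ∂P ≤ C * κ k ^ 2
  eigenvalue_le : ∀ k : ℕ, κ k ≤ C * ((k : ℝ) + 1) ^ (-α)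
  eigenvalue_gap : ∀ k : ℕ, C⁻¹ * ((k : ℝ) + 1) ^ (-α - 1) ≤ κ k - κ (k + 1)
  coeff_le : ∀ j k : ℕ,
    |coeff b φ j k| ≤ C * ((j : ℝ) + 1) ^ (-γ) * ((k : ℝ) + 1) ^ (-β)

/-- `(Xs i, Ys i)`, `i = 0, 1, …`, are independent copies of `(X, Y)`. -/
structure IsIIDSample (P : Measure Ω) (X Y : Ω → L2I) (Xs Ys : ℕ → Ω → L2I) : Prop where
  indep : iIndepFun (fun i ω => (Xs i ω, Ys i ω)) P
  identDistrib : ∀ i, IdentDistrib (fun ω => (Xs i ω, Ys i ω)) (fun ω => (X ω, Y ω)) P P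

/-- `Z n = O_P(r n)` as `n → ∞`. -/
def IsBigOP (P : Measure Ω) (Z : ℕ → Ω → ℝ) (r : ℕ → ℝ) : Prop :=
  ∀ ε : ℝ, 0 < ε → ∃ M : ℝ, 0 < M ∧
    ∀ᶠ n in atTop, P {ω | M * r n < |Z n ω|} ≤ ENNReal.ofReal ε

end Population

section Estimator

/-- The sample mean `n⁻¹ ∑ x_i` of `x_0, …, x_{n-1}`. -/
def sampleMean (n : ℕ) (x : ℕ → L2I) : L2I := (n : ℝ)⁻¹ • ∑ i ∈ Finset.range n, x i

/-- The empirical covariance function of `x_0, …, x_{n-1}`. -/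
def empCovKernel (n : ℕ) (x : ℕ → L2I) : L2II :=
  (n : ℝ)⁻¹ • ∑ i ∈ Finset.range n, tensor (x i - sampleMean n x) (x i - sampleMean n x)

/-- The estimated coefficient `n⁻¹ ∑_i η̂_{i,j} ξ̂_{i,k} / κ̂_k` with `η̂_{i,j} = ∫ y_i φ̂_j` and
`ξ̂_{i,k} = ∫ (x_i - x̄) φ̂_k`. -/
def coeffEst (n : ℕ) (x y : ℕ → L2I) (κ : ℕ → ℝ) (φ : HilbertBasis ℕ ℝ L2I) (j k : ℕ) : ℝ :=
  ((n : ℝ)⁻¹ * ∑ i ∈ Finset.range n,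
    (inner ℝ (φ j) (y i) : ℝ) * inner ℝ (φ k) (x i - sampleMean n x)) / κ k

/-- The double-truncation estimator of the coefficient function with cut-off levels `m₁, m₂`,
based on the data `(x_i, y_i)`, `i < n`, and on a spectral system `(κ, φ)` of the empirical
covariance function. -/
def doubleTruncEst (n m₁ m₂ : ℕ) (x y : ℕ → L2I) (κ : ℕ → ℝ) (φ : HilbertBasis ℕ ℝ L2I) : L2II :=
  ∑ j ∈ Finset.range m₁, ∑ k ∈ Finset.range m₂,
    coeffEst n x y κ φ j k • tensor (φ j) (φ k)

end Estimator

end FunctionalRegression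

end

noncomputable section

namespace FunctionalRegression

/-! Write `(κ, φ)` for the population spectral system and `(ν, ψ)` for the empirical one. The
argument rests on an exact identity (`coeffEst_eq`): whenever `ν k ≠ 0`, the estimated coefficient
equals the coefficient of `b` in the empirical basis `ψ ⊗ ψ` plus a noise term `⟨ψ j ⊗ ψ k, U⟩ / ν
k`, where `U` is the empirical cross-covariance of residuals and regressors. Estimating the
eigenfunctions therefore causes no bias inside the box `j < m₁`, `k < m₂`, and the squared error is
at most the noise plus two tails of `b`, one per variable, taken in the basis `ψ`.

Noise (`sum_inner_sq_div_le`, `tsum_noise_le`): once the empirical covariance operator is within a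
small multiple of `t = m₂^(-α)` of the population one, its inverse on the leading eigenvectors is
controlled by the regularized inverse `(T + t)⁻¹` of the population operator `T`, which is diagonal
in the nonrandom basis `φ`. Since `E‖U φ_l‖²` is of order `κ l / n`, apart from a centring
correction of higher order, the noise is of order `n⁻¹ ∑ κ l / (κ l + t)²`, hence of order `n⁻¹
m₂^(α+1)`.

Tails (`norm_tailProj_sq_le`, `norm_tailProj_eigenvector_le`): a vector is split into its tail in
`φ`, which the decay of the coefficients bounds by `m^(1-2p)` with `p = γ` or `p = β`, and a
combination of `φ l`, `l < m`. The tail of `φ l` in the basis `ψ` is at most a multiple of the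
perturbation applied to `φ l`, divided by the eigenvalue gap. Only the action on the single vector
`φ l` enters, and its mean square carries the factor `κ l`. Cauchy–Schwarz over the `m` terms gives
`(m/n) ∑ l^(α+2-2p)`, which is at most of order `m/n + m^(1-2p)` as long as `m^(2α+2) ≤ n`.

Both steps need the empirical covariance to lie within a small multiple of `max(m₁, m₂)^(-α-1)` of
the population one. Its mean square error is `O(1/n)`, so Markov's inequality gives this with
probability close to one exactly because `max(m₁, m₂) = o(n^(1/(2α+2)))`. A second use of Markov's
inequality, on the random majorant of the error, gives (i); part (ii) substitutes the balanced
cut-offs. -/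

instance : SecondCountableTopology L2I :=
  haveI : Fact ((2 : ENNReal) ≠ ⊤) := ⟨by norm_num⟩
  Lp.SecondCountableTopology

instance : SecondCountableTopology L2II :=
  haveI : Fact ((2 : ENNReal) ≠ ⊤) := ⟨by norm_num⟩
  haveI := isSeparable_of_sigmaFinite (volume : Measure (I × I))
  Lp.SecondCountableTopology

/-! ### Elementary tensors, integral operators and tensor bases. -/

section Tensor

theorem coeFn_tensor (f g : L2I) : tensor f g =ᵐ[volume] fun p : I × I => f p.1 * g p.2 :=
  (memLp_tensor f g).coeFn_toLp

theorem ae_comp_fst {p : I → Prop} (h : ∀ᵐ s, p s) : ∀ᵐ x : I × I, p x.1 := by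
  rw [Measure.volume_eq_prod]
  exact Measure.quasiMeasurePreserving_fst.ae h

theorem ae_comp_snd {p : I → Prop} (h : ∀ᵐ s, p s) : ∀ᵐ x : I × I, p x.2 := by
  rw [Measure.volume_eq_prod]
  exact Measure.quasiMeasurePreserving_snd.ae h

theorem tensor_add_left (f f' g : L2I) : tensor (f + f') g = tensor f g + tensor f' g := by
  apply Lp.ext
  filter_upwards [coeFn_tensor (f + f') g, coeFn_tensor f g, coeFn_tensor f' g,
    Lp.coeFn_add (tensor f g) (tensor f' g), ae_comp_fst (Lp.coeFn_add f f')] with x h₁ h₂ h₃ h₄ h₅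
  rw [h₁, h₄, Pi.add_apply, h₂, h₃, h₅, Pi.add_apply, add_mul]

theorem tensor_add_right (f g g' : L2I) : tensor f (g + g') = tensor f g + tensor f g' := by
  apply Lp.ext
  filter_upwards [coeFn_tensor f (g + g'), coeFn_tensor f g, coeFn_tensor f g',
    Lp.coeFn_add (tensor f g) (tensor f g'), ae_comp_snd (Lp.coeFn_add g g')] with x h₁ h₂ h₃ h₄ h₅
  rw [h₁, h₄, Pi.add_apply, h₂, h₃, h₅, Pi.add_apply, mul_add]

theorem tensor_smul_left (c : ℝ) (f g : L2I) : tensor (c • f) g = c • tensor f g := by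
  apply Lp.ext
  filter_upwards [coeFn_tensor (c • f) g, coeFn_tensor f g,
    Lp.coeFn_smul c (tensor f g), ae_comp_fst (Lp.coeFn_smul c f)] with x h₁ h₂ h₃ h₄
  rw [h₁, h₃, Pi.smul_apply, h₂, h₄, Pi.smul_apply, smul_eq_mul, smul_eq_mul, mul_assoc]

theorem tensor_smul_right (c : ℝ) (f g : L2I) : tensor f (c • g) = c • tensor f g := by
  apply Lp.ext
  filter_upwards [coeFn_tensor f (c • g), coeFn_tensor f g,
    Lp.coeFn_smul c (tensor f g), ae_comp_snd (Lp.coeFn_smul c g)] with x h₁ h₂ h₃ h₄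
  rw [h₁, h₃, Pi.smul_apply, h₂, h₄, Pi.smul_apply, smul_eq_mul, smul_eq_mul, mul_left_comm]

theorem inner_eq_integral (f g : L2I) : inner ℝ f g = ∫ s : I, f s * g s := by
  rw [L2.inner_def]
  exact integral_congr_ae (Eventually.of_forall fun s => by simp [mul_comm])

theorem inner_eq_integral₂ (f g : L2II) : inner ℝ f g = ∫ s : I × I, f s * g s := by
  rw [L2.inner_def]
  exact integral_congr_ae (Eventually.of_forall fun s => by simp [mul_comm])

theorem inner_tensor_tensor (f g f' g' : L2I) :
    inner ℝ (tensor f g) (tensor f' g') = inner ℝ f f' * inner ℝ g g' := by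
  rw [inner_eq_integral₂, inner_eq_integral, inner_eq_integral, ← integral_prod_mul,
    ← Measure.volume_eq_prod]
  refine integral_congr_ae ?_
  filter_upwards [coeFn_tensor f g, coeFn_tensor f' g'] with x h₁ h₂
  rw [h₁, h₂]
  ring

theorem norm_tensor (f g : L2I) : ‖tensor f g‖ = ‖f‖ * ‖g‖ := by
  have h := inner_tensor_tensor f g f g
  rw [real_inner_self_eq_norm_sq, real_inner_self_eq_norm_sq, real_inner_self_eq_norm_sq,
    ← mul_pow] at h
  exact (pow_left_inj₀ (norm_nonneg _) (by positivity) two_ne_zero).1 h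

/-- The tensor product as a continuous bilinear map. -/
def tensorCLM : L2I →L[ℝ] L2I →L[ℝ] L2II :=
  (LinearMap.mk₂ ℝ tensor tensor_add_left tensor_smul_left tensor_add_right
    tensor_smul_right).mkContinuous₂ 1 fun f g => by
      rw [one_mul]; exact (norm_tensor f g).le

@[simp]
theorem tensorCLM_apply (f g : L2I) : tensorCLM f g = tensor f g := rfl

theorem continuous_tensor : Continuous fun p : L2I × L2I => tensor p.1 p.2 :=
  tensorCLM.continuous₂

/-- The integral operator with kernel `R`, as a continuous linear map that is also linear in `R`. -/
def kernelOp (R : L2II) : L2I →L[ℝ] L2I :=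
  LinearMap.mkContinuous
    -- The operator is defined by duality, `⟨f, R g⟩ = ⟨f ⊗ g, R⟩`, so that linearity in both
    -- arguments needs no pointwise integrals.
    { toFun := fun g => ContinuousLinearMap.adjoint (tensorCLM.flip g) R
      map_add' := fun g g' => by simp
      map_smul' := fun c g => by simp } ‖R‖ fun g => by
        have h : ‖tensorCLM.flip g‖ ≤ ‖g‖ :=
          ContinuousLinearMap.opNorm_le_bound _ (norm_nonneg _) fun f => by
            rw [ContinuousLinearMap.flip_apply, tensorCLM_apply, norm_tensor, mul_comm]
        refine ((ContinuousLinearMap.adjoint (tensorCLM.flip g)).le_opNorm R).trans ?_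
        rw [LinearIsometryEquiv.norm_map, mul_comm]
        exact mul_le_mul_of_nonneg_left h (norm_nonneg _)

theorem inner_kernelOp (R : L2II) (f g : L2I) :
    inner ℝ f (kernelOp R g) = inner ℝ (tensor f g) R :=
  ContinuousLinearMap.adjoint_inner_right (tensorCLM.flip g) f R

theorem norm_kernelOp_le (R : L2II) (g : L2I) : ‖kernelOp R g‖ ≤ ‖R‖ * ‖g‖ :=
  (kernelOp R).le_of_opNorm_le (LinearMap.mkContinuous_norm_le _ (norm_nonneg R) _) g

theorem kernelOp_sub (R S : L2II) (g : L2I) :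
    kernelOp (R - S) g = kernelOp R g - kernelOp S g :=
  ext_inner_left ℝ fun f => by simp [inner_kernelOp, inner_sub_right]

theorem kernelOp_smul (c : ℝ) (R : L2II) (g : L2I) : kernelOp (c • R) g = c • kernelOp R g :=
  ext_inner_left ℝ fun f => by simp [inner_kernelOp, inner_smul_right]

theorem kernelOp_tensor (f g h : L2I) : kernelOp (tensor f g) h = (inner ℝ g h : ℝ) • f :=
  ext_inner_left ℝ fun u => by
    rw [inner_kernelOp, inner_tensor_tensor, inner_smul_right, real_inner_comm g h, mul_comm]

theorem kernelOp_sum {ι : Type*} (s : Finset ι) (R : ι → L2II) (g : L2I) :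
    kernelOp (∑ i ∈ s, R i) g = ∑ i ∈ s, kernelOp (R i) g :=
  ext_inner_left ℝ fun f => by simp [inner_kernelOp, inner_sum]

/-- Fubini's theorem. It links the pointwise integral operator `kernelApply` of the hypotheses to
`kernelOp`, with which the proof works. -/
theorem inner_kernelApply (R : L2II) (f g : L2I) :
    inner ℝ (tensor f g) R = ∫ s : I, f s * kernelApply R g s := by
  have hint : Integrable (fun x : I × I => tensor f g x * R x)
      ((volume : Measure I).prod volume) := by
    rw [← Measure.volume_eq_prod]
    exact MemLp.integrable_mul (Lp.memLp (tensor f g)) (Lp.memLp R)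
  have hae : (fun x : I × I => tensor f g x * R x) =ᵐ[(volume : Measure I).prod volume]
      fun x => f x.1 * (R x * g x.2) := by
    rw [← Measure.volume_eq_prod]
    filter_upwards [coeFn_tensor f g] with x hx
    rw [hx]
    ring
  rw [inner_eq_integral₂]
  refine (integral_congr_ae hae).trans ?_
  rw [integral_prod _ (hint.congr hae)]
  simp only [integral_const_mul, kernelApply]

theorem eq_kernelOp_of_ae_eq {R : L2II} {g v : L2I} (h : v =ᵐ[volume] kernelApply R g) :
    v = kernelOp R g :=
  ext_inner_left ℝ fun f => by
    rw [inner_kernelOp, inner_kernelApply, inner_eq_integral]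
    refine integral_congr_ae ?_
    filter_upwards [h] with s hs
    rw [hs]

/-- Tensors of indicators test `R` on measurable rectangles. These form a π-system generating the
product σ-field, so the integral of `R` over every measurable set vanishes. -/
theorem eq_zero_of_inner_tensor_eq_zero {R : L2II} (h : ∀ f g, inner ℝ (tensor f g) R = 0) :
    R = 0 := by
  have hR : Integrable R (volume : Measure (I × I)) :=
    (Lp.memLp R).integrable (by norm_num)
  have hrect : ∀ A B : Set I, MeasurableSet A → MeasurableSet B →
      ∫ x in A ×ˢ B, R x = 0 := by
    intro A B hA hB
    have hA' : (volume A) ≠ ⊤ := measure_ne_top _ _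
    have hB' : (volume B) ≠ ⊤ := measure_ne_top _ _
    have := h (indicatorConstLp 2 hA hA' (1 : ℝ)) (indicatorConstLp 2 hB hB' (1 : ℝ))
    rw [inner_eq_integral₂] at this
    rw [← this, ← integral_indicator (hA.prod hB)]
    refine integral_congr_ae ?_
    filter_upwards [coeFn_tensor (indicatorConstLp 2 hA hA' (1 : ℝ))
      (indicatorConstLp 2 hB hB' (1 : ℝ)),
      ae_comp_fst (indicatorConstLp_coeFn (p := 2) (hs := hA) (hμs := hA') (c := (1 : ℝ))),
      ae_comp_snd (indicatorConstLp_coeFn (p := 2) (hs := hB) (hμs := hB') (c := (1 : ℝ)))]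
      with x h₁ h₂ h₃
    rw [h₁, h₂, h₃]
    by_cases hxA : x.1 ∈ A <;> by_cases hxB : x.2 ∈ B <;>
      simp [Set.indicator, Set.mem_prod, hxA, hxB]
  have hset : ∀ s : Set (I × I), MeasurableSet s → ∫ x in s, R x = 0 := by
    intro s hs
    induction s, hs using MeasurableSpace.induction_on_inter
      (generateFrom_prod (α := I) (β := I)).symm isPiSystem_prod with
    | empty => simp
    | basic t ht =>
      obtain ⟨A, hA, B, hB, rfl⟩ := ht
      exact hrect A B hA hB
    | compl t ht ih =>
      have := integral_add_compl ht hR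
      have huniv : ∫ x, R x = 0 := by
        have := hrect Set.univ Set.univ MeasurableSet.univ MeasurableSet.univ
        rwa [Set.univ_prod_univ, setIntegral_univ] at this
      linarith
    | iUnion t hd ht ih =>
      rw [integral_iUnion ht hd hR.integrableOn]
      simp [ih]
  have : R =ᵐ[volume] (0 : I × I → ℝ) :=
    hR.ae_eq_zero_of_forall_setIntegral_eq_zero fun s hs _ => hset s hs
  exact (Lp.eq_zero_iff_ae_eq_zero).2 this

theorem orthonormal_tensor {ι ι' : Type*} {φ : ι → L2I} {ψ : ι' → L2I}
    (hφ : Orthonormal ℝ φ) (hψ : Orthonormal ℝ ψ) :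
    Orthonormal ℝ fun p : ι × ι' => tensor (φ p.1) (ψ p.2) := by
  classical
  rw [orthonormal_iff_ite] at *
  rintro ⟨i, j⟩ ⟨i', j'⟩
  rw [inner_tensor_tensor, hφ, hψ]
  by_cases h₁ : i = i' <;> by_cases h₂ : j = j' <;> simp [h₁, h₂]

theorem eq_zero_of_forall_inner_eq_zero {ι E : Type*} [NormedAddCommGroup E]
    [InnerProductSpace ℝ E] (φ : HilbertBasis ι ℝ E) {v : E} (h : ∀ i, inner ℝ (φ i) v = 0) :
    v = 0 := by
  have := φ.hasSum_inner_mul_inner v v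
  simp only [h, mul_zero] at this
  exact inner_self_eq_zero.1 (this.unique hasSum_zero)

/-- The tensor product of two Hilbert bases of `L²(I)` is a Hilbert basis of `L²(I²)`. -/
def tensorBasis {ι ι' : Type*} (φ : HilbertBasis ι ℝ L2I) (ψ : HilbertBasis ι' ℝ L2I) :
    HilbertBasis (ι × ι') ℝ L2II :=
  HilbertBasis.mkOfOrthogonalEqBot (orthonormal_tensor φ.orthonormal ψ.orthonormal) <| by
    rw [Submodule.eq_bot_iff]
    intro R hR
    have h : ∀ i j, inner ℝ (tensor (φ i) (ψ j)) R = 0 := fun i j =>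
      (Submodule.mem_orthogonal _ _).1 hR _ (Submodule.subset_span ⟨(i, j), rfl⟩)
    -- Completeness is used one variable at a time: first `R ψ_j = 0` by the basis `φ`, then the
    -- adjoint of `R` vanishes on every `f` by the basis `ψ`.
    have h₁ : ∀ j, kernelOp R (ψ j) = 0 := fun j =>
      eq_zero_of_forall_inner_eq_zero φ fun i => by rw [inner_kernelOp, h]
    refine eq_zero_of_inner_tensor_eq_zero fun f g => ?_
    have h₂ : ContinuousLinearMap.adjoint (kernelOp R) f = 0 :=
      eq_zero_of_forall_inner_eq_zero ψ fun j => by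
        rw [ContinuousLinearMap.adjoint_inner_right, h₁, inner_zero_left]
    rw [← inner_kernelOp, ← ContinuousLinearMap.adjoint_inner_left, h₂, inner_zero_left]

theorem tensorBasis_apply {ι ι' : Type*} (φ : HilbertBasis ι ℝ L2I) (ψ : HilbertBasis ι' ℝ L2I)
    (p : ι × ι') : tensorBasis φ ψ p = tensor (φ p.1) (ψ p.2) := by
  rw [tensorBasis, HilbertBasis.coe_mkOfOrthogonalEqBot]

end Tensor

/-! ### Perturbation of spectral systems in a Hilbert space. -/

section Hilbert

variable {H : Type*} [NormedAddCommGroup H] [InnerProductSpace ℝ H]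

theorem hasSum_inner_sq {ι : Type*} (φ : HilbertBasis ι ℝ H) (v : H) :
    HasSum (fun i => (inner ℝ (φ i) v : ℝ) ^ 2) (‖v‖ ^ 2) := by
  have := φ.hasSum_inner_mul_inner v v
  rw [real_inner_self_eq_norm_sq] at this
  refine this.congr_fun fun i => ?_
  rw [real_inner_comm, sq]

theorem ofReal_norm_sq {ι : Type*} (φ : HilbertBasis ι ℝ H) (v : H) :
    ENNReal.ofReal (‖v‖ ^ 2) = ∑' i, ENNReal.ofReal ((inner ℝ (φ i) v : ℝ) ^ 2) := by
  have := hasSum_inner_sq φ v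
  rw [← this.tsum_eq, ENNReal.ofReal_tsum_of_nonneg (fun _ => sq_nonneg _) this.summable]

/-- If the basis `φ` diagonalizes `T`, the coefficients of `T v` are those of `v` multiplied by the
eigenvalues. -/
theorem inner_apply_of_eigen (φ : HilbertBasis ℕ ℝ H) {T : H →L[ℝ] H} {κ : ℕ → ℝ}
    (hT : ∀ k, T (φ k) = κ k • φ k) (k : ℕ) (v : H) :
    inner ℝ (φ k) (T v) = κ k * inner ℝ (φ k) v := by
  have h := ((φ.hasSum_repr v).mapL T).mapL (innerSL ℝ (φ k))
  have h' : HasSum (fun i => if i = k then κ k * (inner ℝ (φ k) v : ℝ) else 0)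
      (κ k * inner ℝ (φ k) v) := hasSum_ite_eq k _
  refine h.unique (h'.congr_fun fun i => ?_)
  simp only [map_smul, hT, HilbertBasis.repr_apply_apply, innerSL_apply_apply, smul_eq_mul,
    orthonormal_iff_ite.1 φ.orthonormal k i]
  by_cases h : i = k
  · subst h; simp [mul_comm]
  · simp [h, Ne.symm h]

/-- A vector of the span of the first `m + 1` elements of one basis orthogonal to the first `m`
elements of another one. -/
theorem exists_ne_zero_orthogonal (φ ψ : ℕ → H) (m : ℕ) :
    ∃ c : Fin (m + 1) → ℝ, c ≠ 0 ∧ ∀ k < m, inner ℝ (φ k) (∑ i, c i • ψ i) = 0 := by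
  let L : (Fin (m + 1) → ℝ) →ₗ[ℝ] (Fin m → ℝ) :=
    LinearMap.pi fun k => (innerSL ℝ (φ k)).toLinearMap ∘ₗ
      (∑ i : Fin (m + 1), (LinearMap.proj i).smulRight (ψ i))
  have hL : LinearMap.ker L ≠ ⊥ := LinearMap.ker_ne_bot_of_finrank_lt (by simp)
  obtain ⟨c, hc, hc0⟩ := (Submodule.ne_bot_iff _).1 hL
  refine ⟨c, hc0, fun k hk => ?_⟩
  have := congrFun (LinearMap.mem_ker.1 hc) ⟨k, hk⟩
  simpa [L] using this

/-- Weyl's inequality. -/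
theorem eigenvalue_le_add (φ ψ : HilbertBasis ℕ ℝ H) {T S : H →L[ℝ] H} {κ ν : ℕ → ℝ}
    (hκ : Antitone κ) (hν : Antitone ν) (hT : ∀ k, T (φ k) = κ k • φ k)
    (hS : ∀ k, S (ψ k) = ν k • ψ k) {d : ℝ} (hd : ∀ v, ‖S v - T v‖ ≤ d * ‖v‖) (m : ℕ) :
    ν m ≤ κ m + d := by
  -- Courant–Fischer argument: `v` lies in the span of `ψ 0, …, ψ m`, so its Rayleigh quotient for
  -- `S` is at least `ν m`, and it is orthogonal to `φ 0, …, φ (m-1)`, so its quotient for `T` is at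
  -- most `κ m`.
  obtain ⟨c, hc0, hc⟩ := exists_ne_zero_orthogonal φ ψ m
  set v := ∑ i, c i • ψ i with hv
  have hψ : Orthonormal ℝ fun i : Fin (m + 1) => ψ i :=
    ψ.orthonormal.comp _ Fin.val_injective
  have hvv : ‖v‖ ^ 2 = ∑ i, c i * c i := by
    rw [← real_inner_self_eq_norm_sq, hv, hψ.inner_sum]
    simp
  have hvpos : 0 < ‖v‖ ^ 2 := by
    obtain ⟨i, hi⟩ := Function.ne_iff.1 hc0
    rw [hvv]
    exact Finset.sum_pos' (fun _ _ => mul_self_nonneg _) ⟨i, Finset.mem_univ _, mul_self_pos.2 hi⟩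
  have hSv : ν m * ‖v‖ ^ 2 ≤ inner ℝ v (S v) := by
    have : S v = ∑ i : Fin (m + 1), (ν i * c i) • ψ i := by
      rw [hv, map_sum]
      refine Finset.sum_congr rfl fun i _ => ?_
      rw [map_smul, hS, smul_smul, mul_comm]
    rw [this, hv, hψ.inner_sum, ← hv, hvv, Finset.mul_sum]
    refine Finset.sum_le_sum fun i _ => ?_
    have := hν (Nat.lt_succ_iff.1 i.2)
    have := mul_le_mul_of_nonneg_right this (mul_self_nonneg (c i))
    simp only [conj_trivial]
    linarith
  have hTv : inner ℝ v (T v) ≤ κ m * ‖v‖ ^ 2 := by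
    have h₁ := φ.hasSum_inner_mul_inner v (T v)
    have h₂ := (hasSum_inner_sq φ v).mul_left (κ m)
    refine hasSum_le (fun k => ?_) h₁ h₂
    rw [inner_apply_of_eigen φ hT, real_inner_comm]
    rcases lt_or_ge k m with hk | hk
    · rw [hc k hk]; simp
    · have := mul_le_mul_of_nonneg_right (hκ hk) (sq_nonneg (inner ℝ (φ k) v))
      linarith
  have hD : inner ℝ v (S v - T v) ≤ d * ‖v‖ ^ 2 := by
    refine (real_inner_le_norm _ _).trans ?_
    have := mul_le_mul_of_nonneg_left (hd v) (norm_nonneg v)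
    linarith
  rw [inner_sub_right] at hD
  have : (ν m) * ‖v‖ ^ 2 ≤ (κ m + d) * ‖v‖ ^ 2 := by linarith
  exact le_of_mul_le_mul_right this hvpos

/-- The projection onto the orthogonal complement of the first `m` elements of the basis. -/
def tailProj (φ : HilbertBasis ℕ ℝ H) (m : ℕ) : H →ₗ[ℝ] H :=
  LinearMap.id - ∑ j ∈ Finset.range m, (innerSL ℝ (φ j)).toLinearMap.smulRight (φ j)

theorem tailProj_apply (φ : HilbertBasis ℕ ℝ H) (m : ℕ) (v : H) :
    tailProj φ m v = v - ∑ j ∈ Finset.range m, (inner ℝ (φ j) v : ℝ) • φ j := by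
  simp [tailProj]

theorem inner_tailProj (φ : HilbertBasis ℕ ℝ H) (m j : ℕ) (v : H) :
    inner ℝ (φ j) (tailProj φ m v) = if m ≤ j then (inner ℝ (φ j) v : ℝ) else 0 := by
  rw [tailProj_apply, inner_sub_right, inner_sum]
  simp only [inner_smul_right, orthonormal_iff_ite.1 φ.orthonormal j]
  rcases le_or_gt m j with h | h
  · rw [if_pos h, Finset.sum_eq_zero, sub_zero]
    intro i hi
    have : j ≠ i := by have := Finset.mem_range.1 hi; omega
    simp [this]
  · simp [h.not_ge, h]

theorem hasSum_norm_tailProj_sq (φ : HilbertBasis ℕ ℝ H) (m : ℕ) (v : H) :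
    HasSum (fun j => if m ≤ j then (inner ℝ (φ j) v : ℝ) ^ 2 else 0) (‖tailProj φ m v‖ ^ 2) := by
  refine (hasSum_inner_sq φ (tailProj φ m v)).congr_fun fun j => ?_
  rw [inner_tailProj]
  split_ifs <;> simp

theorem norm_tailProj_le (φ : HilbertBasis ℕ ℝ H) (m : ℕ) (v : H) : ‖tailProj φ m v‖ ≤ ‖v‖ := by
  refine (sq_le_sq₀ (norm_nonneg _) (norm_nonneg _)).1 ?_
  refine hasSum_le (fun j => ?_) (hasSum_norm_tailProj_sq φ m v) (hasSum_inner_sq φ v)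
  split_ifs
  · exact le_rfl
  · exact sq_nonneg _

theorem ofReal_norm_tailProj_sq (φ : HilbertBasis ℕ ℝ H) (m : ℕ) (v : H) :
    ENNReal.ofReal (‖tailProj φ m v‖ ^ 2) =
      ∑' j, if m ≤ j then ENNReal.ofReal ((inner ℝ (φ j) v : ℝ) ^ 2) else 0 := by
  rw [ofReal_norm_sq φ]
  refine tsum_congr fun j => ?_
  rw [inner_tailProj]
  split_ifs <;> simp

/-- Replacing the basis `φ` by the basis `ψ` in a tail projection. -/
theorem norm_tailProj_sq_le (φ ψ : HilbertBasis ℕ ℝ H) (m : ℕ) (v : H) :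
    ‖tailProj ψ m v‖ ^ 2 ≤ 2 * ‖tailProj φ m v‖ ^ 2 +
      2 * (m * ∑ l ∈ Finset.range m, (inner ℝ (φ l) v : ℝ) ^ 2 * ‖tailProj ψ m (φ l)‖ ^ 2) := by
  have hv : v = tailProj φ m v + ∑ l ∈ Finset.range m, (inner ℝ (φ l) v : ℝ) • φ l := by
    rw [tailProj_apply, sub_add_cancel]
  have h₁ : ‖tailProj ψ m v‖ ≤ ‖tailProj φ m v‖ +
      ∑ l ∈ Finset.range m, |(inner ℝ (φ l) v : ℝ)| * ‖tailProj ψ m (φ l)‖ := by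
    conv_lhs => rw [hv, map_add, map_sum]
    refine (norm_add_le _ _).trans (add_le_add (norm_tailProj_le _ _ _) ?_)
    refine (norm_sum_le _ _).trans (Finset.sum_le_sum fun l _ => ?_)
    rw [map_smul, norm_smul, Real.norm_eq_abs]
  -- Cauchy–Schwarz over the `m` leading terms; this is the source of the factor `m`.
  have h₂ := sq_sum_le_card_mul_sum_sq (s := Finset.range m)
    (f := fun l => |(inner ℝ (φ l) v : ℝ)| * ‖tailProj ψ m (φ l)‖)
  simp only [mul_pow, sq_abs, Finset.card_range] at h₂
  have h₃ := pow_le_pow_left₀ (norm_nonneg _) h₁ 2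
  have h₄ := add_sq_le (a := ‖tailProj φ m v‖)
    (b := ∑ l ∈ Finset.range m, |(inner ℝ (φ l) v : ℝ)| * ‖tailProj ψ m (φ l)‖)
  linarith

/-- First order perturbation bound for the tail of an eigenvector. -/
theorem norm_tailProj_eigenvector_le (φ ψ : HilbertBasis ℕ ℝ H) {T S : H →L[ℝ] H} {κ ν : ℕ → ℝ}
    (hκ : Antitone κ) (hν : Antitone ν) (hT : ∀ k, T (φ k) = κ k • φ k)
    (hS : ∀ k, S (ψ k) = ν k • ψ k) {d g : ℝ} (hd : ∀ v, ‖S v - T v‖ ≤ d * ‖v‖) {l m : ℕ}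
    (hg : 0 < g) (hlm : g ≤ κ l - κ m) (hdg : d ≤ g / 2) :
    ‖tailProj ψ m (φ l)‖ ^ 2 ≤ (2 / g) ^ 2 * ‖S (φ l) - T (φ l)‖ ^ 2 := by
  refine hasSum_le (fun j => ?_) (hasSum_norm_tailProj_sq ψ m (φ l))
    ((hasSum_inner_sq ψ (S (φ l) - T (φ l))).mul_left _)
  split_ifs with hj
  -- Weyl's inequality gives `ν j ≤ ν m ≤ κ m + d ≤ κ l - g / 2`, so `κ l` stays separated from
  -- every tail eigenvalue of `S`.
  · have hW := eigenvalue_le_add φ ψ hκ hν hT hS hd m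
    have hνj := hν hj
    have hgap : g / 2 ≤ κ l - ν j := by linarith
    -- Both eigenvector equations turn the coefficient of the perturbation into an eigenvalue
    -- difference times the coefficient of `φ l`; the factor `2 / g` cancels that difference.
    have heq : inner ℝ (ψ j) (S (φ l) - T (φ l)) = -(κ l - ν j) * inner ℝ (ψ j) (φ l) := by
      rw [inner_sub_right, inner_apply_of_eigen ψ hS, hT, inner_smul_right]
      ring
    rw [heq, mul_pow, ← mul_assoc, ← mul_pow]
    refine le_mul_of_one_le_left (sq_nonneg _) ?_
    rw [mul_neg, neg_sq, one_le_sq_iff_one_le_abs]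
    refine le_trans ?_ (le_abs_self _)
    rw [div_mul_eq_mul_div, le_div_iff₀ hg]
    linarith
  · positivity

/-- Bound for the inverse of `S` on the span of its leading eigenvectors in terms of the
regularized inverse of `T`. -/
theorem sum_inner_sq_div_le (φ ψ : HilbertBasis ℕ ℝ H) {T S : H →L[ℝ] H} {κ ν : ℕ → ℝ}
    (hκ : ∀ k, 0 ≤ κ k) (hT : ∀ k, T (φ k) = κ k • φ k)
    (hS : ∀ k, S (ψ k) = ν k • ψ k) {d s t : ℝ} (hd : ∀ v, ‖S v - T v‖ ≤ d * ‖v‖) (hd₀ : 0 ≤ d)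
    (hs : 0 < s) (ht : 0 < t) {m : ℕ} (hν : ∀ k < m, s ≤ ν k) (u : H) :
    ENNReal.ofReal (∑ k ∈ Finset.range m, (inner ℝ (ψ k) u : ℝ) ^ 2 / ν k ^ 2) ≤
      ENNReal.ofReal ((1 + (d + t) / s) ^ 2) *
        ∑' l, ENNReal.ofReal ((inner ℝ (φ l) u : ℝ) ^ 2 / (κ l + t) ^ 2) := by
  have hnn : ∀ l, 0 ≤ (inner ℝ (φ l) u : ℝ) ^ 2 / (κ l + t) ^ 2 := fun l => by positivity
  have hsum : Summable fun l => (inner ℝ (φ l) u : ℝ) ^ 2 / (κ l + t) ^ 2 := by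
    refine Summable.of_nonneg_of_le hnn (fun l => ?_)
      ((hasSum_inner_sq φ u).summable.div_const (t ^ 2))
    gcongr
    linarith [hκ l]
  rw [← ENNReal.ofReal_tsum_of_nonneg hnn hsum, ← ENNReal.ofReal_mul (by positivity)]
  refine ENNReal.ofReal_le_ofReal ?_
  set Z := ∑' l, (inner ℝ (φ l) u : ℝ) ^ 2 / (κ l + t) ^ 2 with hZ
  have hZ₀ : 0 ≤ Z := tsum_nonneg hnn
  set A := ∑ k ∈ Finset.range m, (inner ℝ (ψ k) u : ℝ) ^ 2 / ν k ^ 2 with hA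
  have hA₀ : 0 ≤ A := Finset.sum_nonneg fun _ _ => by positivity
  have hψ := ψ.orthonormal
  have hnorm : ∀ c : ℕ → ℝ, ‖∑ k ∈ Finset.range m, c k • ψ k‖ ^ 2 =
      ∑ k ∈ Finset.range m, c k ^ 2 := by
    intro c
    rw [← real_inner_self_eq_norm_sq, hψ.inner_sum]
    exact Finset.sum_congr rfl fun k _ => by simp [sq]
  -- `w` is `S⁻² u` on the leading eigenspace, chosen so that `⟨u, w⟩` and `‖S w‖²` both equal `A`.
  -- Then `A = ⟨(T + t)⁻¹ u, (T + t) w⟩ ≤ √Z ‖(T + t) w‖`, and `(T + t) w` is compared with `S w`.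
  set w := ∑ k ∈ Finset.range m, ((inner ℝ (ψ k) u : ℝ) / ν k ^ 2) • ψ k with hw
  have hν₀ : ∀ k ∈ Finset.range m, 0 < ν k := fun k hk =>
    hs.trans_le (hν k (Finset.mem_range.1 hk))
  have huw : inner ℝ u w = A := by
    rw [hw, inner_sum]
    refine Finset.sum_congr rfl fun k _ => ?_
    rw [inner_smul_right, real_inner_comm]
    ring
  have hSw : ‖S w‖ ^ 2 = A := by
    have : S w = ∑ k ∈ Finset.range m, ((inner ℝ (ψ k) u : ℝ) / ν k) • ψ k := by
      rw [hw, map_sum]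
      refine Finset.sum_congr rfl fun k hk => ?_
      have := (hν₀ k hk).ne'
      rw [map_smul, hS, smul_smul]
      congr 1
      field_simp
    rw [this, hnorm]
    exact Finset.sum_congr rfl fun k _ => by rw [div_pow]
  have hwn : ‖w‖ ^ 2 ≤ A / s ^ 2 := by
    rw [hw, hnorm, hA, Finset.sum_div]
    refine Finset.sum_le_sum fun k hk => ?_
    have h₁ := hν k (Finset.mem_range.1 hk)
    have h₂ := hν₀ k hk
    rw [div_pow, ← pow_mul, div_div]
    refine div_le_div_of_nonneg_left (sq_nonneg _) (by positivity) ?_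
    rw [pow_mul, sq (ν k ^ 2)]
    gcongr
  have hSw' : ‖S w‖ = √A := by rw [← hSw, Real.sqrt_sq (norm_nonneg _)]
  have hwn' : ‖w‖ ≤ √A / s := by
    refine Real.le_sqrt_of_sq_le hwn |>.trans ?_
    rw [Real.sqrt_div hA₀, Real.sqrt_sq hs.le]
  have hTw : ‖T w + t • w‖ ≤ (1 + (d + t) / s) * √A := by
    have : T w + t • w = S w - (S w - T w) + t • w := by abel
    rw [this]
    refine (norm_add_le _ _).trans ((add_le_add_left (norm_sub_le _ _) _).trans ?_)
    rw [norm_smul, Real.norm_eq_abs, abs_of_pos ht, hSw']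
    have h₁ := (hd w).trans (mul_le_mul_of_nonneg_left hwn' hd₀)
    have h₂ := mul_le_mul_of_nonneg_left hwn' ht.le
    calc √A + ‖S w - T w‖ + t * ‖w‖ ≤ √A + d * (√A / s) + t * (√A / s) := by gcongr
      _ = (1 + (d + t) / s) * √A := by ring
  have hcs : A ≤ √Z * ‖T w + t • w‖ := by
    have hsumw := hasSum_inner_sq φ (T w + t • w)
    have hcoef : ∀ l, inner ℝ (φ l) (T w + t • w) = (κ l + t) * inner ℝ (φ l) w := by
      intro l
      rw [inner_add_right, inner_apply_of_eigen φ hT, inner_smul_right]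
      ring
    rw [← huw, ← Real.sqrt_sq (norm_nonneg (T w + t • w)), ← Real.sqrt_mul hZ₀]
    refine Real.le_sqrt_of_sq_le ?_
    have huw' := φ.hasSum_inner_mul_inner u w
    have hfin : ∀ F : Finset ℕ, (∑ l ∈ F, (inner ℝ u (φ l) : ℝ) * inner ℝ (φ l) w) ^ 2 ≤
        Z * ‖T w + t • w‖ ^ 2 := by
      intro F
      have h := Finset.sum_mul_sq_le_sq_mul_sq F
        (fun l => (inner ℝ (φ l) u : ℝ) / (κ l + t)) (fun l => inner ℝ (φ l) (T w + t • w))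
      have heq : ∀ l, (inner ℝ (φ l) u : ℝ) / (κ l + t) * inner ℝ (φ l) (T w + t • w) =
          (inner ℝ u (φ l) : ℝ) * inner ℝ (φ l) w := by
        intro l
        have : κ l + t ≠ 0 := by have := hκ l; positivity
        rw [hcoef, real_inner_comm]
        field_simp
      simp only [heq, div_pow] at h
      refine h.trans (mul_le_mul ?_ ?_ ?_ hZ₀)
      · exact hsum.sum_le_tsum F fun l _ => hnn l
      · exact sum_le_hasSum F (fun _ _ => sq_nonneg _) hsumw
      · exact Finset.sum_nonneg fun _ _ => sq_nonneg _
    -- Cauchy–Schwarz with weights `κ l + t` holds for finite partial sums and passes to the limit.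
    exact le_of_tendsto (huw'.pow 2) (Eventually.of_forall hfin)
  have hfin : A ≤ √Z * ((1 + (d + t) / s) * √A) :=
    hcs.trans (mul_le_mul_of_nonneg_left hTw (Real.sqrt_nonneg _))
  -- The bound has the form `A ≤ const · √A`; dividing by `√A` requires the case `A = 0` to be set
  -- apart.
  rcases hA₀.eq_or_lt with h | h
  · rw [← h]; positivity
  · have hsA := Real.sqrt_pos.2 h
    have h₁ : √A ≤ √Z * (1 + (d + t) / s) := by
      have : √A * √A ≤ (√Z * (1 + (d + t) / s)) * √A := by
        rw [Real.mul_self_sqrt hA₀]; linarith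
      exact le_of_mul_le_mul_right this hsA
    have := pow_le_pow_left₀ (Real.sqrt_nonneg _) h₁ 2
    rw [mul_pow, Real.sq_sqrt hA₀, Real.sq_sqrt hZ₀] at this
    linarith

end Hilbert

/-! ### Exact decomposition of the estimation error. -/

section Decomposition

theorem IsSpectralSystem.kernelOp_apply {R : L2II} {κ : ℕ → ℝ} {φ : HilbertBasis ℕ ℝ L2I}
    (h : IsSpectralSystem R κ φ) (k : ℕ) : kernelOp R (φ k) = κ k • φ k := by
  refine (eq_kernelOp_of_ae_eq ?_).symm
  filter_upwards [h.eigen k, Lp.coeFn_smul (κ k) (φ k)] with s h₁ h₂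
  rw [h₁, h₂, Pi.smul_apply, smul_eq_mul]

theorem IsSpectralSystem.nonneg {R : L2II} {κ : ℕ → ℝ} {φ : HilbertBasis ℕ ℝ L2I}
    (h : IsSpectralSystem R κ φ) (k : ℕ) : 0 ≤ κ k :=
  h.antitone.le_of_tendsto h.tendsto_zero k

/-- The deviations of the responses from the regression line. -/
def residual (μX μY : L2I) (b : L2II) (x y : L2I) : L2I := y - μY - kernelOp b (x - μX)

/-- The empirical cross-covariance of residuals and regressors. -/
def crossCov (n : ℕ) (x e : ℕ → L2I) : L2II :=
  (n : ℝ)⁻¹ • ∑ i ∈ Finset.range n, tensor (e i) (x i - sampleMean n x)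

theorem sum_sub_sampleMean (n : ℕ) (x : ℕ → L2I) :
    ∑ i ∈ Finset.range n, (x i - sampleMean n x) = 0 := by
  rcases Nat.eq_zero_or_pos n with rfl | hn
  · simp
  · have : (n : ℝ) ≠ 0 := by positivity
    rw [Finset.sum_sub_distrib, Finset.sum_const, Finset.card_range, sampleMean,
      ← Nat.cast_smul_eq_nsmul ℝ, smul_smul, mul_inv_cancel₀ this, one_smul, sub_self]

/-- The eigenvector equation writes `κ k • φ k` as the average of the centred `x i` weighted by
their own scores. Applying `b` and dividing by `κ k` shows that regressing the linear part of `y i`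
on these scores returns the coefficient of `b` without error; only the residuals remain. -/
theorem coeffEst_eq {n : ℕ} {x y : ℕ → L2I} {κ : ℕ → ℝ} {φ : HilbertBasis ℕ ℝ L2I}
    (h : IsSpectralSystem (empCovKernel n x) κ φ) (μX μY : L2I) (b : L2II) {j k : ℕ}
    (hk : κ k ≠ 0) :
    coeffEst n x y κ φ j k = inner ℝ (tensor (φ j) (φ k)) b +
      inner ℝ (tensor (φ j) (φ k))
        (crossCov n x fun i => residual μX μY b (x i) (y i)) / κ k := by
  have hb : kernelOp b (φ k) = (κ k)⁻¹ • (n : ℝ)⁻¹ • ∑ i ∈ Finset.range n,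
      (inner ℝ (φ k) (x i - sampleMean n x) : ℝ) • kernelOp b (x i - sampleMean n x) := by
    have h₁ := h.kernelOp_apply k
    rw [empCovKernel, kernelOp_smul, kernelOp_sum] at h₁
    simp only [kernelOp_tensor] at h₁
    have h₂ : φ k = (κ k)⁻¹ • (κ k • φ k) := by rw [smul_smul, inv_mul_cancel₀ hk, one_smul]
    conv_lhs => rw [h₂, ← h₁]
    simp only [map_smul, map_sum]
    congr 2
    exact Finset.sum_congr rfl fun i _ => by rw [real_inner_comm]
  rw [← inner_kernelOp, hb, crossCov, coeffEst, inner_smul_right, inner_smul_right, inner_sum,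
    inner_smul_right, inner_sum]
  simp only [inner_tensor_tensor, inner_smul_right, residual]
  -- The scores sum to zero, so any part of `y i` that does not depend on `i` drops out: the
  -- uncentred responses and the values chosen for `μX` and `μY` do no harm.
  have h0 : ∑ i ∈ Finset.range n, (inner ℝ (φ k) (x i - sampleMean n x) : ℝ) = 0 := by
    rw [← inner_sum, sum_sub_sampleMean, inner_zero_right]
  have hy : ∀ i, (inner ℝ (φ j) (y i) : ℝ) * inner ℝ (φ k) (x i - sampleMean n x) =
      inner ℝ (φ k) (x i - sampleMean n x) *
        inner ℝ (φ j) (kernelOp b (x i - sampleMean n x)) +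
      inner ℝ (φ j) (y i - μY - kernelOp b (x i - μX)) *
        inner ℝ (φ k) (x i - sampleMean n x) +
      inner ℝ (φ j) (μY + kernelOp b (sampleMean n x - μX)) *
        inner ℝ (φ k) (x i - sampleMean n x) := by
    intro i
    have : y i = kernelOp b (x i - sampleMean n x) + (y i - μY - kernelOp b (x i - μX)) +
        (μY + kernelOp b (sampleMean n x - μX)) := by
      simp only [map_sub]; abel
    conv_lhs => rw [this]
    rw [inner_add_right, inner_add_right]
    ring
  simp only [hy, Finset.sum_add_distrib, ← Finset.mul_sum, h0, mul_zero, add_zero]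
  field_simp

theorem inner_doubleTruncEst (n m₁ m₂ : ℕ) (x y : ℕ → L2I) (κ : ℕ → ℝ)
    (φ : HilbertBasis ℕ ℝ L2I) (j k : ℕ) :
    inner ℝ (tensor (φ j) (φ k)) (doubleTruncEst n m₁ m₂ x y κ φ) =
      if j < m₁ ∧ k < m₂ then coeffEst n x y κ φ j k else 0 := by
  have ho := orthonormal_iff_ite.1 φ.orthonormal
  simp only [doubleTruncEst, inner_sum, inner_smul_right, inner_tensor_tensor, ho]
  by_cases hj : j < m₁ <;> by_cases hk : k < m₂ <;> simp [hj, hk]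

theorem ofReal_inner_sq_comm (f g : L2I) :
    ENNReal.ofReal ((inner ℝ f g : ℝ) ^ 2) = ENNReal.ofReal ((inner ℝ g f : ℝ) ^ 2) := by
  rw [real_inner_comm]

theorem ofReal_norm_sq_kernel (φ ψ : HilbertBasis ℕ ℝ L2I) (R : L2II) :
    ENNReal.ofReal (‖R‖ ^ 2) =
      ∑' j, ∑' k, ENNReal.ofReal ((inner ℝ (tensor (φ j) (ψ k)) R : ℝ) ^ 2) := by
  rw [ofReal_norm_sq (tensorBasis φ ψ)]
  simp only [tensorBasis_apply]
  exact ENNReal.tsum_prod (f := fun j k => ENNReal.ofReal ((inner ℝ (tensor (φ j) (ψ k)) R : ℝ) ^ 2))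

/-- By Parseval in the variable that is not truncated, its basis may be changed from `ψ` to `φ`.
Only one variable then carries the empirical basis, and the decay of the coefficients in `φ` can be
used in the other. -/
theorem tsum_tail_left (φ ψ : HilbertBasis ℕ ℝ L2I) (m : ℕ) (R : L2II) :
    (∑' j, ∑' k, if m ≤ j then
      ENNReal.ofReal ((inner ℝ (tensor (ψ j) (ψ k)) R : ℝ) ^ 2) else 0) =
      ∑' k, ENNReal.ofReal (‖tailProj ψ m (kernelOp R (φ k))‖ ^ 2) := by
  simp only [ofReal_norm_tailProj_sq]
  rw [ENNReal.tsum_comm (f := fun k j => if m ≤ j then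
    ENNReal.ofReal ((inner ℝ (ψ j) (kernelOp R (φ k)) : ℝ) ^ 2) else 0)]
  refine tsum_congr fun j => ?_
  split_ifs with h
  · simp only [← inner_kernelOp, ← ContinuousLinearMap.adjoint_inner_left (kernelOp R)]
    have h₁ := ofReal_norm_sq ψ (ContinuousLinearMap.adjoint (kernelOp R) (ψ j))
    have h₂ := ofReal_norm_sq φ (ContinuousLinearMap.adjoint (kernelOp R) (ψ j))
    rw [h₁] at h₂
    simpa only [real_inner_comm] using h₂
  · rfl

theorem tsum_tail_right (φ ψ : HilbertBasis ℕ ℝ L2I) (m : ℕ) (R : L2II) :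
    (∑' j, ∑' k, if m ≤ k then
      ENNReal.ofReal ((inner ℝ (tensor (ψ j) (ψ k)) R : ℝ) ^ 2) else 0) =
      ∑' j, ENNReal.ofReal
        (‖tailProj ψ m (ContinuousLinearMap.adjoint (kernelOp R) (φ j))‖ ^ 2) := by
  simp only [ofReal_norm_tailProj_sq]
  rw [ENNReal.tsum_comm (f := fun j k => if m ≤ k then
      ENNReal.ofReal ((inner ℝ (tensor (ψ j) (ψ k)) R : ℝ) ^ 2) else 0),
    ENNReal.tsum_comm (f := fun j k => if m ≤ k then ENNReal.ofReal
      ((inner ℝ (ψ k) (ContinuousLinearMap.adjoint (kernelOp R) (φ j)) : ℝ) ^ 2) else 0)]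
  refine tsum_congr fun k => ?_
  split_ifs with h
  · simp only [← inner_kernelOp, ContinuousLinearMap.adjoint_inner_right (kernelOp R)]
    have h₁ := ofReal_norm_sq ψ (kernelOp R (ψ k))
    have h₂ := ofReal_norm_sq φ (kernelOp R (ψ k))
    rw [h₁] at h₂
    exact h₂.trans (tsum_congr fun j => ofReal_inner_sq_comm _ _)
  · rfl

/-- Decomposition of the estimation error into a noise term and two approximation errors. -/
theorem ofReal_norm_doubleTruncEst_sub_sq_le {n m₁ m₂ : ℕ} {x y : ℕ → L2I} {κ : ℕ → ℝ}
    {ψ : HilbertBasis ℕ ℝ L2I} (h : IsSpectralSystem (empCovKernel n x) κ ψ) (μX μY : L2I)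
    (b : L2II) (φ : HilbertBasis ℕ ℝ L2I) (hκ : ∀ k < m₂, κ k ≠ 0) :
    ENNReal.ofReal (‖doubleTruncEst n m₁ m₂ x y κ ψ - b‖ ^ 2) ≤
      (∑' j, ENNReal.ofReal (∑ k ∈ Finset.range m₂,
        (inner ℝ (ψ k) (ContinuousLinearMap.adjoint (kernelOp
          (crossCov n x fun i => residual μX μY b (x i) (y i))) (ψ j)) : ℝ) ^ 2 / κ k ^ 2)) +
      (∑' k, ENNReal.ofReal (‖tailProj ψ m₁ (kernelOp b (φ k))‖ ^ 2)) +
      ∑' j, ENNReal.ofReal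
        (‖tailProj ψ m₂ (ContinuousLinearMap.adjoint (kernelOp b) (φ j))‖ ^ 2) := by
  set U := crossCov n x fun i => residual μX μY b (x i) (y i) with hU
  rw [ofReal_norm_sq_kernel ψ ψ, ← tsum_tail_left φ ψ, ← tsum_tail_right φ ψ]
  have hnoise : ∀ j, ENNReal.ofReal (∑ k ∈ Finset.range m₂,
      (inner ℝ (ψ k) (ContinuousLinearMap.adjoint (kernelOp U) (ψ j)) : ℝ) ^ 2 / κ k ^ 2) =
      ∑' k, if k < m₂ then
        ENNReal.ofReal ((inner ℝ (tensor (ψ j) (ψ k)) U : ℝ) ^ 2 / κ k ^ 2) else 0 := by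
    intro j
    rw [ENNReal.ofReal_sum_of_nonneg fun _ _ => by positivity,
      tsum_eq_sum (s := Finset.range m₂) fun k hk => if_neg (by simpa using hk)]
    refine Finset.sum_congr rfl fun k hk => ?_
    rw [if_pos (Finset.mem_range.1 hk), ContinuousLinearMap.adjoint_inner_right,
      real_inner_comm, inner_kernelOp]
  simp only [hnoise]
  rw [← ENNReal.tsum_add, ← ENNReal.tsum_add]
  refine ENNReal.tsum_le_tsum fun j => ?_
  rw [← ENNReal.tsum_add, ← ENNReal.tsum_add]
  refine ENNReal.tsum_le_tsum fun k => ?_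
  rw [inner_sub_right, inner_doubleTruncEst]
  -- Inside the box only noise is left; outside it the estimator vanishes and the coefficient of `b`
  -- is charged to the tail in `k` if `k ≥ m₂`, otherwise to the tail in `j`. The noise bound keeps
  -- all `j`, which makes it independent of `m₁`.
  by_cases hk : k < m₂
  · by_cases hj : j < m₁
    · rw [if_pos ⟨hj, hk⟩, if_pos hk, coeffEst_eq h μX μY b (hκ k hk), add_sub_cancel_left, div_pow]
      exact le_self_add.trans (le_self_add)
    · rw [if_neg (by tauto), if_pos (not_lt.1 hj), zero_sub, neg_sq]
      exact le_add_self.trans le_self_add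
  · rw [if_neg (by tauto), if_pos (not_lt.1 hk), zero_sub, neg_sq]
    exact le_add_self

/-- Tail bound for a family of vectors whose coefficients decay polynomially. -/
theorem tsum_norm_tailProj_sq_le {H : Type*} [NormedAddCommGroup H] [InnerProductSpace ℝ H]
    (φ ψ : HilbertBasis ℕ ℝ H) (m : ℕ) (v : ℕ → H) {u w : ℕ → ℝ} (hu : Summable u)
    (hw : Summable w)
    (hv : ∀ l k, (inner ℝ (φ l) (v k) : ℝ) ^ 2 ≤ u l * w k) :
    ∑' k, ENNReal.ofReal (‖tailProj ψ m (v k)‖ ^ 2) ≤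
      ENNReal.ofReal ((∑' k, w k) * (2 * (∑' l, u (l + m)) +
        2 * (m * ∑ l ∈ Finset.range m, u l * ‖tailProj ψ m (φ l)‖ ^ 2))) := by
  set A := 2 * (∑' l, u (l + m)) +
        2 * (m * ∑ l ∈ Finset.range m, u l * ‖tailProj ψ m (φ l)‖ ^ 2) with hA
  have hle : ∀ k, ‖tailProj ψ m (v k)‖ ^ 2 ≤ w k * A := by
    intro k
    have h₁ := norm_tailProj_sq_le φ ψ m (v k)
    have h₂ : ‖tailProj φ m (v k)‖ ^ 2 ≤ (∑' l, u (l + m)) * w k := by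
      have hs := hasSum_norm_tailProj_sq φ m (v k)
      have hs' := (hasSum_nat_add_iff' m).2 hs
      rw [Finset.sum_eq_zero, sub_zero] at hs'
      · refine hasSum_le (fun l => ?_) hs'
          ((((summable_nat_add_iff m).2 hu).hasSum).mul_right (w k))
        rw [if_pos (Nat.le_add_left m l)]
        exact hv _ _
      · intro l hl
        rw [if_neg (by simpa using hl)]
    have h₃ : ∑ l ∈ Finset.range m, (inner ℝ (φ l) (v k) : ℝ) ^ 2 * ‖tailProj ψ m (φ l)‖ ^ 2 ≤
        (∑ l ∈ Finset.range m, u l * ‖tailProj ψ m (φ l)‖ ^ 2) * w k := by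
      rw [Finset.sum_mul]
      refine Finset.sum_le_sum fun l _ => ?_
      have := mul_le_mul_of_nonneg_right (hv l k) (sq_nonneg ‖tailProj ψ m (φ l)‖)
      linarith
    have h₄ := mul_le_mul_of_nonneg_left h₃ (Nat.cast_nonneg (α := ℝ) m)
    rw [hA]
    linarith
  have hsum : Summable fun k => w k * A := hw.mul_right A
  calc ∑' k, ENNReal.ofReal (‖tailProj ψ m (v k)‖ ^ 2)
      ≤ ∑' k, ENNReal.ofReal (w k * A) :=
        ENNReal.tsum_le_tsum fun k => ENNReal.ofReal_le_ofReal (hle k)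
    _ = ENNReal.ofReal (∑' k, w k * A) :=
        (ENNReal.ofReal_tsum_of_nonneg (fun k => (sq_nonneg _).trans (hle k)) hsum).symm
    _ = _ := by rw [tsum_mul_right]

/-- Bound for the noise term by the residual cross-covariance in the population basis. -/
theorem tsum_noise_le (φ ψ : HilbertBasis ℕ ℝ L2I) {R S : L2II} {κ ν : ℕ → ℝ}
    (hR : IsSpectralSystem R κ φ) (hS : IsSpectralSystem S ν ψ) (U : L2II) {s t : ℝ} (hs : 0 < s)
    (ht : 0 < t) {m : ℕ} (hν : ∀ k < m, s ≤ ν k) :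
    (∑' j, ENNReal.ofReal (∑ k ∈ Finset.range m,
      (inner ℝ (ψ k) (ContinuousLinearMap.adjoint (kernelOp U) (ψ j)) : ℝ) ^ 2 / ν k ^ 2)) ≤
      ENNReal.ofReal ((1 + (‖S - R‖ + t) / s) ^ 2) *
        ∑' l, ENNReal.ofReal (‖kernelOp U (φ l)‖ ^ 2 / (κ l + t) ^ 2) := by
  have hκ := hR.nonneg
  -- The inverse bound is applied to each vector `U* ψ_j`; summation over all `j` then reassembles
  -- `‖U φ_l‖²` by Parseval.
  calc _ ≤ ∑' j, ENNReal.ofReal ((1 + (‖S - R‖ + t) / s) ^ 2) * ∑' l, ENNReal.ofReal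
        ((inner ℝ (φ l) (ContinuousLinearMap.adjoint (kernelOp U) (ψ j)) : ℝ) ^ 2 /
          (κ l + t) ^ 2) := by
        refine ENNReal.tsum_le_tsum fun j => ?_
        exact sum_inner_sq_div_le φ ψ hκ hR.kernelOp_apply hS.kernelOp_apply
          (fun v => by rw [← kernelOp_sub]; exact norm_kernelOp_le _ _) (norm_nonneg _) hs ht hν _
    _ = ENNReal.ofReal ((1 + (‖S - R‖ + t) / s) ^ 2) * ∑' l, ∑' j, ENNReal.ofReal
        ((inner ℝ (φ l) (ContinuousLinearMap.adjoint (kernelOp U) (ψ j)) : ℝ) ^ 2 /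
          (κ l + t) ^ 2) := by rw [ENNReal.tsum_mul_left, ENNReal.tsum_comm]
    _ = _ := by
        congr 1
        refine tsum_congr fun l => ?_
        have hpos : 0 < (κ l + t) ^ 2 := by have := hκ l; positivity
        simp only [ENNReal.ofReal_div_of_pos hpos, ContinuousLinearMap.adjoint_inner_right]
        simp only [div_eq_mul_inv]
        rw [ENNReal.tsum_mul_right, ofReal_norm_sq ψ]
        simp only [ofReal_inner_sq_comm (ψ _)]

end Decomposition

/-! ### Comparison of power sums with integrals. -/

section PowerSums

theorem one_add_mul_sub_le_rpow {r y : ℝ} (hr : r ≤ 0) (hy : 0 < y) :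
    1 + r * (y - 1) ≤ y ^ r := by
  rw [Real.rpow_def_of_pos hy]
  have h₁ := Real.add_one_le_exp (Real.log y * r)
  have h₂ := mul_le_mul_of_nonpos_right (Real.log_le_sub_one_of_pos hy) hr
  linarith

/-- Discrete form of integrating `x^(-p)`: Bernoulli's inequality at `x / (x + 1)` with the negative
exponent `1 - p`. The right side telescopes. -/
theorem sub_one_mul_rpow_neg_le {p x : ℝ} (hp : 1 < p) (hx : 0 < x) :
    (p - 1) * (x + 1) ^ (-p) ≤ x ^ (1 - p) - (x + 1) ^ (1 - p) := by
  have hx1 : 0 < x + 1 := by linarith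
  have hy : 0 < x / (x + 1) := by positivity
  have h := one_add_mul_sub_le_rpow (r := 1 - p) (by linarith) hy
  have h₂ : x ^ (1 - p) = (x + 1) ^ (1 - p) * (x / (x + 1)) ^ (1 - p) := by
    rw [← Real.mul_rpow hx1.le hy.le, mul_div_cancel₀ _ hx1.ne']
  have h₃ : (x + 1) ^ (1 - p) = (x + 1) ^ (-p) * (x + 1) := by
    rw [← Real.rpow_add_one hx1.ne']; congr 1; ring
  have h₄ := mul_le_mul_of_nonneg_left h (Real.rpow_nonneg hx1.le (1 - p))
  rw [← h₂] at h₄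
  have h₅ : (x + 1) ^ (1 - p) * (1 + (1 - p) * (x / (x + 1) - 1)) =
      (x + 1) ^ (1 - p) + (p - 1) * (x + 1) ^ (-p) := by
    rw [h₃]; field_simp; ring
  linarith

theorem summable_add_one_rpow {p : ℝ} (hp : 1 < p) :
    Summable fun l : ℕ => ((l : ℝ) + 1) ^ (-p) := by
  have := (summable_nat_add_iff 1).2 (Real.summable_nat_rpow (p := -p) |>.2 (by linarith))
  simpa using this

theorem tsum_tail_rpow_le {p : ℝ} (hp : 1 < p) {m : ℕ} (hm : 1 ≤ m) :
    ∑' l : ℕ, (((l + m : ℕ) : ℝ) + 1) ^ (-p) ≤ (p - 1)⁻¹ * (m : ℝ) ^ (1 - p) := by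
  have hp' : 0 < p - 1 := by linarith
  have hm' : (1 : ℝ) ≤ m := by exact_mod_cast hm
  refine Real.tsum_le_of_sum_range_le (fun l => by positivity) fun N => ?_
  have h : ∑ l ∈ Finset.range N, (p - 1) * (((l + m : ℕ) : ℝ) + 1) ^ (-p) ≤
      ∑ l ∈ Finset.range N, ((((l + m : ℕ) : ℝ)) ^ (1 - p) - ((l + 1 + m : ℕ) : ℝ) ^ (1 - p)) := by
    refine Finset.sum_le_sum fun l _ => ?_
    have := sub_one_mul_rpow_neg_le (p := p) (x := ((l + m : ℕ) : ℝ)) hp (by push_cast; positivity)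
    rwa [show (l + 1 + m : ℕ) = l + m + 1 by ring, Nat.cast_add_one]
  rw [Finset.sum_range_sub' (fun l => ((l + m : ℕ) : ℝ) ^ (1 - p)), ← Finset.mul_sum] at h
  rw [inv_mul_eq_div, le_div_iff₀ hp', mul_comm]
  have : 0 ≤ ((N + m : ℕ) : ℝ) ^ (1 - p) := by positivity
  rw [zero_add] at h
  linarith

/-- For `r ≥ 1` every term is at most the last one; for `r < 1` Bernoulli's inequality bounds each
term by an increment of `x^r / r`, and the sum telescopes. -/
theorem sum_rpow_sub_one_le {r : ℝ} (hr : 0 < r) {m : ℕ} (hm : 1 ≤ m) :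
    ∑ l ∈ Finset.range m, ((l : ℝ) + 1) ^ (r - 1) ≤ (1 + r⁻¹) * (m : ℝ) ^ r := by
  have hm0 : (0 : ℝ) < m := by exact_mod_cast hm
  have hpos : 0 ≤ (m : ℝ) ^ r := by positivity
  rcases le_or_gt 1 r with h1 | h1
  · have : ∑ l ∈ Finset.range m, ((l : ℝ) + 1) ^ (r - 1) ≤
        ∑ l ∈ Finset.range m, (m : ℝ) ^ (r - 1) := by
      refine Finset.sum_le_sum fun l hl => Real.rpow_le_rpow (by positivity) ?_ (by linarith)
      exact_mod_cast Finset.mem_range.1 hl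
    rw [Finset.sum_const, Finset.card_range, nsmul_eq_mul, mul_comm,
      ← Real.rpow_add_one hm0.ne', sub_add_cancel] at this
    have : 0 ≤ r⁻¹ * (m : ℝ) ^ r := by positivity
    linarith
  · have h : ∑ l ∈ Finset.range m, r * ((l : ℝ) + 1) ^ (r - 1) ≤
        ∑ l ∈ Finset.range m, (((l + 1 : ℕ) : ℝ) ^ r - (l : ℝ) ^ r) := by
      refine Finset.sum_le_sum fun l _ => ?_
      have hx1 : (0 : ℝ) < (l : ℝ) + 1 := by positivity
      have hy : (0 : ℝ) ≤ l / (l + 1) := by positivity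
      have hB := rpow_one_add_le_one_add_mul_self (s := (l : ℝ) / (l + 1) - 1)
        (by linarith) hr.le h1.le
      rw [add_sub_cancel] at hB
      have h₂ : (l : ℝ) ^ r = ((l : ℝ) + 1) ^ r * ((l : ℝ) / (l + 1)) ^ r := by
        rw [← Real.mul_rpow hx1.le hy, mul_div_cancel₀ _ hx1.ne']
      have h₃ : ((l : ℝ) + 1) ^ r = ((l : ℝ) + 1) ^ (r - 1) * (l + 1) := by
        rw [← Real.rpow_add_one hx1.ne', sub_add_cancel]
      have h₄ := mul_le_mul_of_nonneg_left hB (Real.rpow_nonneg hx1.le r)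
      rw [← h₂] at h₄
      have h₅ : ((l : ℝ) + 1) ^ r * (1 + r * ((l : ℝ) / (l + 1) - 1)) =
          ((l : ℝ) + 1) ^ r - r * ((l : ℝ) + 1) ^ (r - 1) := by
        rw [h₃]; field_simp; ring
      push_cast
      linarith
    rw [Finset.sum_range_sub (fun l : ℕ => (l : ℝ) ^ r), ← Finset.mul_sum, Nat.cast_zero,
      Real.zero_rpow hr.ne', sub_zero] at h
    have h' : ∑ l ∈ Finset.range m, ((l : ℝ) + 1) ^ (r - 1) ≤ r⁻¹ * (m : ℝ) ^ r := by
      rw [inv_mul_eq_div, le_div_iff₀ hr, mul_comm]; exact h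
    linarith

/-- The room between `q` and `p` removes the logarithmic case `q = -1`: either the series converges,
or `p > -1` and the sum with exponent `p` dominates. -/
theorem exists_sum_rpow_le {p q : ℝ} (hqp : q < p) :
    ∃ c : ℝ, 0 ≤ c ∧ ∀ m : ℕ, 1 ≤ m →
      ∑ l ∈ Finset.range m, ((l : ℝ) + 1) ^ q ≤ c * (1 + (m : ℝ) ^ (p + 1)) := by
  rcases lt_or_ge q (-1) with hq | hq
  · have hs := summable_add_one_rpow (p := -q) (by linarith)
    rw [neg_neg] at hs
    refine ⟨∑' l : ℕ, ((l : ℝ) + 1) ^ q, tsum_nonneg fun _ => by positivity, fun m _ => ?_⟩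
    have h₁ := hs.sum_le_tsum (Finset.range m) fun _ _ => by positivity
    refine h₁.trans (le_mul_of_one_le_right (tsum_nonneg fun _ => by positivity) ?_)
    have : 0 ≤ (m : ℝ) ^ (p + 1) := by positivity
    linarith
  · have hr : 0 < p + 1 := by linarith
    refine ⟨1 + (p + 1)⁻¹, by positivity, fun m hm => ?_⟩
    have h := sum_rpow_sub_one_le hr hm
    have h₂ : ∑ l ∈ Finset.range m, ((l : ℝ) + 1) ^ q ≤
        ∑ l ∈ Finset.range m, ((l : ℝ) + 1) ^ (p + 1 - 1) := by
      refine Finset.sum_le_sum fun l _ => Real.rpow_le_rpow_of_exponent_le ?_ (by linarith)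
      linarith [Nat.cast_nonneg (α := ℝ) l]
    have : 0 ≤ 1 + (p + 1)⁻¹ := by positivity
    linarith

end PowerSums

/-! ### Consequences of eigenvalue decay and spacing. -/

section Eigenvalues

variable {κ : ℕ → ℝ} {α C : ℝ}

theorem summable_eigenvalue (hα : 1 < α) (hκ₀ : ∀ k, 0 ≤ κ k)
    (hκ : ∀ k : ℕ, κ k ≤ C * ((k : ℝ) + 1) ^ (-α)) : Summable κ :=
  Summable.of_nonneg_of_le hκ₀ hκ ((summable_add_one_rpow hα).mul_left C)

/-- The `m` consecutive gaps starting at index `m - 1` telescope, and each is at least `C⁻¹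
(2m)^(-α-1)`. -/
theorem eigenvalue_ge (hC : 0 < C) (hα : 0 < α) (hκ₀ : ∀ k, 0 ≤ κ k)
    (hgap : ∀ k : ℕ, C⁻¹ * ((k : ℝ) + 1) ^ (-α - 1) ≤ κ k - κ (k + 1)) {m : ℕ} (hm : 1 ≤ m) :
    C⁻¹ * 2 ^ (-α - 1) * (m : ℝ) ^ (-α) ≤ κ (m - 1) := by
  obtain ⟨m, rfl⟩ : ∃ k, m = k + 1 := ⟨m - 1, by omega⟩
  rw [Nat.add_sub_cancel]
  have hM : (0 : ℝ) < (m + 1 : ℕ) := by positivity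
  have h : ∑ i ∈ Finset.range (m + 1), C⁻¹ * (2 * ((m + 1 : ℕ) : ℝ)) ^ (-α - 1) ≤
      ∑ i ∈ Finset.range (m + 1), (κ (m + i) - κ (m + (i + 1))) := by
    refine Finset.sum_le_sum fun i hi => le_trans ?_ (hgap (m + i))
    refine mul_le_mul_of_nonneg_left ?_ (inv_nonneg.2 hC.le)
    refine Real.rpow_le_rpow_of_nonpos (by positivity) ?_ (by linarith)
    have : (i : ℝ) ≤ m := by exact_mod_cast Nat.lt_succ_iff.1 (Finset.mem_range.1 hi)
    push_cast
    linarith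
  rw [Finset.sum_range_sub' (fun i => κ (m + i)), Finset.sum_const, Finset.card_range,
    nsmul_eq_mul, add_zero, Real.mul_rpow (by norm_num) hM.le] at h
  have h₂ : ((m + 1 : ℕ) : ℝ) ^ (-α) = ((m + 1 : ℕ) : ℝ) ^ (-α - 1) * ((m + 1 : ℕ) : ℝ) := by
    rw [← Real.rpow_add_one hM.ne', sub_add_cancel]
  rw [h₂]
  linarith [hκ₀ (m + (m + 1))]

/-- With `t = m^(-α)`, each of the first `m` terms is at most `1 / t`, because `κ t ≤ (κ + t)²`; the
later terms are at most `κ l / t²`, and their sum is at most of order `m^(2α) m^(1-α)`. Both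
contributions are at most of order `m^(α+1)`. -/
theorem exists_tsum_eigenvalue_div_le (hα : 1 < α) (hC : 0 < C) (hκ₀ : ∀ k, 0 ≤ κ k)
    (hκ : ∀ k : ℕ, κ k ≤ C * ((k : ℝ) + 1) ^ (-α)) :
    ∃ c : ℝ, 0 ≤ c ∧ ∀ m : ℕ, 1 ≤ m →
      ∑' l, ENNReal.ofReal (κ l / (κ l + (m : ℝ) ^ (-α)) ^ 2) ≤
        ENNReal.ofReal (c * (m : ℝ) ^ (α + 1)) := by
  refine ⟨1 + C * (α - 1)⁻¹, by have : 0 < α - 1 := by linarith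
                                positivity, fun m hm => ?_⟩
  have hm0 : (0 : ℝ) < m := by exact_mod_cast hm
  set t := (m : ℝ) ^ (-α) with ht
  have ht0 : 0 < t := by positivity
  have hbound₂ : ∀ l, κ l / (κ l + t) ^ 2 ≤ κ l / t ^ 2 := fun l => by
    have := hκ₀ l
    gcongr
    linarith
  have hnn : ∀ l, 0 ≤ κ l / (κ l + t) ^ 2 := fun l => by have := hκ₀ l; positivity
  have hsum : Summable fun l => κ l / (κ l + t) ^ 2 :=
    Summable.of_nonneg_of_le hnn hbound₂ ((summable_eigenvalue hα hκ₀ hκ).div_const _)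
  rw [← ENNReal.ofReal_tsum_of_nonneg hnn hsum]
  refine ENNReal.ofReal_le_ofReal ?_
  rw [← hsum.sum_add_tsum_nat_add m, add_mul, one_mul]
  have htinv : t⁻¹ = (m : ℝ) ^ α := by rw [ht, Real.rpow_neg hm0.le, inv_inv]
  refine add_le_add ?_ ?_
  · have : ∀ l ∈ Finset.range m, κ l / (κ l + t) ^ 2 ≤ (m : ℝ) ^ α := fun l _ => by
      have hl := hκ₀ l
      rw [← htinv, div_le_iff₀ (by positivity), inv_mul_eq_div, le_div_iff₀ ht0]
      nlinarith
    refine (Finset.sum_le_sum this).trans ?_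
    rw [Finset.sum_const, Finset.card_range, nsmul_eq_mul, Real.rpow_add_one hm0.ne', mul_comm]
  · have h₁ : ∑' l, κ (l + m) / (κ (l + m) + t) ^ 2 ≤
        ∑' l : ℕ, C * (t⁻¹) ^ 2 * (((l + m : ℕ) : ℝ) + 1) ^ (-α) := by
      refine Summable.tsum_le_tsum (fun l => (hbound₂ _).trans ?_)
        ((summable_nat_add_iff m).2 hsum)
        (((summable_nat_add_iff m).2 (summable_add_one_rpow hα)).mul_left _)
      rw [div_eq_mul_inv, inv_pow]
      have := mul_le_mul_of_nonneg_right (hκ (l + m)) (inv_nonneg.2 (sq_nonneg t))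
      linarith
    rw [tsum_mul_left] at h₁
    refine h₁.trans ((mul_le_mul_of_nonneg_left (tsum_tail_rpow_le hα hm)
      (by positivity)).trans (le_of_eq ?_))
    rw [htinv, ← Real.rpow_natCast, ← Real.rpow_mul hm0.le]
    have : (m : ℝ) ^ (α + 1) = (m : ℝ) ^ (α * (2 : ℕ)) * (m : ℝ) ^ (1 - α) := by
      rw [← Real.rpow_add hm0]; congr 1; push_cast; ring
    rw [this]
    ring

end Eigenvalues

/-! ### Error bounds on the event of a small perturbation. -/

section Deterministic

/-- Tail bound for a family of vectors with polynomially decaying coefficients, in the basis of a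
perturbed spectral system. -/
theorem exists_tail_bound {K : L2II} {κ : ℕ → ℝ} {φ : HilbertBasis ℕ ℝ L2I} {α p q C : ℝ}
    (hK : IsSpectralSystem K κ φ) (hα : 1 < α) (hp : 1 / 2 < p) (hq : 1 / 2 < q) (hC : 1 < C)
    (hgap : ∀ k : ℕ, C⁻¹ * ((k : ℝ) + 1) ^ (-α - 1) ≤ κ k - κ (k + 1)) {v : ℕ → L2I}
    (hv : ∀ l k : ℕ, |(inner ℝ (φ l) (v k) : ℝ)| ≤
      C * ((l : ℝ) + 1) ^ (-p) * ((k : ℝ) + 1) ^ (-q)) :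
    ∃ c : ℝ, 0 < c ∧ ∀ (m M : ℕ) (R : L2II) (ν : ℕ → ℝ) (ψ : HilbertBasis ℕ ℝ L2I) (Q : ℕ → ℝ),
      1 ≤ m → m ≤ M → IsSpectralSystem R ν ψ → ‖R - K‖ ≤ (2 * C)⁻¹ * (M : ℝ) ^ (-α - 1) →
      (∀ l, ‖kernelOp (R - K) (φ l)‖ ^ 2 ≤ 2 * Q l) →
      ∑' k, ENNReal.ofReal (‖tailProj ψ m (v k)‖ ^ 2) ≤ ENNReal.ofReal c *
        (ENNReal.ofReal (m * ∑ l ∈ Finset.range m, ((l : ℝ) + 1) ^ (2 * α + 2 - 2 * p) * Q l) +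
          ENNReal.ofReal ((m : ℝ) ^ (-2 * p + 1))) := by
  have hC0 : 0 < C := by linarith
  have hsq : ∀ (k : ℕ) (r : ℝ), (((k : ℝ) + 1) ^ (-r)) ^ 2 = ((k : ℝ) + 1) ^ (-(2 * r)) := by
    intro k r
    rw [← Real.rpow_natCast, ← Real.rpow_mul (by positivity)]
    congr 1; push_cast; ring
  have hsp := summable_add_one_rpow (p := 2 * p) (by linarith)
  have hsq' := summable_add_one_rpow (p := 2 * q) (by linarith)
  have hv2 : ∀ l k, (inner ℝ (φ l) (v k) : ℝ) ^ 2 ≤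
      (C ^ 2 * ((l : ℝ) + 1) ^ (-(2 * p))) * ((k : ℝ) + 1) ^ (-(2 * q)) := by
    intro l k
    have := pow_le_pow_left₀ (abs_nonneg _) (hv l k) 2
    rwa [sq_abs, mul_pow, mul_pow, hsq, hsq] at this
  set Z := ∑' k : ℕ, ((k : ℝ) + 1) ^ (-(2 * q)) with hZ
  have hZ0 : 0 < Z := hsq'.tsum_pos (fun _ => by positivity) 0 (by positivity)
  have hp' : 0 < 2 * p - 1 := by linarith
  -- The first summand comes from the tail in the population basis. The second is `2 · C² · 4C² ·
  -- 2`: the splitting of the tail, the squared coefficient bound, the squared inverse gap, and the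
  -- factor in `hQ`.
  refine ⟨Z * (2 * C ^ 2 * (2 * p - 1)⁻¹ + 16 * C ^ 4), by positivity, ?_⟩
  intro m M R ν ψ Q hm hmM hR hd hQ
  have hm0 : (0 : ℝ) < m := by exact_mod_cast hm
  have hQ0 : ∀ l, 0 ≤ Q l := fun l => by have := (sq_nonneg _).trans (hQ l); linarith
  have hS0 : 0 ≤ m * ∑ l ∈ Finset.range m, ((l : ℝ) + 1) ^ (2 * α + 2 - 2 * p) * Q l :=
    mul_nonneg hm0.le (Finset.sum_nonneg fun l _ => mul_nonneg (by positivity) (hQ0 l))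
  rw [← ENNReal.ofReal_add hS0 (by positivity), ← ENNReal.ofReal_mul (by positivity)]
  refine (tsum_norm_tailProj_sq_le φ ψ m v (hsp.mul_left _) hsq' hv2).trans
    (ENNReal.ofReal_le_ofReal ?_)
  rw [← hZ, mul_assoc Z]
  refine mul_le_mul_of_nonneg_left ?_ hZ0.le
  have h₁ : ∑' l : ℕ, C ^ 2 * (((l + m : ℕ) : ℝ) + 1) ^ (-(2 * p)) ≤
      C ^ 2 * ((2 * p - 1)⁻¹ * (m : ℝ) ^ (-2 * p + 1)) := by
    rw [tsum_mul_left]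
    refine mul_le_mul_of_nonneg_left ?_ (by positivity)
    refine (tsum_tail_rpow_le (p := 2 * p) (by linarith) hm).trans_eq ?_
    congr 2; ring
  have h₂ : ∑ l ∈ Finset.range m, C ^ 2 * ((l : ℝ) + 1) ^ (-(2 * p)) *
      ‖tailProj ψ m (φ l)‖ ^ 2 ≤
      8 * C ^ 4 * ∑ l ∈ Finset.range m, ((l : ℝ) + 1) ^ (2 * α + 2 - 2 * p) * Q l := by
    rw [Finset.mul_sum]
    refine Finset.sum_le_sum fun l hl => ?_
    have hlm := Finset.mem_range.1 hl
    have hl0 : (0 : ℝ) < (l : ℝ) + 1 := by positivity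
    set g := C⁻¹ * ((l : ℝ) + 1) ^ (-α - 1) with hg
    have hg0 : 0 < g := by positivity
    have hgκ : g ≤ κ l - κ m := by
      have := hK.antitone (show l + 1 ≤ m from hlm)
      linarith [hgap l]
    -- The assumed closeness is half the lower bound for the gap at level `M`, and `l + 1 ≤ m ≤ M`
    -- makes the gap at `l` at least as large.
    have hdg : ‖R - K‖ ≤ g / 2 := by
      refine hd.trans ?_
      have : (M : ℝ) ^ (-α - 1) ≤ ((l : ℝ) + 1) ^ (-α - 1) := by
        refine Real.rpow_le_rpow_of_nonpos hl0 ?_ (by linarith)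
        exact_mod_cast (show l + 1 ≤ M by omega)
      have := mul_le_mul_of_nonneg_left this (show 0 ≤ (2 * C)⁻¹ by positivity)
      refine this.trans_eq ?_
      rw [hg, mul_inv]; ring
    have hT := norm_tailProj_eigenvector_le φ ψ hK.antitone hR.antitone hK.kernelOp_apply
      hR.kernelOp_apply (fun w => by rw [← kernelOp_sub]; exact norm_kernelOp_le _ _) hg0 hgκ hdg
    rw [← kernelOp_sub] at hT
    have hT' := hT.trans (mul_le_mul_of_nonneg_left (hQ l) (sq_nonneg _))
    have hg2 : (2 / g) ^ 2 = 4 * C ^ 2 * ((l : ℝ) + 1) ^ (2 * α + 2) := by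
      have : ((l : ℝ) + 1) ^ (2 * α + 2) = ((((l : ℝ) + 1) ^ (-α - 1))⁻¹) ^ 2 := by
        rw [← Real.rpow_neg hl0.le, ← Real.rpow_natCast, ← Real.rpow_mul hl0.le]
        congr 1; push_cast; ring
      rw [this, hg, div_pow, mul_pow, inv_pow, inv_pow]
      field_simp
      norm_num
    have hexp : ((l : ℝ) + 1) ^ (2 * α + 2 - 2 * p) =
        ((l : ℝ) + 1) ^ (-(2 * p)) * ((l : ℝ) + 1) ^ (2 * α + 2) := by
      rw [← Real.rpow_add hl0]; congr 1; ring
    rw [hg2] at hT'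
    refine (mul_le_mul_of_nonneg_left hT' (by positivity)).trans_eq ?_
    rw [hexp]; ring
  have h₃ := mul_le_mul_of_nonneg_left h₂ hm0.le
  have hA : 0 ≤ (m : ℝ) ^ (-2 * p + 1) := by positivity
  have hB : 0 ≤ 16 * C ^ 4 * (m : ℝ) ^ (-2 * p + 1) := by positivity
  have hD := mul_nonneg (show 0 ≤ 2 * C ^ 2 * (2 * p - 1)⁻¹ by positivity) hS0
  linarith

/-- Deterministic error bound for the estimator when the empirical covariance function is close to
the covariance function. -/
theorem exists_error_bound {K b : L2II} {κ : ℕ → ℝ} {φ : HilbertBasis ℕ ℝ L2I} {α β γ C : ℝ}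
    (hK : IsSpectralSystem K κ φ) (hα : 1 < α) (hβ : 1 / 2 < β) (hγ : 1 / 2 < γ) (hC : 1 < C)
    (hgap : ∀ k : ℕ, C⁻¹ * ((k : ℝ) + 1) ^ (-α - 1) ≤ κ k - κ (k + 1))
    (hb : ∀ j k : ℕ, |coeff b φ j k| ≤ C * ((j : ℝ) + 1) ^ (-γ) * ((k : ℝ) + 1) ^ (-β))
    (μX μY : L2I) :
    ∃ c δ : ℝ, 0 < c ∧ 0 < δ ∧ ∀ (n m₁ m₂ : ℕ) (x y : ℕ → L2I) (ν : ℕ → ℝ)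
      (ψ : HilbertBasis ℕ ℝ L2I) (Q : ℕ → ℝ), 1 ≤ m₁ → 1 ≤ m₂ →
      IsSpectralSystem (empCovKernel n x) ν ψ →
      ‖empCovKernel n x - K‖ ≤ δ * ((max m₁ m₂ : ℕ) : ℝ) ^ (-α - 1) →
      (∀ l, ‖kernelOp (empCovKernel n x - K) (φ l)‖ ^ 2 ≤ 2 * Q l) →
      (∀ l, ‖kernelOp (crossCov n x fun i => residual μX μY b (x i) (y i)) (φ l)‖ ^ 2 ≤
        2 * Q l) →
      ENNReal.ofReal (‖doubleTruncEst n m₁ m₂ x y ν ψ - b‖ ^ 2) ≤ ENNReal.ofReal c *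
        ((∑' l, ENNReal.ofReal (Q l / (κ l + (m₂ : ℝ) ^ (-α)) ^ 2)) +
        (ENNReal.ofReal (m₁ * ∑ l ∈ Finset.range m₁, ((l : ℝ) + 1) ^ (2 * α + 2 - 2 * γ) * Q l) +
          ENNReal.ofReal ((m₁ : ℝ) ^ (-2 * γ + 1))) +
        (ENNReal.ofReal (m₂ * ∑ l ∈ Finset.range m₂, ((l : ℝ) + 1) ^ (2 * α + 2 - 2 * β) * Q l) +
          ENNReal.ofReal ((m₂ : ℝ) ^ (-2 * β + 1)))) := by
  have hC0 : 0 < C := by linarith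
  obtain ⟨c₁, hc₁, H₁⟩ := exists_tail_bound (v := fun k => kernelOp b (φ k)) hK hα hγ hβ hC hgap
    fun l k => by rw [inner_kernelOp]; exact hb l k
  obtain ⟨c₂, hc₂, H₂⟩ := exists_tail_bound
    (v := fun k => ContinuousLinearMap.adjoint (kernelOp b) (φ k)) hK hα hβ hγ hC hgap
    fun l k => by
      rw [ContinuousLinearMap.adjoint_inner_right, real_inner_comm, inner_kernelOp]
      refine (hb k l).trans_eq ?_
      ring
  set a := C⁻¹ * 2 ^ (-α - 1) with ha
  have ha0 : 0 < a := by positivity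
  set c₃ := 2 * (1 + (a / 2 + 1) / (a / 2)) ^ 2 with hc₃
  have hc₃0 : 0 < c₃ := by positivity
  -- In `δ`, `(2C)⁻¹` serves the eigenvector perturbation and `a / 2` keeps the leading empirical
  -- eigenvalues above half of the bound `a m₂^(-α)`. With `s = (a/2) t` and `d ≤ (a/2) t`, the
  -- prefactor of the noise is at most `c₃ / 2`.
  refine ⟨max (max c₁ c₂) c₃, min (2 * C)⁻¹ (a / 2), by positivity, by positivity, ?_⟩
  intro n m₁ m₂ x y ν ψ Q hm₁ hm₂ hν hd hQ hU
  have hm₂0 : (0 : ℝ) < m₂ := by exact_mod_cast hm₂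
  set M := max m₁ m₂ with hM
  have hM0 : (0 : ℝ) < M := hm₂0.trans_le (by exact_mod_cast le_max_right _ _)
  have hd₁ : ‖empCovKernel n x - K‖ ≤ (2 * C)⁻¹ * (M : ℝ) ^ (-α - 1) :=
    hd.trans (mul_le_mul_of_nonneg_right (min_le_left _ _) (by positivity))
  set t := (m₂ : ℝ) ^ (-α) with ht
  have ht0 : 0 < t := by positivity
  have hd₂ : ‖empCovKernel n x - K‖ ≤ a / 2 * t := by
    refine hd.trans (mul_le_mul (min_le_right _ _) ?_ (by positivity) (by positivity))
    calc (M : ℝ) ^ (-α - 1) ≤ (m₂ : ℝ) ^ (-α - 1) :=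
          Real.rpow_le_rpow_of_nonpos hm₂0 (by exact_mod_cast le_max_right _ _) (by linarith)
      _ ≤ t := Real.rpow_le_rpow_of_exponent_le (by exact_mod_cast hm₂) (by linarith)
  -- Weyl's inequality with the roles of the two operators exchanged, at the last retained index `m₂
  -- - 1`.
  have hνlow : ∀ k < m₂, a / 2 * t ≤ ν k := by
    intro k hk
    have h₁ := eigenvalue_ge hC0 (by linarith) hK.nonneg hgap hm₂
    have h₂ := eigenvalue_le_add ψ φ hν.antitone hK.antitone hν.kernelOp_apply hK.kernelOp_apply
      (d := ‖empCovKernel n x - K‖)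
      (fun w => by
        rw [norm_sub_rev, ← kernelOp_sub]; exact norm_kernelOp_le _ _) (m₂ - 1)
    have h₃ := hν.antitone (show k ≤ m₂ - 1 by omega)
    rw [← ha, ← ht] at h₁
    linarith
  have hs0 : 0 < a / 2 * t := by positivity
  have hdec := ofReal_norm_doubleTruncEst_sub_sq_le (m₁ := m₁) (m₂ := m₂) (y := y) hν μX μY b φ
    fun k hk => (hs0.trans_le (hνlow k hk)).ne'
  refine hdec.trans ?_
  rw [mul_add, mul_add]
  have hmono : ∀ {c : ℝ}, c ≤ max (max c₁ c₂) c₃ → ∀ A : ENNReal,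
      ENNReal.ofReal c * A ≤ ENNReal.ofReal (max (max c₁ c₂) c₃) * A := fun h A =>
    mul_le_mul_left (ENNReal.ofReal_le_ofReal h) A
  refine add_le_add (add_le_add ?_ ?_) ?_
  · refine le_trans ?_ (hmono (le_max_right _ _) _)
    refine (tsum_noise_le φ ψ hK hν _ hs0 ht0 hνlow).trans ?_
    have h₁ : (1 + (‖empCovKernel n x - K‖ + t) / (a / 2 * t)) ^ 2 ≤
        (1 + (a / 2 + 1) / (a / 2)) ^ 2 := by
      have : (‖empCovKernel n x - K‖ + t) / (a / 2 * t) ≤ (a / 2 + 1) / (a / 2) := by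
        rw [div_le_div_iff₀ hs0 (by positivity)]
        nlinarith
      gcongr
    have h₂ : ∑' l, ENNReal.ofReal (‖kernelOp (crossCov n x fun i =>
        residual μX μY b (x i) (y i)) (φ l)‖ ^ 2 / (κ l + t) ^ 2) ≤
        ENNReal.ofReal 2 * ∑' l, ENNReal.ofReal (Q l / (κ l + t) ^ 2) := by
      rw [← ENNReal.tsum_mul_left]
      refine ENNReal.tsum_le_tsum fun l => ?_
      rw [← ENNReal.ofReal_mul (by norm_num), ← mul_div_assoc]
      exact ENNReal.ofReal_le_ofReal (div_le_div_of_nonneg_right (hU l) (sq_nonneg _))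
    refine (mul_le_mul' (ENNReal.ofReal_le_ofReal h₁) h₂).trans_eq ?_
    rw [← mul_assoc, ← ENNReal.ofReal_mul (by positivity), hc₃, mul_comm (2 : ℝ)]
  · exact (H₁ m₁ M _ ν ψ Q hm₁ (le_max_left _ _) hν hd₁ hQ).trans
      (hmono ((le_max_left _ _).trans (le_max_left _ _)) _)
  · exact (H₂ m₂ M _ ν ψ Q hm₂ (le_max_right _ _) hν hd₁ hQ).trans
      (hmono ((le_max_right _ _).trans (le_max_left _ _)) _)

end Deterministic

/-! ### Mean square error of Hilbert-space sample means. -/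

section SampleMoments

variable {Ω S H : Type*} [MeasurableSpace Ω] [MeasurableSpace S] [NormedAddCommGroup H]
  [InnerProductSpace ℝ H] [CompleteSpace H]

theorem integral_norm_sub_integral_sq_le {ρ : Measure S} [IsProbabilityMeasure ρ] {g : S → H}
    (hg : MemLp g 2 ρ) : ∫ z, ‖g z - ∫ w, g w ∂ρ‖ ^ 2 ∂ρ ≤ ∫ z, ‖g z‖ ^ 2 ∂ρ := by
  set c := ∫ w, g w ∂ρ with hc
  have hi : Integrable g ρ := hg.integrable (by norm_num)
  have hin : Integrable (fun z => (inner ℝ c (g z) : ℝ)) ρ := hi.const_inner c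
  have hsq : Integrable (fun z => ‖g z‖ ^ 2) ρ := hg.integrable_norm_pow (by norm_num)
  have hEq : ∀ z, ‖g z - c‖ ^ 2 = ‖g z‖ ^ 2 - 2 * inner ℝ c (g z) + ‖c‖ ^ 2 := fun z => by
    rw [norm_sub_sq_real, real_inner_comm]
  have h₁ : ∫ z, ‖g z - c‖ ^ 2 ∂ρ = ∫ z, (‖g z‖ ^ 2 - 2 * inner ℝ c (g z)) ∂ρ + ∫ _, ‖c‖ ^ 2 ∂ρ := by
    simp only [hEq]
    exact integral_add (hsq.sub (hin.const_mul 2)) (integrable_const _)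
  have h₂ : ∫ z, (‖g z‖ ^ 2 - 2 * inner ℝ c (g z)) ∂ρ = ∫ z, ‖g z‖ ^ 2 ∂ρ - 2 * ‖c‖ ^ 2 := by
    rw [integral_sub hsq (hin.const_mul 2), integral_const_mul, integral_inner hi, ← hc,
      real_inner_self_eq_norm_sq]
  rw [h₁, h₂, integral_const, probReal_univ, one_smul]
  linarith [sq_nonneg ‖c‖]

/-- The mean square error of a sample mean. -/
theorem lintegral_norm_mean_sub_sq_le {P : Measure Ω} [IsProbabilityMeasure P] {W : ℕ → Ω → S}
    {ρ : Measure S} [IsProbabilityMeasure ρ] (hW : iIndepFun W P) (hm : ∀ i, AEMeasurable (W i) P)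
    (hρ : ∀ i, P.map (W i) = ρ) {g : S → H} (hg : MemLp g 2 ρ) {s : ℝ}
    (hs : ∫ z, ‖g z‖ ^ 2 ∂ρ ≤ s) {n : ℕ} (hn : 1 ≤ n) :
    ∫⁻ ω, ENNReal.ofReal (‖(n : ℝ)⁻¹ • ∑ i ∈ Finset.range n, g (W i ω) - ∫ z, g z ∂ρ‖ ^ 2) ∂P ≤
      ENNReal.ofReal (s / n) := by
  set c := ∫ z, g z ∂ρ with hc
  have hn0 : (n : ℝ) ≠ 0 := by positivity
  have hf : MemLp (fun z => g z - c) 2 ρ := hg.sub (memLp_const c)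
  have hZ : ∀ i, MemLp (fun ω => g (W i ω) - c) 2 P := fun i =>
    MemLp.comp_of_map (g := fun z => g z - c) (by rw [hρ]; exact hf) (hm i)
  have hfint : Integrable (fun z => g z - c) ρ := hf.integrable (by norm_num)
  have hZint : ∀ i, ∫ ω, (g (W i ω) - c) ∂P = 0 := by
    intro i
    have := integral_map (hm i) (f := fun z => g z - c) (by rw [hρ]; exact hf.1)
    rw [← this, hρ, integral_sub (hg.integrable (by norm_num)) (integrable_const _)]
    simp [hc]
  -- Independent centred vectors are orthogonal in mean, so only the `n` diagonal terms survive the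
  -- expansion of the square.
  have hcross : ∀ i j, i ≠ j →
      ∫ ω, (inner ℝ (g (W i ω) - c) (g (W j ω) - c) : ℝ) ∂P = 0 := by
    intro i j hij
    have := (hW.indepFun hij).integral_bilin_comp_comp (hm i) (hm j)
      (f := fun z => g z - c) (g := fun z => g z - c) (by rw [hρ]; exact hfint)
      (by rw [hρ]; exact hfint) (innerSL ℝ)
    refine this.trans ?_
    rw [hZint, map_zero]
    rfl
  have hdiag : ∀ i, ∫ ω, (inner ℝ (g (W i ω) - c) (g (W i ω) - c) : ℝ) ∂P ≤ s := by
    intro i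
    simp only [real_inner_self_eq_norm_sq]
    have := integral_map (hm i) (f := fun z => ‖g z - c‖ ^ 2)
      (by rw [hρ]; exact hf.1.norm.pow 2)
    rw [← this, hρ]
    exact (integral_norm_sub_integral_sq_le hg).trans hs
  have hmean : ∀ ω, (n : ℝ)⁻¹ • ∑ i ∈ Finset.range n, g (W i ω) - c =
      (n : ℝ)⁻¹ • ∑ i ∈ Finset.range n, (g (W i ω) - c) := by
    intro ω
    rw [Finset.sum_sub_distrib, smul_sub, Finset.sum_const, Finset.card_range,
      ← Nat.cast_smul_eq_nsmul ℝ, smul_smul, inv_mul_cancel₀ hn0, one_smul]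
  simp only [hmean]
  have hsumLp : MemLp (fun ω => (n : ℝ)⁻¹ • ∑ i ∈ Finset.range n, (g (W i ω) - c)) 2 P :=
    (memLp_finsetSum _ fun i _ => hZ i).const_smul _
  rw [← ofReal_integral_eq_lintegral_ofReal (hsumLp.integrable_norm_pow (by norm_num))
    (Eventually.of_forall fun _ => sq_nonneg _)]
  refine ENNReal.ofReal_le_ofReal ?_
  have hexp : ∀ ω, ‖(n : ℝ)⁻¹ • ∑ i ∈ Finset.range n, (g (W i ω) - c)‖ ^ 2 =
      ((n : ℝ)⁻¹) ^ 2 * ∑ i ∈ Finset.range n, ∑ j ∈ Finset.range n,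
        inner ℝ (g (W i ω) - c) (g (W j ω) - c) := by
    intro ω
    rw [norm_smul, mul_pow, Real.norm_eq_abs, sq_abs, ← real_inner_self_eq_norm_sq, sum_inner]
    simp only [inner_sum]
  have hint : ∀ i j, Integrable (fun ω => (inner ℝ (g (W i ω) - c) (g (W j ω) - c) : ℝ)) P :=
    fun i j => Integrable.mono' ((hZ i).norm.integrable_mul (hZ j).norm)
      ((hZ i).1.inner (hZ j).1) (Eventually.of_forall fun ω => norm_inner_le_norm _ _)
  simp only [hexp]
  rw [integral_const_mul, integral_finsetSum _ fun i _ => integrable_finsetSum _ fun j _ => hint i j]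
  have h₁ : ∀ i ∈ Finset.range n, ∫ ω, ∑ j ∈ Finset.range n,
      (inner ℝ (g (W i ω) - c) (g (W j ω) - c) : ℝ) ∂P ≤ s := by
    intro i hi
    rw [integral_finsetSum _ fun j _ => hint i j, Finset.sum_eq_single_of_mem i hi]
    · exact hdiag i
    · exact fun j _ hj => hcross i j hj.symm
  have h₂ := Finset.sum_le_sum h₁
  rw [Finset.sum_const, Finset.card_range, nsmul_eq_mul] at h₂
  refine (mul_le_mul_of_nonneg_left h₂ (sq_nonneg _)).trans_eq ?_
  field_simp

end SampleMoments

/-! ### Moments of scores and residuals. -/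

section PopulationMoments

variable {Ω : Type*} [MeasurableSpace Ω] {P : Measure Ω}
  {X Y : Ω → L2I} {b : L2II} {κ : ℕ → ℝ} {φ : HilbertBasis ℕ ℝ L2I} {α β γ C : ℝ}

theorem memLp_centered [IsProbabilityMeasure P] (hX : MemLp X 2 P) :
    MemLp (fun ω => X ω - meanFn P X) 2 P :=
  hX.sub (memLp_const _)

theorem integral_centered [IsProbabilityMeasure P] (hX : MemLp X 2 P) :
    ∫ ω, (X ω - meanFn P X) ∂P = 0 := by
  rw [integral_sub (hX.integrable (by norm_num)) (integrable_const _)]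
  simp [meanFn]

theorem integrable_tensor_centered [IsProbabilityMeasure P] (hX : MemLp X 2 P) :
    Integrable (fun ω => tensor (X ω - meanFn P X) (X ω - meanFn P X)) P := by
  have h := memLp_centered hX
  refine Integrable.mono' (h.integrable_norm_pow (by norm_num))
    (continuous_tensor.comp_aestronglyMeasurable (h.1.prodMk h.1)) (Eventually.of_forall fun ω => ?_)
  rw [norm_tensor, sq]

theorem memLp_score [IsProbabilityMeasure P] (hX : MemLp X 2 P) (k : ℕ) :
    MemLp (score P X φ k) 2 P :=
  (memLp_centered hX).const_inner (φ k)

theorem inner_tensor_covKernel [IsProbabilityMeasure P] (hX : MemLp X 2 P) (f g : L2I) :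
    inner ℝ (tensor f g) (covKernel P X) =
      ∫ ω, (inner ℝ f (X ω - meanFn P X) : ℝ) * inner ℝ g (X ω - meanFn P X) ∂P := by
  rw [covKernel, ← integral_inner (integrable_tensor_centered hX)]
  simp only [inner_tensor_tensor]

theorem integral_score_sq [IsProbabilityMeasure P] (hX : MemLp X 2 P)
    (hspec : IsSpectralSystem (covKernel P X) κ φ) (k : ℕ) :
    ∫ ω, score P X φ k ω ^ 2 ∂P = κ k := by
  have h₁ := inner_tensor_covKernel hX (φ k) (φ k)
  rw [← inner_kernelOp, hspec.kernelOp_apply, inner_smul_right, real_inner_self_eq_norm_sq,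
    φ.orthonormal.1, one_pow, mul_one] at h₁
  rw [h₁]
  exact integral_congr_ae (Eventually.of_forall fun ω => by simp [score, sq])

theorem lintegral_score_sq [IsProbabilityMeasure P] (hX : MemLp X 2 P)
    (hspec : IsSpectralSystem (covKernel P X) κ φ) (k : ℕ) :
    ∫⁻ ω, ENNReal.ofReal (score P X φ k ω ^ 2) ∂P = ENNReal.ofReal (κ k) := by
  rw [← integral_score_sq hX hspec, ofReal_integral_eq_lintegral_ofReal
    (memLp_score hX k).integrable_sq (Eventually.of_forall fun _ => sq_nonneg _)]

theorem IsRegular.eigenvalue_pos (hreg : IsRegular P X Y b κ φ α β γ C)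
    (hspec : IsSpectralSystem (covKernel P X) κ φ) (k : ℕ) : 0 < κ k := by
  have h₁ := hreg.eigenvalue_gap k
  have h₂ := hspec.nonneg (k + 1)
  have hC : 0 < C := by linarith [hreg.one_lt_C]
  have : 0 < C⁻¹ * ((k : ℝ) + 1) ^ (-α - 1) := by positivity
  linarith

/-- The arithmetic–geometric mean inequality, with weights balanced by the positive eigenvalues,
reduces the mixed moment to the two fourth moments and yields the product `κ j κ k`. -/
theorem lintegral_score_sq_mul_score_sq_le (hreg : IsRegular P X Y b κ φ α β γ C)
    (hspec : IsSpectralSystem (covKernel P X) κ φ) (j k : ℕ) :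
    ∫⁻ ω, ENNReal.ofReal (score P X φ j ω ^ 2 * score P X φ k ω ^ 2) ∂P ≤
      ENNReal.ofReal (C * κ j * κ k) := by
  have hj := hreg.eigenvalue_pos hspec j
  have hk := hreg.eigenvalue_pos hspec k
  have hjne := hj.ne'
  have hkne := hk.ne'
  have hint : Integrable (fun ω => κ k / (2 * κ j) * score P X φ j ω ^ 4 +
      κ j / (2 * κ k) * score P X φ k ω ^ 4) P :=
    ((hreg.score_integrable j).const_mul _).add ((hreg.score_integrable k).const_mul _)
  calc _ ≤ ∫⁻ ω, ENNReal.ofReal (κ k / (2 * κ j) * score P X φ j ω ^ 4 +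
      κ j / (2 * κ k) * score P X φ k ω ^ 4) ∂P := by
        refine lintegral_mono fun ω => ENNReal.ofReal_le_ofReal ?_
        set a := score P X φ j ω
        set c := score P X φ k ω
        have h : 0 ≤ κ j * κ k / 2 * (a ^ 2 / κ j - c ^ 2 / κ k) ^ 2 := by positivity
        have : κ j * κ k / 2 * (a ^ 2 / κ j - c ^ 2 / κ k) ^ 2 =
          κ k / (2 * κ j) * a ^ 4 + κ j / (2 * κ k) * c ^ 4 - a ^ 2 * c ^ 2 := by
          field_simp
          ring
        linarith
    _ = ENNReal.ofReal (∫ ω, κ k / (2 * κ j) * score P X φ j ω ^ 4 +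
      κ j / (2 * κ k) * score P X φ k ω ^ 4 ∂P) := by
        rw [ofReal_integral_eq_lintegral_ofReal hint]
        exact Eventually.of_forall fun ω => by positivity
    _ ≤ _ := by
        refine ENNReal.ofReal_le_ofReal ?_
        rw [integral_add ((hreg.score_integrable j).const_mul _)
          ((hreg.score_integrable k).const_mul _), integral_const_mul, integral_const_mul]
        have h₁ := mul_le_mul_of_nonneg_left (hreg.score_moment j)
          (show 0 ≤ κ k / (2 * κ j) by positivity)
        have h₂ := mul_le_mul_of_nonneg_left (hreg.score_moment k)
          (show 0 ≤ κ j / (2 * κ k) by positivity)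
        refine (add_le_add h₁ h₂).trans_eq ?_
        field_simp
        ring

/-- Parseval for `‖X - E X‖²` and summation of the mixed moments over `k`, where `∑ κ k` is finite.
The surviving factor `κ l` is what makes the covariance error small in the direction `φ l`. -/
theorem lintegral_score_sq_mul_norm_sq_le [IsProbabilityMeasure P] (hX : MemLp X 2 P)
    (hreg : IsRegular P X Y b κ φ α β γ C)
    (hspec : IsSpectralSystem (covKernel P X) κ φ) (l : ℕ) :
    ∫⁻ ω, ENNReal.ofReal (score P X φ l ω ^ 2 * ‖X ω - meanFn P X‖ ^ 2) ∂P ≤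
      ENNReal.ofReal (C * (∑' k, κ k) * κ l) := by
  have hκ₀ := hspec.nonneg
  have hC : 0 < C := by linarith [hreg.one_lt_C]
  have hsum := summable_eigenvalue hreg.one_lt_alpha hκ₀ hreg.eigenvalue_le
  have hsc : ∀ k, AEMeasurable (score P X φ k) P := fun k => (memLp_score hX k).1.aemeasurable
  calc _ = ∫⁻ ω, ∑' k, ENNReal.ofReal (score P X φ l ω ^ 2 * score P X φ k ω ^ 2) ∂P := by
        refine lintegral_congr fun ω => ?_
        rw [ENNReal.ofReal_mul (sq_nonneg _), ofReal_norm_sq φ, ← ENNReal.tsum_mul_left]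
        refine tsum_congr fun k => ?_
        rw [ENNReal.ofReal_mul (sq_nonneg _)]
        rfl
    _ = ∑' k, ∫⁻ ω, ENNReal.ofReal (score P X φ l ω ^ 2 * score P X φ k ω ^ 2) ∂P :=
        lintegral_tsum fun k => (((hsc l).pow_const 2).mul ((hsc k).pow_const 2)).ennreal_ofReal
    _ ≤ ∑' k, ENNReal.ofReal (C * κ l * κ k) :=
        ENNReal.tsum_le_tsum fun k => lintegral_score_sq_mul_score_sq_le hreg hspec l k
    _ = _ := by
        rw [← ENNReal.ofReal_tsum_of_nonneg
          (fun k => mul_nonneg (mul_nonneg hC.le (hκ₀ l)) (hκ₀ k)) (hsum.mul_left _),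
          tsum_mul_left]
        congr 1; ring

theorem lintegral_norm_centered_pow_le [IsProbabilityMeasure P] (hX : MemLp X 2 P)
    (hreg : IsRegular P X Y b κ φ α β γ C)
    (hspec : IsSpectralSystem (covKernel P X) κ φ) :
    ∫⁻ ω, ENNReal.ofReal (‖X ω - meanFn P X‖ ^ 2 * ‖X ω - meanFn P X‖ ^ 2) ∂P ≤
      ENNReal.ofReal (C * (∑' k, κ k) ^ 2) := by
  have hκ₀ := hspec.nonneg
  have hC : 0 < C := by linarith [hreg.one_lt_C]
  have hsum := summable_eigenvalue hreg.one_lt_alpha hκ₀ hreg.eigenvalue_le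
  have hsc : ∀ k, AEMeasurable (score P X φ k) P := fun k => (memLp_score hX k).1.aemeasurable
  have hn : AEMeasurable (fun ω => ‖X ω - meanFn P X‖) P := (memLp_centered hX).1.norm.aemeasurable
  calc _ = ∫⁻ ω, ∑' k, ENNReal.ofReal (score P X φ k ω ^ 2 * ‖X ω - meanFn P X‖ ^ 2) ∂P := by
        refine lintegral_congr fun ω => ?_
        rw [ENNReal.ofReal_mul (sq_nonneg _)]
        nth_rewrite 1 [ofReal_norm_sq φ]
        rw [← ENNReal.tsum_mul_right]
        refine tsum_congr fun k => ?_
        rw [ENNReal.ofReal_mul (sq_nonneg _)]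
        rfl
    _ = ∑' k, ∫⁻ ω, ENNReal.ofReal (score P X φ k ω ^ 2 * ‖X ω - meanFn P X‖ ^ 2) ∂P :=
        lintegral_tsum fun k => (((hsc k).pow_const 2).mul (hn.pow_const 2)).ennreal_ofReal
    _ ≤ ∑' k, ENNReal.ofReal (C * (∑' i, κ i) * κ k) :=
        ENNReal.tsum_le_tsum fun k => lintegral_score_sq_mul_norm_sq_le hX hreg hspec k
    _ = _ := by
        have hτ : 0 ≤ C * ∑' i, κ i := mul_nonneg hC.le (tsum_nonneg hκ₀)
        rw [← ENNReal.ofReal_tsum_of_nonneg (fun k => mul_nonneg hτ (hκ₀ k))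
          (hsum.mul_left (C * ∑' i, κ i)), tsum_mul_left, sq, mul_assoc]

theorem condMean_eq (hmodel : IsLinearModel P X Y b) :
    ∀ᵐ ω ∂P, condMean P X Y ω = meanFn P Y + kernelOp b (X ω - meanFn P X) := by
  filter_upwards [hmodel.regression] with ω hω
  rw [← sub_eq_iff_eq_add']
  refine eq_kernelOp_of_ae_eq ?_
  filter_upwards [hω, Lp.coeFn_sub (condMean P X Y ω) (meanFn P Y)] with s h₁ h₂
  rw [h₂, Pi.sub_apply, h₁, add_sub_cancel_left]

theorem residual_ae_eq (hmodel : IsLinearModel P X Y b) :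
    (fun ω => residual (meanFn P X) (meanFn P Y) b (X ω) (Y ω)) =ᵐ[P]
      fun ω => Y ω - condMean P X Y ω := by
  filter_upwards [condMean_eq hmodel] with ω hω
  rw [hω, residual]
  abel

theorem memLp_residual [IsProbabilityMeasure P] (hmodel : IsLinearModel P X Y b) :
    MemLp (fun ω => residual (meanFn P X) (meanFn P Y) b (X ω) (Y ω)) 2 P :=
  (hmodel.memLp_Y.sub (memLp_const _)).sub
    ((kernelOp b).comp_memLp' (memLp_centered hmodel.memLp_X))

theorem comap_le (hmodel : IsLinearModel P X Y b) :
    MeasurableSpace.comap X inferInstance ≤ (inferInstance : MeasurableSpace Ω) :=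
  hmodel.measurable_X.comap_le

theorem condExp_residual [IsProbabilityMeasure P] (hmodel : IsLinearModel P X Y b) :
    P[fun ω => residual (meanFn P X) (meanFn P Y) b (X ω) (Y ω) |
      MeasurableSpace.comap X inferInstance] =ᵐ[P] 0 := by
  have hY : Integrable Y P := hmodel.memLp_Y.integrable (by norm_num)
  have hm := comap_le hmodel
  refine (condExp_congr_ae (residual_ae_eq hmodel)).trans ?_
  refine (condExp_sub hY integrable_condExp _).trans ?_
  rw [condExp_of_stronglyMeasurable hm stronglyMeasurable_condExp integrable_condExp,
    sub_self]

theorem integral_residual [IsProbabilityMeasure P] (hmodel : IsLinearModel P X Y b) :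
    ∫ ω, residual (meanFn P X) (meanFn P Y) b (X ω) (Y ω) ∂P = 0 := by
  rw [← integral_condExp (comap_le hmodel), integral_congr_ae (condExp_residual hmodel)]
  simp

theorem measurable_comap_score (k : ℕ) :
    Measurable[MeasurableSpace.comap X inferInstance] (score P X φ k) := by
  have : score P X φ k = (fun x => (inner ℝ (φ k) (x - meanFn P X) : ℝ)) ∘ X := rfl
  rw [this]
  refine Measurable.comp ?_ (comap_measurable X)
  exact Continuous.measurable (by fun_prop)

/-- The score is a function of `X`, so it can be pulled out of the conditional expectation, and the
residual has conditional mean zero. -/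
theorem integral_score_smul_residual [IsProbabilityMeasure P]
    (hmodel : IsLinearModel P X Y b) (k : ℕ) :
    ∫ ω, score P X φ k ω • residual (meanFn P X) (meanFn P Y) b (X ω) (Y ω) ∂P = 0 := by
  have hr := memLp_residual hmodel
  have hint : Integrable (fun ω => score P X φ k ω •
      residual (meanFn P X) (meanFn P Y) b (X ω) (Y ω)) P :=
    memLp_one_iff_integrable.1 (hr.smul (memLp_score hmodel.memLp_X k))
  have h := condExp_smul_of_aestronglyMeasurable_left (μ := P)
    (m := MeasurableSpace.comap X inferInstance)
    ((measurable_comap_score (P := P) (φ := φ) k).stronglyMeasurable.aestronglyMeasurable) hint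
    (hr.integrable (by norm_num))
  rw [← integral_condExp (comap_le hmodel)]
  refine integral_eq_zero_of_ae ?_
  filter_upwards [h, condExp_residual hmodel] with ω h₁ h₂
  refine h₁.trans ?_
  simp [h₂]

/-- The conditional moment bound is read as an inequality of measures on the σ-field of `X`: the
measure with density `‖e‖²` is at most `C` times `P` there. Any nonnegative `f` measurable for that
σ-field can then be integrated, without integrability of the product. -/
theorem lintegral_mul_norm_residual_sq_le [IsProbabilityMeasure P]
    (hmodel : IsLinearModel P X Y b)
    (hreg : IsRegular P X Y b κ φ α β γ C) {f : Ω → ENNReal}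
    (hf : Measurable[MeasurableSpace.comap X inferInstance] f) :
    ∫⁻ ω, f ω *
      ENNReal.ofReal (‖residual (meanFn P X) (meanFn P Y) b (X ω) (Y ω)‖ ^ 2) ∂P ≤
      ENNReal.ofReal C * ∫⁻ ω, f ω ∂P := by
  have hm := comap_le hmodel
  set e := fun ω => residual (meanFn P X) (meanFn P Y) b (X ω) (Y ω) with he
  have hr : MemLp e 2 P := memLp_residual hmodel
  have hint : Integrable (fun ω => ‖e ω‖ ^ 2) P := hr.integrable_norm_pow (by norm_num)
  have hmeas : AEMeasurable (fun ω => ENNReal.ofReal (‖e ω‖ ^ 2)) P :=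
    hint.1.aemeasurable.ennreal_ofReal
  set ν := P.withDensity fun ω => ENNReal.ofReal (‖e ω‖ ^ 2) with hν
  have hcond : ∀ᵐ ω ∂P, (P[fun ω => ‖e ω‖ ^ 2 | MeasurableSpace.comap X inferInstance]) ω ≤ C := by
    have hcongr : (fun ω => ‖e ω‖ ^ 2) =ᵐ[P] fun ω => ‖Y ω - condMean P X Y ω‖ ^ 2 := by
      filter_upwards [residual_ae_eq hmodel] with ω hω
      rw [he]; simp only [hω]
    filter_upwards [hreg.error_moment, condExp_congr_ae (m := MeasurableSpace.comap X inferInstance)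
      hcongr] with ω h₁ h₂
    rw [h₂]
    exact h₁
  have hle : ν.trim hm ≤ ENNReal.ofReal C • P.trim hm := by
    refine Measure.le_iff.2 fun s hs => ?_
    rw [Measure.smul_apply, trim_measurableSet_eq hm hs, trim_measurableSet_eq hm hs, hν,
      withDensity_apply _ (hm s hs), smul_eq_mul,
      ← ofReal_integral_eq_lintegral_ofReal hint.integrableOn
        (Eventually.of_forall fun _ => sq_nonneg _), ← setIntegral_condExp hm hint hs]
    have : ∫ ω in s, (P[fun ω => ‖e ω‖ ^ 2 | MeasurableSpace.comap X inferInstance]) ω ∂P ≤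
        ∫ _ in s, C ∂P :=
      setIntegral_mono_ae integrable_condExp.integrableOn (integrable_const C).integrableOn hcond
    rw [setIntegral_const, smul_eq_mul, mul_comm] at this
    refine (ENNReal.ofReal_le_ofReal this).trans_eq ?_
    rw [ENNReal.ofReal_mul (by linarith [hreg.one_lt_C]), ofReal_measureReal]
  calc ∫⁻ ω, f ω * ENNReal.ofReal (‖e ω‖ ^ 2) ∂P = ∫⁻ ω, f ω ∂ν := by
        rw [hν, lintegral_withDensity_eq_lintegral_mul₀ hmeas (hf.mono hm le_rfl).aemeasurable]
        simp only [Pi.mul_apply, mul_comm]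
    _ = ∫⁻ ω, f ω ∂(ν.trim hm) := (lintegral_trim hm hf).symm
    _ ≤ ∫⁻ ω, f ω ∂(ENNReal.ofReal C • P.trim hm) := lintegral_mono' hle le_rfl
    _ = _ := by rw [lintegral_smul_measure, lintegral_trim hm hf, smul_eq_mul]

theorem lintegral_norm_score_smul_residual_sq_le [IsProbabilityMeasure P]
    (hmodel : IsLinearModel P X Y b)
    (hspec : IsSpectralSystem (covKernel P X) κ φ)
    (hreg : IsRegular P X Y b κ φ α β γ C) (k : ℕ) :
    ∫⁻ ω, ENNReal.ofReal (‖score P X φ k ω •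
      residual (meanFn P X) (meanFn P Y) b (X ω) (Y ω)‖ ^ 2) ∂P ≤ ENNReal.ofReal (C * κ k) := by
  have h := lintegral_mul_norm_residual_sq_le hmodel hreg
    (f := fun ω => ENNReal.ofReal (score P X φ k ω ^ 2))
    ((measurable_comap_score k).pow_const 2).ennreal_ofReal
  rw [lintegral_score_sq hmodel.memLp_X hspec,
    ← ENNReal.ofReal_mul (by linarith [hreg.one_lt_C])] at h
  refine le_trans (le_of_eq (lintegral_congr fun ω => ?_)) h
  rw [norm_smul, mul_pow, Real.norm_eq_abs, sq_abs, ENNReal.ofReal_mul (sq_nonneg _)]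

end PopulationMoments

/-! ### Recentring empirical covariances at the population mean. -/

section SampleAlgebra

theorem smul_sum_sub_const {n : ℕ} (hn : 1 ≤ n) (x : ℕ → L2I) (μ : L2I) :
    (n : ℝ)⁻¹ • ∑ i ∈ Finset.range n, (x i - μ) = sampleMean n x - μ := by
  have hn0 : (n : ℝ) ≠ 0 := by positivity
  rw [Finset.sum_sub_distrib, smul_sub, Finset.sum_const, Finset.card_range,
    ← Nat.cast_smul_eq_nsmul ℝ, smul_smul, inv_mul_cancel₀ hn0, one_smul, sampleMean]

theorem tensor_sub_left (f f' g : L2I) : tensor (f - f') g = tensor f g - tensor f' g := by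
  simp only [← tensorCLM_apply, map_sub, sub_apply]

theorem tensor_sub_right (f g g' : L2I) : tensor f (g - g') = tensor f g - tensor f g' := by
  simp only [← tensorCLM_apply, map_sub]

theorem tensor_sum_left {ι : Type*} (s : Finset ι) (f : ι → L2I) (g : L2I) :
    tensor (∑ i ∈ s, f i) g = ∑ i ∈ s, tensor (f i) g := by
  simp only [← tensorCLM_apply, map_sum, sum_apply]

/-- Replacing the sample mean by `μ` turns the summands into functions of one observation each, at
the price of a rank-one tensor of sample averages. -/
theorem crossCov_eq (n : ℕ) (x e : ℕ → L2I) (μ : L2I) :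
    crossCov n x e = (n : ℝ)⁻¹ • ∑ i ∈ Finset.range n, tensor (e i) (x i - μ) -
      tensor ((n : ℝ)⁻¹ • ∑ i ∈ Finset.range n, e i) (sampleMean n x - μ) := by
  have h : ∀ i, tensor (e i) (x i - sampleMean n x) =
      tensor (e i) (x i - μ) - tensor (e i) (sampleMean n x - μ) := fun i => by
    rw [← tensor_sub_right]; congr 1; abel
  rw [crossCov, tensor_smul_left, tensor_sum_left, ← smul_sub, ← Finset.sum_sub_distrib]
  simp only [h]

theorem empCovKernel_eq {n : ℕ} (hn : 1 ≤ n) (x : ℕ → L2I) (μ : L2I) :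
    empCovKernel n x = (n : ℝ)⁻¹ • ∑ i ∈ Finset.range n, tensor (x i - μ) (x i - μ) -
      tensor (sampleMean n x - μ) (sampleMean n x - μ) := by
  have h₁ : empCovKernel n x = crossCov n x fun i => x i - μ := by
    have h : ∀ i, tensor (x i - sampleMean n x) (x i - sampleMean n x) =
        tensor (x i - μ) (x i - sampleMean n x) -
          tensor (sampleMean n x - μ) (x i - sampleMean n x) := fun i => by
      rw [← tensor_sub_left]; congr 1; abel
    have h₀ : ∑ i ∈ Finset.range n, tensor (sampleMean n x - μ) (x i - sampleMean n x) = 0 := by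
      simp only [← tensorCLM_apply]
      rw [← map_sum, sum_sub_sampleMean, map_zero]
    rw [empCovKernel, crossCov]
    simp only [h]
    rw [Finset.sum_sub_distrib, h₀, sub_zero]
  rw [h₁, crossCov_eq n x _ μ, smul_sum_sub_const hn]

/-- Absorbs the rank-one centring correction: `v` is a sample average known to have norm at most
one, and `a` is the component along `φ l` of the deviation of the sample mean. -/
theorem norm_sub_smul_sq_le {H : Type*} [NormedAddCommGroup H] [InnerProductSpace ℝ H] (u v : H)
    (a : ℝ) (hv : ‖v‖ ≤ 1) : ‖u - a • v‖ ^ 2 ≤ 2 * (‖u‖ ^ 2 + ‖a‖ ^ 2) := by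
  have h₁ : ‖u - a • v‖ ≤ ‖u‖ + ‖a‖ := by
    refine (norm_sub_le _ _).trans (add_le_add le_rfl ?_)
    rw [norm_smul]
    exact mul_le_of_le_one_right (norm_nonneg _) hv
  have h₂ := pow_le_pow_left₀ (norm_nonneg _) h₁ 2
  have h₃ := add_sq_le (a := ‖u‖) (b := ‖a‖)
  linarith

end SampleAlgebra

/-! ### Deviations of sample averages of functions of the data. -/

section MeanSquareDeviation

variable {Ω H : Type*} [NormedAddCommGroup H] [InnerProductSpace ℝ H]

/-- The squared deviation of the sample mean of `g` from `c`. -/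
def meanSqDev (Xs Ys : ℕ → Ω → L2I) (g : L2I × L2I → H) (c : H) (n : ℕ) (ω : Ω) : ℝ :=
  ‖(n : ℝ)⁻¹ • ∑ i ∈ Finset.range n, g (Xs i ω, Ys i ω) - c‖ ^ 2

theorem meanSqDev_nonneg (Xs Ys : ℕ → Ω → L2I) (g : L2I × L2I → H) (c : H) (n : ℕ) (ω : Ω) :
    0 ≤ meanSqDev Xs Ys g c n ω := sq_nonneg _

variable [MeasurableSpace Ω] {P : Measure Ω} {X Y : Ω → L2I} {Xs Ys : ℕ → Ω → L2I}

theorem lintegral_ofReal_add_add_le {f₁ f₂ f₃ : Ω → ℝ} (hm₁ : AEMeasurable f₁ P)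
    (hm₂ : AEMeasurable f₂ P) (h₁ : ∀ ω, 0 ≤ f₁ ω) (h₂ : ∀ ω, 0 ≤ f₂ ω) (h₃ : ∀ ω, 0 ≤ f₃ ω)
    {s₁ s₂ s₃ : ℝ} (hs₁ : 0 ≤ s₁) (hs₂ : 0 ≤ s₂) (hs₃ : 0 ≤ s₃)
    (H₁ : ∫⁻ ω, ENNReal.ofReal (f₁ ω) ∂P ≤ ENNReal.ofReal s₁)
    (H₂ : ∫⁻ ω, ENNReal.ofReal (f₂ ω) ∂P ≤ ENNReal.ofReal s₂)
    (H₃ : ∫⁻ ω, ENNReal.ofReal (f₃ ω) ∂P ≤ ENNReal.ofReal s₃) :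
    ∫⁻ ω, ENNReal.ofReal (f₁ ω + f₂ ω + f₃ ω) ∂P ≤ ENNReal.ofReal (s₁ + s₂ + s₃) := by
  have h : ∀ ω, ENNReal.ofReal (f₁ ω + f₂ ω + f₃ ω) = ENNReal.ofReal (f₁ ω) +
      (ENNReal.ofReal (f₂ ω) + ENNReal.ofReal (f₃ ω)) := fun ω => by
    rw [ENNReal.ofReal_add (add_nonneg (h₁ ω) (h₂ ω)) (h₃ ω), ENNReal.ofReal_add (h₁ ω) (h₂ ω),
      add_assoc]
  simp only [h]
  rw [lintegral_add_left' hm₁.ennreal_ofReal, lintegral_add_left' hm₂.ennreal_ofReal,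
    add_assoc s₁, ENNReal.ofReal_add hs₁ (add_nonneg hs₂ hs₃), ENNReal.ofReal_add hs₂ hs₃]
  exact add_le_add H₁ (add_le_add H₂ H₃)

theorem aemeasurable_meanSqDev (hsample : IsIIDSample P X Y Xs Ys) {g : L2I × L2I → H}
    (hg : Continuous g) (c : H) (n : ℕ) : AEMeasurable (meanSqDev Xs Ys g c n) P := by
  have h : ∀ i, AEStronglyMeasurable (fun ω => g (Xs i ω, Ys i ω)) P := fun i =>
    hg.comp_aestronglyMeasurable
      (hsample.identDistrib i).aemeasurable_fst.aestronglyMeasurable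
  have h₂ : AEStronglyMeasurable
      (fun ω => (n : ℝ)⁻¹ • ∑ i ∈ Finset.range n, g (Xs i ω, Ys i ω) - c) P :=
    ((Finset.aestronglyMeasurable_fun_sum _ fun i _ => h i).const_smul _).sub
      aestronglyMeasurable_const
  exact (h₂.norm.pow 2).aemeasurable

/-- The second moment is assumed as a bound on a lower integral, and square integrability of `g`
under the law of `(X, Y)` is deduced from it. This suits the quadratic functions of `X`, whose
moments are known only as such bounds. -/
theorem lintegral_meanSqDev_le [CompleteSpace H] [IsProbabilityMeasure P]
    (hsample : IsIIDSample P X Y Xs Ys) {g : L2I × L2I → H}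
    (hg : Continuous g) {s : ℝ} (hs₀ : 0 ≤ s)
    (hs : ∫⁻ ω, ENNReal.ofReal (‖g (X ω, Y ω)‖ ^ 2) ∂P ≤ ENNReal.ofReal s) {c : H}
    (hc : ∫ ω, g (X ω, Y ω) ∂P = c) {n : ℕ} (hn : 1 ≤ n) :
    ∫⁻ ω, ENNReal.ofReal (meanSqDev Xs Ys g c n ω) ∂P ≤ ENNReal.ofReal (s / n) := by
  have hXY : AEMeasurable (fun ω => (X ω, Y ω)) P := (hsample.identDistrib 0).aemeasurable_snd
  have : IsProbabilityMeasure (P.map fun ω => (X ω, Y ω)) := Measure.isProbabilityMeasure_map hXY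
  have hgm : AEStronglyMeasurable g (P.map fun ω => (X ω, Y ω)) := hg.aestronglyMeasurable
  have hgP : AEStronglyMeasurable (fun ω => g (X ω, Y ω)) P :=
    hg.comp_aestronglyMeasurable hXY.aestronglyMeasurable
  have hint : Integrable (fun ω => ‖g (X ω, Y ω)‖ ^ 2) P := by
    refine ⟨hgP.norm.pow 2, ?_⟩
    rw [hasFiniteIntegral_iff_ofReal (Eventually.of_forall fun _ => sq_nonneg _)]
    exact hs.trans_lt ENNReal.ofReal_lt_top
  have hL : MemLp g 2 (P.map fun ω => (X ω, Y ω)) := by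
    rw [memLp_map_measure_iff hgm hXY]
    exact (memLp_two_iff_integrable_sq_norm hgP).2 hint
  have hs' : ∫ z, ‖g z‖ ^ 2 ∂(P.map fun ω => (X ω, Y ω)) ≤ s := by
    rw [integral_map (f := fun z => ‖g z‖ ^ 2) hXY (hgm.norm.pow 2)]
    rw [← ofReal_integral_eq_lintegral_ofReal hint (Eventually.of_forall fun _ => sq_nonneg _)] at hs
    exact (ENNReal.ofReal_le_ofReal_iff hs₀).1 hs
  have h := lintegral_norm_mean_sub_sq_le hsample.indep
    (fun i => (hsample.identDistrib i).aemeasurable_fst)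
    (fun i => (hsample.identDistrib i).map_eq) hL hs' hn
  rwa [integral_map hXY hgm, hc] at h

end MeanSquareDeviation

/-! ### Directional and global fluctuations of the sample. -/

section Sample

variable {Ω : Type*} [MeasurableSpace Ω] {P : Measure Ω} {X Y : Ω → L2I} {b : L2II} {κ : ℕ → ℝ}
  {φ : HilbertBasis ℕ ℝ L2I} {α β γ C : ℝ} {Xs Ys : ℕ → Ω → L2I}

/-- The fluctuations of the sample in the direction of the `l`-th eigenfunction. -/
def fluctuation (P : Measure Ω) (X Y : Ω → L2I) (b : L2II) (φ : HilbertBasis ℕ ℝ L2I)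
    (Xs Ys : ℕ → Ω → L2I) (n l : ℕ) (ω : Ω) : ℝ :=
  meanSqDev Xs Ys (fun z => (inner ℝ (φ l) (z.1 - meanFn P X) : ℝ) • (z.1 - meanFn P X))
      (kernelOp (covKernel P X) (φ l)) n ω +
    meanSqDev Xs Ys (fun z => (inner ℝ (φ l) (z.1 - meanFn P X) : ℝ) •
      residual (meanFn P X) (meanFn P Y) b z.1 z.2) 0 n ω +
    meanSqDev Xs Ys (fun z => (inner ℝ (φ l) (z.1 - meanFn P X) : ℝ)) 0 n ω

/-- The global fluctuations of the sample. -/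
def globalFluctuation (P : Measure Ω) (X Y : Ω → L2I) (b : L2II)
    (Xs Ys : ℕ → Ω → L2I) (n : ℕ) (ω : Ω) : ℝ :=
  meanSqDev Xs Ys (fun z => tensor (z.1 - meanFn P X) (z.1 - meanFn P X)) (covKernel P X) n ω +
    meanSqDev Xs Ys (fun z => residual (meanFn P X) (meanFn P Y) b z.1 z.2) 0 n ω +
    meanSqDev Xs Ys (fun z => z.1 - meanFn P X) 0 n ω

theorem continuous_residual (μX μY : L2I) (b : L2II) :
    Continuous fun z : L2I × L2I => residual μX μY b z.1 z.2 :=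
  (continuous_snd.sub continuous_const).sub
    ((kernelOp b).continuous.comp (continuous_fst.sub continuous_const))

theorem continuous_inner_fst (f μ : L2I) :
    Continuous fun z : L2I × L2I => (inner ℝ f (z.1 - μ) : ℝ) := by fun_prop

theorem continuous_tensor_fst (μ : L2I) :
    Continuous fun z : L2I × L2I => tensor (z.1 - μ) (z.1 - μ) :=
  continuous_tensor.comp (by fun_prop : Continuous fun z : L2I × L2I => (z.1 - μ, z.1 - μ))

theorem aemeasurable_fluctuation (hsample : IsIIDSample P X Y Xs Ys) (n l : ℕ) :
    AEMeasurable (fluctuation P X Y b φ Xs Ys n l) P :=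
  ((aemeasurable_meanSqDev hsample ((continuous_inner_fst _ _).smul (by fun_prop)) _ _).add
    (aemeasurable_meanSqDev hsample ((continuous_inner_fst _ _).smul
      (continuous_residual _ _ _)) _ _)).add
    (aemeasurable_meanSqDev hsample (continuous_inner_fst _ _) _ _)

theorem aemeasurable_globalFluctuation (hsample : IsIIDSample P X Y Xs Ys) (n : ℕ) :
    AEMeasurable (globalFluctuation P X Y b Xs Ys n) P :=
  ((aemeasurable_meanSqDev hsample (continuous_tensor_fst _) _ _).add
    (aemeasurable_meanSqDev hsample (continuous_residual _ _ _) _ _)).add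
    (aemeasurable_meanSqDev hsample (by fun_prop) _ _)

theorem fluctuation_nonneg (n l : ℕ) (ω : Ω) : 0 ≤ fluctuation P X Y b φ Xs Ys n l ω :=
  add_nonneg (add_nonneg (meanSqDev_nonneg _ _ _ _ _ _) (meanSqDev_nonneg _ _ _ _ _ _))
    (meanSqDev_nonneg _ _ _ _ _ _)

/-- Each of the three averaged quantities, score times centred regressor, score times residual, and
the score itself, has a second moment bounded by a constant times `κ l`; averaging contributes `1 /
n`. -/
theorem lintegral_fluctuation_le [IsProbabilityMeasure P] (hmodel : IsLinearModel P X Y b)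
    (hspec : IsSpectralSystem (covKernel P X) κ φ) (hreg : IsRegular P X Y b κ φ α β γ C)
    (hsample : IsIIDSample P X Y Xs Ys) {n : ℕ} (hn : 1 ≤ n) (l : ℕ) :
    ∫⁻ ω, ENNReal.ofReal (fluctuation P X Y b φ Xs Ys n l ω) ∂P ≤
      ENNReal.ofReal ((C * (∑' k, κ k) + C + 1) * κ l / n) := by
  have hX := hmodel.memLp_X
  have hκ₀ := hspec.nonneg
  have hC : 0 < C := by linarith [hreg.one_lt_C]
  have hτ : 0 ≤ C * (∑' k, κ k) := mul_nonneg hC.le (tsum_nonneg hκ₀)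
  have hn0 : (0 : ℝ) ≤ n := Nat.cast_nonneg n
  have h₁ := lintegral_meanSqDev_le hsample
    (g := fun z => (inner ℝ (φ l) (z.1 - meanFn P X) : ℝ) • (z.1 - meanFn P X))
    (c := kernelOp (covKernel P X) (φ l))
    ((continuous_inner_fst _ _).smul (by fun_prop)) (mul_nonneg hτ (hκ₀ l))
    (by
      refine le_trans (le_of_eq (lintegral_congr fun ω => ?_))
        (lintegral_score_sq_mul_norm_sq_le hX hreg hspec l)
      rw [norm_smul, mul_pow, Real.norm_eq_abs, sq_abs]
      rfl)
    (by
      have hint : Integrable (fun ω => (inner ℝ (φ l) (X ω - meanFn P X) : ℝ) •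
          (X ω - meanFn P X)) P :=
        memLp_one_iff_integrable.1 ((memLp_centered hX).smul (memLp_score (φ := φ) hX l))
      refine ext_inner_left ℝ fun f => ?_
      rw [← integral_inner hint, inner_kernelOp, inner_tensor_covKernel hX]
      simp only [inner_smul_right, mul_comm])
    hn
  have h₂ := lintegral_meanSqDev_le hsample
    (g := fun z => (inner ℝ (φ l) (z.1 - meanFn P X) : ℝ) •
      residual (meanFn P X) (meanFn P Y) b z.1 z.2) (c := 0)
    ((continuous_inner_fst _ _).smul (continuous_residual _ _ _)) (mul_nonneg hC.le (hκ₀ l))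
    (lintegral_norm_score_smul_residual_sq_le hmodel hspec hreg l)
    (integral_score_smul_residual hmodel l) hn
  have h₃ := lintegral_meanSqDev_le hsample
    (g := fun z => (inner ℝ (φ l) (z.1 - meanFn P X) : ℝ)) (c := 0)
    (continuous_inner_fst _ _) (hκ₀ l)
    (by
      refine le_of_eq ((lintegral_congr fun ω => ?_).trans (lintegral_score_sq hX hspec l))
      rw [Real.norm_eq_abs, sq_abs]
      rfl)
    (by
      rw [integral_inner ((memLp_centered hX).integrable (by norm_num)), integral_centered hX,
        inner_zero_right])
    hn
  have hm₁ := aemeasurable_meanSqDev hsample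
    (g := fun z => (inner ℝ (φ l) (z.1 - meanFn P X) : ℝ) • (z.1 - meanFn P X))
    ((continuous_inner_fst _ _).smul (by fun_prop)) (kernelOp (covKernel P X) (φ l)) n
  have hm₂ := aemeasurable_meanSqDev hsample
    (g := fun z => (inner ℝ (φ l) (z.1 - meanFn P X) : ℝ) •
      residual (meanFn P X) (meanFn P Y) b z.1 z.2)
    ((continuous_inner_fst _ _).smul (continuous_residual _ _ _)) 0 n
  have hl := hκ₀ l
  refine (lintegral_ofReal_add_add_le hm₁ hm₂ (meanSqDev_nonneg _ _ _ _ _)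
    (meanSqDev_nonneg _ _ _ _ _) (meanSqDev_nonneg _ _ _ _ _) (by positivity) (by positivity)
    (by positivity) h₁ h₂ h₃).trans_eq ?_
  congr 1
  ring

theorem exists_lintegral_globalFluctuation_le [IsProbabilityMeasure P]
    (hmodel : IsLinearModel P X Y b)
    (hspec : IsSpectralSystem (covKernel P X) κ φ) (hreg : IsRegular P X Y b κ φ α β γ C)
    (hsample : IsIIDSample P X Y Xs Ys) :
    ∃ s : ℝ, 0 < s ∧ ∀ n : ℕ, 1 ≤ n →
      ∫⁻ ω, ENNReal.ofReal (globalFluctuation P X Y b Xs Ys n ω) ∂P ≤ ENNReal.ofReal (s / n) := by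
  have hX := hmodel.memLp_X
  have hκ₀ := hspec.nonneg
  have hC : 0 < C := by linarith [hreg.one_lt_C]
  have hx2 : Integrable (fun ω => ‖X ω - meanFn P X‖ ^ 2) P :=
    (memLp_centered hX).integrable_norm_pow (by norm_num)
  set v := ∫ ω, ‖X ω - meanFn P X‖ ^ 2 ∂P with hv
  have hv0 : 0 ≤ v := integral_nonneg fun _ => sq_nonneg _
  refine ⟨C * (∑' k, κ k) ^ 2 + C + v, by positivity, fun n hn => ?_⟩
  have h₁ := lintegral_meanSqDev_le hsample (continuous_tensor_fst (meanFn P X))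
    (s := C * (∑' k, κ k) ^ 2) (by positivity)
    (by
      refine le_trans (le_of_eq (lintegral_congr fun ω => ?_))
        (lintegral_norm_centered_pow_le hX hreg hspec)
      rw [norm_tensor, mul_pow])
    (c := covKernel P X) rfl hn
  have h₂ := lintegral_meanSqDev_le hsample
    (continuous_residual (meanFn P X) (meanFn P Y) b) (s := C) hC.le
    (by
      have := lintegral_mul_norm_residual_sq_le hmodel hreg (f := fun _ => 1) measurable_const
      simpa using this)
    (integral_residual hmodel) hn
  have h₃ := lintegral_meanSqDev_le hsample
    (g := fun z => z.1 - meanFn P X) (by fun_prop) (s := v) hv0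
    (by
      rw [hv, ofReal_integral_eq_lintegral_ofReal hx2 (Eventually.of_forall fun _ => sq_nonneg _)])
    (integral_centered hX) hn
  have hm₁ := aemeasurable_meanSqDev hsample (continuous_tensor_fst (meanFn P X))
    (covKernel P X) n
  have hm₂ := aemeasurable_meanSqDev hsample
    (continuous_residual (meanFn P X) (meanFn P Y) b) 0 n
  refine (lintegral_ofReal_add_add_le hm₁ hm₂ (meanSqDev_nonneg _ _ _ _ _)
    (meanSqDev_nonneg _ _ _ _ _) (meanSqDev_nonneg _ _ _ _ _) (by positivity) (by positivity)
    (by positivity) h₁ h₂ h₃).trans_eq ?_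
  congr 1
  ring

/-- Small global fluctuations imply that the empirical objects are close to the population ones. -/
theorem perturbation_le_of_globalFluctuation_le {n : ℕ} (hn : 1 ≤ n) {ω : Ω} {η : ℝ} (hη : 0 ≤ η)
    (hη1 : η ≤ 1) (h : globalFluctuation P X Y b Xs Ys n ω ≤ η ^ 2) :
    ‖empCovKernel n (fun i => Xs i ω) - covKernel P X‖ ≤ 2 * η ∧
    (∀ l, ‖kernelOp (empCovKernel n (fun i => Xs i ω) - covKernel P X) (φ l)‖ ^ 2 ≤
      2 * fluctuation P X Y b φ Xs Ys n l ω) ∧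
    (∀ l, ‖kernelOp (crossCov n (fun i => Xs i ω)
      fun i => residual (meanFn P X) (meanFn P Y) b (Xs i ω) (Ys i ω)) (φ l)‖ ^ 2 ≤
      2 * fluctuation P X Y b φ Xs Ys n l ω) := by
  set μX := meanFn P X with hμX
  set μY := meanFn P Y with hμY
  set x := fun i => Xs i ω with hx
  set e := fun i => residual μX μY b (Xs i ω) (Ys i ω) with he
  set A := (n : ℝ)⁻¹ • ∑ i ∈ Finset.range n, tensor (x i - μX) (x i - μX) with hA
  set E := (n : ℝ)⁻¹ • ∑ i ∈ Finset.range n, e i with hE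
  set x' := sampleMean n x - μX with hx'
  have hglob : globalFluctuation P X Y b Xs Ys n ω =
      ‖A - covKernel P X‖ ^ 2 + ‖E‖ ^ 2 + ‖x'‖ ^ 2 := by
    rw [hx', ← smul_sum_sub_const hn]
    simp only [globalFluctuation, meanSqDev, sub_zero]
    rfl
  rw [hglob] at h
  have hAη : ‖A - covKernel P X‖ ≤ η :=
    abs_le_of_sq_le_sq' (by nlinarith [sq_nonneg ‖E‖, sq_nonneg ‖x'‖]) hη |>.2
  have hEη : ‖E‖ ≤ η :=
    abs_le_of_sq_le_sq' (by nlinarith [sq_nonneg ‖A - covKernel P X‖, sq_nonneg ‖x'‖]) hη |>.2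
  have hxη : ‖x'‖ ≤ η :=
    abs_le_of_sq_le_sq' (by nlinarith [sq_nonneg ‖A - covKernel P X‖, sq_nonneg ‖E‖]) hη |>.2
  -- The rank-one correction `x' ⊗ x'` sends `φ l` to `⟨x', φ l⟩ x'`. Since `‖x'‖ ≤ 1`, the third
  -- summand of the fluctuation, `⟨φ l, x'⟩²`, bounds the square of its norm.
  have hemp : empCovKernel n x - covKernel P X = A - covKernel P X - tensor x' x' := by
    rw [empCovKernel_eq hn x μX, ← hx', ← hA]; abel
  have hlast : ∀ l, (n : ℝ)⁻¹ • ∑ i ∈ Finset.range n, (inner ℝ (φ l) (x i - μX) : ℝ) =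
      inner ℝ (φ l) x' := fun l => by
    rw [hx', ← smul_sum_sub_const hn, inner_smul_right, inner_sum, smul_eq_mul]
  have hfl : ∀ l, fluctuation P X Y b φ Xs Ys n l ω =
      ‖kernelOp (A - covKernel P X) (φ l)‖ ^ 2 +
      ‖(n : ℝ)⁻¹ • ∑ i ∈ Finset.range n, (inner ℝ (φ l) (x i - μX) : ℝ) • e i‖ ^ 2 +
      ‖(inner ℝ (φ l) x' : ℝ)‖ ^ 2 := fun l => by
    rw [← hlast, kernelOp_sub, hA, kernelOp_smul, kernelOp_sum]
    simp only [fluctuation, meanSqDev, sub_zero, kernelOp_tensor, real_inner_comm (φ l)]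
    rfl
  refine ⟨?_, fun l => ?_, fun l => ?_⟩
  · rw [hemp]
    refine (norm_sub_le _ _).trans ?_
    rw [norm_tensor]
    nlinarith [norm_nonneg x']
  · rw [hemp, kernelOp_sub _ (tensor x' x'), kernelOp_tensor, real_inner_comm, hfl]
    refine (norm_sub_smul_sq_le _ _ _ (hxη.trans hη1)).trans ?_
    nlinarith [sq_nonneg ‖(n : ℝ)⁻¹ • ∑ i ∈ Finset.range n,
      (inner ℝ (φ l) (x i - μX) : ℝ) • e i‖]
  · rw [crossCov_eq n x e μX, ← hE, ← hx', kernelOp_sub, kernelOp_tensor, kernelOp_smul,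
      kernelOp_sum, real_inner_comm, hfl]
    simp only [kernelOp_tensor, real_inner_comm (φ l)]
    refine (norm_sub_smul_sq_le _ _ _ (hEη.trans hη1)).trans ?_
    nlinarith [sq_nonneg ‖kernelOp (A - covKernel P X) (φ l)‖]

end Sample

/-! ### Expected error majorant and the rate for general cut-offs. -/

section Rate

variable {Ω : Type*} [MeasurableSpace Ω] {P : Measure Ω} {X Y : Ω → L2I} {b : L2II} {κ : ℕ → ℝ}
  {φ : HilbertBasis ℕ ℝ L2I} {α β γ C : ℝ} {Xs Ys : ℕ → Ω → L2I}

/-- Inserting `κ l ≤ C (l+1)^(-α)` leaves `(m/n) ∑ (l+1)^(α+2-2p)`, bounded by a multiple of `m/n +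
(m^(2α+2) / n) m^(1-2p)`; the constraint on `m` brings the second part down to the squared bias. -/
theorem exists_lintegral_weighted_fluctuation_le [IsProbabilityMeasure P]
    (hmodel : IsLinearModel P X Y b)
    (hspec : IsSpectralSystem (covKernel P X) κ φ) (hreg : IsRegular P X Y b κ φ α β γ C)
    (hsample : IsIIDSample P X Y Xs Ys) (p : ℝ) :
    ∃ c : ℝ, 0 ≤ c ∧ ∀ n m : ℕ, 1 ≤ n → 1 ≤ m → (m : ℝ) ^ (2 * α + 2) ≤ n →
      ∫⁻ ω, ENNReal.ofReal (m * ∑ l ∈ Finset.range m, ((l : ℝ) + 1) ^ (2 * α + 2 - 2 * p) *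
        fluctuation P X Y b φ Xs Ys n l ω) ∂P ≤
        ENNReal.ofReal (c * ((n : ℝ)⁻¹ * m + (m : ℝ) ^ (-2 * p + 1))) := by
  have hC : 0 < C := by linarith [hreg.one_lt_C]
  have hκ₀ := hspec.nonneg
  have hα := hreg.one_lt_alpha
  set c₀ := C * (∑' k, κ k) + C + 1 with hc₀
  have hc₀0 : 0 ≤ c₀ := by
    have : 0 ≤ C * (∑' k, κ k) := mul_nonneg hC.le (tsum_nonneg hκ₀)
    linarith
  -- The exponent is deliberately enlarged by `α - 1 > 0`: this avoids the logarithmic case and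
  -- still fits under the constraint `m^(2α+2) ≤ n`.
  obtain ⟨c₁, hc₁, H₁⟩ := exists_sum_rpow_le (p := 2 * α + 1 - 2 * p) (q := α + 2 - 2 * p)
    (by linarith)
  refine ⟨c₀ * C * c₁, by positivity, fun n m hn hm hmn => ?_⟩
  have hn0 : (0 : ℝ) < n := by exact_mod_cast hn
  have hm0 : (0 : ℝ) < m := by exact_mod_cast hm
  have hQ := fun l (ω : Ω) => fluctuation_nonneg (P := P) (X := X) (Y := Y) (b := b) (φ := φ)
    (Xs := Xs) (Ys := Ys) n l ω
  have hsplit : ∀ ω, ENNReal.ofReal (m * ∑ l ∈ Finset.range m,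
      ((l : ℝ) + 1) ^ (2 * α + 2 - 2 * p) * fluctuation P X Y b φ Xs Ys n l ω) =
      ∑ l ∈ Finset.range m, ENNReal.ofReal (m * ((l : ℝ) + 1) ^ (2 * α + 2 - 2 * p)) *
        ENNReal.ofReal (fluctuation P X Y b φ Xs Ys n l ω) := fun ω => by
    rw [Finset.mul_sum, ENNReal.ofReal_sum_of_nonneg fun l _ =>
      mul_nonneg hm0.le (mul_nonneg (by positivity) (hQ l ω))]
    refine Finset.sum_congr rfl fun l _ => ?_
    rw [← mul_assoc, ENNReal.ofReal_mul (by positivity)]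
  simp only [hsplit]
  rw [lintegral_finsetSum' _ fun l _ =>
    (aemeasurable_fluctuation hsample n l).ennreal_ofReal.const_mul _]
  have hterm : ∀ l ∈ Finset.range m,
      ∫⁻ ω, ENNReal.ofReal (m * ((l : ℝ) + 1) ^ (2 * α + 2 - 2 * p)) *
        ENNReal.ofReal (fluctuation P X Y b φ Xs Ys n l ω) ∂P ≤
      ENNReal.ofReal (c₀ * C * ((n : ℝ)⁻¹ * m) * ((l : ℝ) + 1) ^ (α + 2 - 2 * p)) := by
    intro l _
    rw [lintegral_const_mul'' _ (aemeasurable_fluctuation hsample n l).ennreal_ofReal]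
    refine (mul_le_mul' le_rfl
      (lintegral_fluctuation_le hmodel hspec hreg hsample hn l)).trans ?_
    rw [← ENNReal.ofReal_mul (by positivity)]
    refine ENNReal.ofReal_le_ofReal ?_
    have hexp : ((l : ℝ) + 1) ^ (α + 2 - 2 * p) =
        ((l : ℝ) + 1) ^ (2 * α + 2 - 2 * p) * ((l : ℝ) + 1) ^ (-α) := by
      rw [← Real.rpow_add (by positivity)]; congr 1; ring
    rw [hexp]
    have := mul_le_mul_of_nonneg_left (hreg.eigenvalue_le l) (show 0 ≤
      (m * ((l : ℝ) + 1) ^ (2 * α + 2 - 2 * p)) * c₀ * (n : ℝ)⁻¹ by positivity)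
    rw [div_eq_mul_inv]
    linarith
  refine (Finset.sum_le_sum hterm).trans ?_
  rw [← ENNReal.ofReal_sum_of_nonneg fun l _ => by positivity, ← Finset.mul_sum]
  refine ENNReal.ofReal_le_ofReal ?_
  refine (mul_le_mul_of_nonneg_left (H₁ m hm) (by positivity)).trans ?_
  have hexp : (m : ℝ) * (m : ℝ) ^ (2 * α + 1 - 2 * p + 1) =
      (m : ℝ) ^ (2 * α + 2) * (m : ℝ) ^ (-2 * p + 1) := by
    rw [← Real.rpow_add hm0, mul_comm, ← Real.rpow_add_one hm0.ne']; congr 1; ring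
  have hle : (n : ℝ)⁻¹ * ((m : ℝ) * (m : ℝ) ^ (2 * α + 1 - 2 * p + 1)) ≤
      (m : ℝ) ^ (-2 * p + 1) := by
    rw [hexp, ← mul_assoc]
    refine mul_le_of_le_one_left (by positivity) ?_
    rw [inv_mul_eq_div, div_le_one hn0]
    exact hmn
  have := mul_le_mul_of_nonneg_left hle (show 0 ≤ c₀ * C * c₁ by positivity)
  linarith

theorem exists_lintegral_noise_fluctuation_le [IsProbabilityMeasure P]
    (hmodel : IsLinearModel P X Y b)
    (hspec : IsSpectralSystem (covKernel P X) κ φ) (hreg : IsRegular P X Y b κ φ α β γ C)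
    (hsample : IsIIDSample P X Y Xs Ys) :
    ∃ c : ℝ, 0 ≤ c ∧ ∀ n m : ℕ, 1 ≤ n → 1 ≤ m →
      ∫⁻ ω, ∑' l, ENNReal.ofReal (fluctuation P X Y b φ Xs Ys n l ω /
        (κ l + (m : ℝ) ^ (-α)) ^ 2) ∂P ≤
        ENNReal.ofReal (c * ((n : ℝ)⁻¹ * (m : ℝ) ^ (α + 1))) := by
  have hC : 0 < C := by linarith [hreg.one_lt_C]
  have hκ₀ := hspec.nonneg
  set c₀ := C * (∑' k, κ k) + C + 1 with hc₀
  have hc₀0 : 0 ≤ c₀ := by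
    have : 0 ≤ C * (∑' k, κ k) := mul_nonneg hC.le (tsum_nonneg hκ₀)
    linarith
  obtain ⟨c₁, hc₁, H₁⟩ := exists_tsum_eigenvalue_div_le hreg.one_lt_alpha hC hκ₀
    hreg.eigenvalue_le
  refine ⟨c₀ * c₁, by positivity, fun n m hn hm => ?_⟩
  have hn0 : (0 : ℝ) < n := by exact_mod_cast hn
  have hm0 : (0 : ℝ) < m := by exact_mod_cast hm
  set t := (m : ℝ) ^ (-α) with ht
  have ht0 : 0 < t := by positivity
  have hpos : ∀ l, 0 < (κ l + t) ^ 2 := fun l => by have := hκ₀ l; positivity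
  have hterm : ∀ l, ∫⁻ ω, ENNReal.ofReal (fluctuation P X Y b φ Xs Ys n l ω /
      (κ l + t) ^ 2) ∂P ≤
      ENNReal.ofReal (c₀ * (n : ℝ)⁻¹) * ENNReal.ofReal (κ l / (κ l + t) ^ 2) := by
    intro l
    simp only [ENNReal.ofReal_div_of_pos (hpos l)]
    simp only [div_eq_mul_inv]
    rw [lintegral_mul_const'' _ (aemeasurable_fluctuation hsample n l).ennreal_ofReal,
      ← mul_assoc, ← ENNReal.ofReal_mul (by positivity)]
    refine mul_le_mul' ((lintegral_fluctuation_le hmodel hspec hreg hsample hn l).trans_eq ?_)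
      le_rfl
    rw [← hc₀, div_eq_mul_inv]
    congr 1; ring
  rw [lintegral_tsum fun l =>
    ((aemeasurable_fluctuation hsample n l).div_const _).ennreal_ofReal]
  refine (ENNReal.tsum_le_tsum hterm).trans ?_
  rw [ENNReal.tsum_mul_left]
  refine (mul_le_mul' le_rfl (H₁ m hm)).trans_eq ?_
  rw [← ENNReal.ofReal_mul (by positivity)]
  congr 1; ring

/-- The random majorant of the squared estimation error. -/
def errorMajorant (P : Measure Ω) (X Y : Ω → L2I) (b : L2II) (κ : ℕ → ℝ)
    (φ : HilbertBasis ℕ ℝ L2I) (α β γ : ℝ) (Xs Ys : ℕ → Ω → L2I) (n m₁ m₂ : ℕ) (ω : Ω) :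
    ENNReal :=
  (∑' l, ENNReal.ofReal (fluctuation P X Y b φ Xs Ys n l ω / (κ l + (m₂ : ℝ) ^ (-α)) ^ 2)) +
    (ENNReal.ofReal (m₁ * ∑ l ∈ Finset.range m₁, ((l : ℝ) + 1) ^ (2 * α + 2 - 2 * γ) *
      fluctuation P X Y b φ Xs Ys n l ω) +
    ENNReal.ofReal (m₂ * ∑ l ∈ Finset.range m₂, ((l : ℝ) + 1) ^ (2 * α + 2 - 2 * β) *
      fluctuation P X Y b φ Xs Ys n l ω))

/-- The rate of convergence of the estimator. -/
def rate (α β γ : ℝ) (n m₁ m₂ : ℕ) : ℝ :=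
  (n : ℝ)⁻¹ * ((m₁ : ℝ) + (m₂ : ℝ) ^ (α + 1)) + (m₁ : ℝ) ^ (-2 * γ + 1) + (m₂ : ℝ) ^ (-2 * β + 1)

theorem rate_pos {n m₁ m₂ : ℕ} (hm₁ : 1 ≤ m₁) : 0 < rate α β γ n m₁ m₂ := by
  have : (0 : ℝ) < m₁ := by exact_mod_cast hm₁
  unfold rate
  positivity

theorem aemeasurable_weighted_fluctuation (hsample : IsIIDSample P X Y Xs Ys) (n m : ℕ) (r : ℝ) :
    AEMeasurable (fun ω => ENNReal.ofReal (m * ∑ l ∈ Finset.range m, ((l : ℝ) + 1) ^ r *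
      fluctuation P X Y b φ Xs Ys n l ω)) P :=
  ((Finset.aemeasurable_fun_sum _ fun l _ =>
    (aemeasurable_fluctuation hsample n l).const_mul _).const_mul _).ennreal_ofReal

theorem aemeasurable_noise_fluctuation (hsample : IsIIDSample P X Y Xs Ys) (n : ℕ) (t : ℝ) :
    AEMeasurable (fun ω => ∑' l, ENNReal.ofReal (fluctuation P X Y b φ Xs Ys n l ω /
      (κ l + t) ^ 2)) P :=
  AEMeasurable.tsum fun l =>
    ((aemeasurable_fluctuation hsample n l).div_const _).ennreal_ofReal

theorem exists_lintegral_errorMajorant_le [IsProbabilityMeasure P]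
    (hmodel : IsLinearModel P X Y b)
    (hspec : IsSpectralSystem (covKernel P X) κ φ) (hreg : IsRegular P X Y b κ φ α β γ C)
    (hsample : IsIIDSample P X Y Xs Ys) :
    ∃ c : ℝ, 0 < c ∧ ∀ n m₁ m₂ : ℕ, 1 ≤ n → 1 ≤ m₁ → 1 ≤ m₂ →
      ((max m₁ m₂ : ℕ) : ℝ) ^ (2 * α + 2) ≤ n →
      ∫⁻ ω, errorMajorant P X Y b κ φ α β γ Xs Ys n m₁ m₂ ω ∂P ≤
        ENNReal.ofReal (c * rate α β γ n m₁ m₂) := by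
  obtain ⟨c₁, hc₁, H₁⟩ := exists_lintegral_noise_fluctuation_le hmodel hspec hreg hsample
  obtain ⟨c₂, hc₂, H₂⟩ := exists_lintegral_weighted_fluctuation_le hmodel hspec hreg hsample γ
  obtain ⟨c₃, hc₃, H₃⟩ := exists_lintegral_weighted_fluctuation_le hmodel hspec hreg hsample β
  have hα := hreg.one_lt_alpha
  refine ⟨c₁ + c₂ + c₃ + 1, by positivity, fun n m₁ m₂ hn hm₁ hm₂ hmn => ?_⟩
  have hle : ∀ m : ℕ, m ≤ max m₁ m₂ → (m : ℝ) ^ (2 * α + 2) ≤ n := fun m hm =>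
    (Real.rpow_le_rpow (Nat.cast_nonneg _) (by exact_mod_cast hm) (by linarith)).trans hmn
  have h₁ := H₁ n m₂ hn hm₂
  have h₂ := H₂ n m₁ hn hm₁ (hle m₁ (le_max_left _ _))
  have h₃ := H₃ n m₂ hn hm₂ (hle m₂ (le_max_right _ _))
  unfold errorMajorant
  rw [lintegral_add_left' (aemeasurable_noise_fluctuation hsample n _),
    lintegral_add_left' (aemeasurable_weighted_fluctuation hsample n m₁ _)]
  refine (add_le_add h₁ (add_le_add h₂ h₃)).trans ?_
  rw [← ENNReal.ofReal_add (by positivity) (by positivity),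
    ← ENNReal.ofReal_add (by positivity) (by positivity)]
  refine ENNReal.ofReal_le_ofReal ?_
  have hm₂1 : (1 : ℝ) ≤ m₂ := by exact_mod_cast hm₂
  -- The tail in the second variable contributes `m₂ / n`, which the noise rate `m₂^(α+1) / n`
  -- absorbs.
  have hpow : (m₂ : ℝ) ≤ (m₂ : ℝ) ^ (α + 1) := by
    conv_lhs => rw [← Real.rpow_one (m₂ : ℝ)]
    exact Real.rpow_le_rpow_of_exponent_le hm₂1 (by linarith)
  have hrest : ∀ a r s : ℝ, 0 ≤ a → r ≤ s → a * r ≤ a * s := fun a r s ha h =>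
    mul_le_mul_of_nonneg_left h ha
  have hn0 : (0 : ℝ) ≤ (n : ℝ)⁻¹ := by positivity
  have e₁ : (0 : ℝ) ≤ (n : ℝ)⁻¹ * m₁ := by positivity
  have e₂ : (0 : ℝ) ≤ (n : ℝ)⁻¹ * (m₂ : ℝ) ^ (α + 1) := by positivity
  have e₃ : (0 : ℝ) ≤ (m₁ : ℝ) ^ (-2 * γ + 1) := by positivity
  have e₄ : (0 : ℝ) ≤ (m₂ : ℝ) ^ (-2 * β + 1) := by positivity
  have e₅ := mul_le_mul_of_nonneg_left hpow hn0
  have hr0 := (rate_pos (α := α) (β := β) (γ := γ) (n := n) (m₂ := m₂) hm₁).le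
  have f₁ := hrest c₁ ((n : ℝ)⁻¹ * (m₂ : ℝ) ^ (α + 1)) (rate α β γ n m₁ m₂) hc₁
    (by unfold rate; linarith)
  have f₂ := hrest c₂ ((n : ℝ)⁻¹ * m₁ + (m₁ : ℝ) ^ (-2 * γ + 1)) (rate α β γ n m₁ m₂) hc₂
    (by unfold rate; linarith)
  have f₃ := hrest c₃ ((n : ℝ)⁻¹ * m₂ + (m₂ : ℝ) ^ (-2 * β + 1)) (rate α β γ n m₁ m₂) hc₃
    (by unfold rate; linarith)
  linarith

theorem measure_le_ofReal_div {f : Ω → ENNReal} (hf : AEMeasurable f P) {a s : ℝ} (ha : 0 < a)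
    (h : ∫⁻ ω, f ω ∂P ≤ ENNReal.ofReal s) :
    P {ω | ENNReal.ofReal a ≤ f ω} ≤ ENNReal.ofReal (s / a) := by
  refine (meas_ge_le_lintegral_div hf (ENNReal.ofReal_pos.2 ha).ne' ENNReal.ofReal_ne_top).trans ?_
  rw [ENNReal.ofReal_div_of_pos ha]
  exact ENNReal.div_le_div_right h _

/-- Convergence rate of the estimator for general cut-off levels. -/
theorem isBigOP_doubleTruncEst [IsProbabilityMeasure P] (hmodel : IsLinearModel P X Y b)
    (hspec : IsSpectralSystem (covKernel P X) κ φ) (hreg : IsRegular P X Y b κ φ α β γ C)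
    (hsample : IsIIDSample P X Y Xs Ys) {κhat : ℕ → Ω → ℕ → ℝ}
    {φhat : ℕ → Ω → HilbertBasis ℕ ℝ L2I}
    (hhat : ∀ n ω, IsSpectralSystem (empCovKernel n (fun i => Xs i ω)) (κhat n ω) (φhat n ω))
    {m₁ m₂ : ℕ → ℕ} (hm₁ : Tendsto m₁ atTop atTop) (hm₂ : Tendsto m₂ atTop atTop)
    (hm : (fun n => ((max (m₁ n) (m₂ n) : ℕ) : ℝ)) =o[atTop]
        fun n : ℕ => (n : ℝ) ^ (1 / (2 * α + 2))) :
    IsBigOP P (fun n ω => ‖doubleTruncEst n (m₁ n) (m₂ n) (fun i => Xs i ω) (fun i => Ys i ω)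
      (κhat n ω) (φhat n ω) - b‖ ^ 2) (fun n => rate α β γ n (m₁ n) (m₂ n)) := by
  have hα := hreg.one_lt_alpha
  have hβ : 1 / 2 < β := by linarith [hreg.lt_beta]
  obtain ⟨c, δ, hc, hδ, Hdet⟩ := exists_error_bound hspec hα hβ hreg.lt_gamma hreg.one_lt_C
    hreg.eigenvalue_gap hreg.coeff_le (meanFn P X) (meanFn P Y)
  obtain ⟨s, hs, HV⟩ := exists_lintegral_globalFluctuation_le hmodel hspec hreg hsample
  obtain ⟨c', hc', HW⟩ := exists_lintegral_errorMajorant_le hmodel hspec hreg hsample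
  -- Chosen so that `η = a M^(-α-1)` satisfies `η ≤ 1`, for the centring corrections, and `2η ≤ δ
  -- M^(-α-1)`, for the deterministic bound.
  set a := min 1 (δ / 2) with ha
  have ha0 : 0 < a := by positivity
  have hsmall : ∀ θ : ℝ, 0 < θ → ∀ᶠ n : ℕ in atTop,
      ((max (m₁ n) (m₂ n) : ℕ) : ℝ) ^ (2 * α + 2) ≤ θ * n := by
    intro θ hθ
    have he : 0 < 2 * α + 2 := by linarith
    filter_upwards [hm.def (Real.rpow_pos_of_pos hθ (1 / (2 * α + 2)))] with n hn
    rw [Real.norm_of_nonneg (Nat.cast_nonneg _), Real.norm_of_nonneg (by positivity),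
      ← Real.mul_rpow hθ.le (Nat.cast_nonneg _)] at hn
    have := Real.rpow_le_rpow (Nat.cast_nonneg _) hn he.le
    rwa [← Real.rpow_mul (by positivity), one_div, inv_mul_cancel₀ he.ne', Real.rpow_one] at this
  intro ε hε
  set A := 2 * c' / ε with hA
  have hA0 : 0 < A := by positivity
  -- `A` bounds the random majorant relative to the rate, and `1` accounts for the two deterministic
  -- bias powers. With `A = 2c' / ε` Markov's inequality costs `ε / 2`.
  refine ⟨c * (A + 1), by positivity, ?_⟩
  filter_upwards [hm₁.eventually_ge_atTop 1, hm₂.eventually_ge_atTop 1, eventually_ge_atTop 1,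
    hsmall 1 one_pos, hsmall (ε * a ^ 2 / (2 * s)) (by positivity)] with n h₁ h₂ hn hM₁ hM₂
  rw [one_mul] at hM₁
  have hn0 : (0 : ℝ) < n := by exact_mod_cast hn
  set M := max (m₁ n) (m₂ n) with hM
  have hM0 : 1 ≤ M := h₁.trans (le_max_left _ _)
  have hM1 : (1 : ℝ) ≤ M := by exact_mod_cast hM0
  have hM00 : (0 : ℝ) < M := by linarith
  set r := rate α β γ n (m₁ n) (m₂ n) with hr
  have hr0 : 0 < r := rate_pos h₁
  set η := a * (M : ℝ) ^ (-α - 1) with hη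
  have hη0 : 0 < η := by positivity
  have hpow1 : (M : ℝ) ^ (-α - 1) ≤ 1 := Real.rpow_le_one_of_one_le_of_nonpos hM1 (by linarith)
  have hη1 : η ≤ 1 := mul_le_one₀ (min_le_left _ _) (by positivity) hpow1
  have hηδ : 2 * η ≤ δ * (M : ℝ) ^ (-α - 1) := by
    have : 2 * a ≤ δ := by linarith [min_le_right 1 (δ / 2)]
    have := mul_le_mul_of_nonneg_right this (show 0 ≤ (M : ℝ) ^ (-α - 1) by positivity)
    rw [hη]; linarith
  -- The event of a large error is only covered by measurable ones, so nothing is needed about how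
  -- the empirical eigenfunctions depend on `ω`.
  have hsub : {ω | c * (A + 1) * r < |‖doubleTruncEst n (m₁ n) (m₂ n) (fun i => Xs i ω)
      (fun i => Ys i ω) (κhat n ω) (φhat n ω) - b‖ ^ 2|} ⊆
      {ω | ENNReal.ofReal (η ^ 2) ≤ ENNReal.ofReal (globalFluctuation P X Y b Xs Ys n ω)} ∪
      {ω | ENNReal.ofReal (A * r) ≤
        errorMajorant P X Y b κ φ α β γ Xs Ys n (m₁ n) (m₂ n) ω} := by
    intro ω hω
    by_contra hcon
    simp only [Set.mem_union, Set.mem_ofPred_eq, not_or, not_le] at hcon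
    obtain ⟨hV, hW⟩ := hcon
    have hV' : globalFluctuation P X Y b Xs Ys n ω ≤ η ^ 2 :=
      ((ENNReal.ofReal_lt_ofReal_iff (by positivity)).1 hV).le
    obtain ⟨hd, hQ, hU⟩ := perturbation_le_of_globalFluctuation_le (φ := φ) hn hη0.le hη1 hV'
    have hZ := Hdet n (m₁ n) (m₂ n) (fun i => Xs i ω) (fun i => Ys i ω) (κhat n ω) (φhat n ω)
      (fun l => fluctuation P X Y b φ Xs Ys n l ω) h₁ h₂ (hhat n ω) (hd.trans hηδ) hQ hU
    have hsum : ENNReal.ofReal ((m₁ n : ℝ) ^ (-2 * γ + 1)) +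
        ENNReal.ofReal ((m₂ n : ℝ) ^ (-2 * β + 1)) ≤ ENNReal.ofReal r := by
      rw [← ENNReal.ofReal_add (by positivity) (by positivity)]
      refine ENNReal.ofReal_le_ofReal ?_
      rw [hr, rate]
      have : 0 ≤ (n : ℝ)⁻¹ * ((m₁ n : ℝ) + (m₂ n : ℝ) ^ (α + 1)) := by positivity
      linarith
    have hZ' : ENNReal.ofReal (‖doubleTruncEst n (m₁ n) (m₂ n) (fun i => Xs i ω)
        (fun i => Ys i ω) (κhat n ω) (φhat n ω) - b‖ ^ 2) ≤ ENNReal.ofReal (c * (A + 1) * r) := by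
      refine hZ.trans ?_
      rw [mul_assoc, ENNReal.ofReal_mul hc.le, add_mul, one_mul,
        ENNReal.ofReal_add (by positivity) hr0.le]
      refine mul_le_mul' le_rfl ((le_of_eq ?_).trans (add_le_add hW.le hsum))
      unfold errorMajorant
      ring
    rw [ENNReal.ofReal_le_ofReal_iff (by positivity)] at hZ'
    rw [Set.mem_ofPred_eq, abs_of_nonneg (sq_nonneg _)] at hω
    linarith
  have hPV := measure_le_ofReal_div (aemeasurable_globalFluctuation (b := b) hsample n).ennreal_ofReal
    (show 0 < η ^ 2 by positivity) (HV n hn)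
  have hPW : P {ω | ENNReal.ofReal (A * r) ≤
      errorMajorant P X Y b κ φ α β γ Xs Ys n (m₁ n) (m₂ n) ω} ≤
      ENNReal.ofReal (c' * r / (A * r)) :=
    measure_le_ofReal_div ((aemeasurable_noise_fluctuation hsample n _).add
      ((aemeasurable_weighted_fluctuation hsample n _ _).add
      (aemeasurable_weighted_fluctuation hsample n _ _))) (by positivity) (HW n _ _ hn h₁ h₂ hM₁)
  -- Since `η² M^(2α+2) = a²`, this is the requirement `M^(2α+2) ≤ (ε a² / (2s)) n`, which holds
  -- eventually by the little-o assumption.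
  have hV2 : s / n / η ^ 2 ≤ ε / 2 := by
    have hη2 : η ^ 2 * (M : ℝ) ^ (2 * α + 2) = a ^ 2 := by
      rw [hη, mul_pow, ← Real.rpow_natCast ((M : ℝ) ^ (-α - 1)), ← Real.rpow_mul hM00.le,
        mul_assoc, ← Real.rpow_add hM00]
      have : (-α - 1) * ((2 : ℕ) : ℝ) + (2 * α + 2) = 0 := by push_cast; ring
      rw [this, Real.rpow_zero, mul_one]
    rw [div_div, div_le_iff₀ (by positivity)]
    have h := mul_le_mul_of_nonneg_left hM₂ (sq_nonneg η)
    rw [hη2] at h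
    have h' : a ^ 2 * (2 * s) ≤ a ^ 2 * (ε * η ^ 2 * n) := by
      have := mul_le_mul_of_nonneg_right h (show 0 ≤ 2 * s by positivity)
      refine this.trans_eq ?_
      field_simp
    have := le_of_mul_le_mul_left h' (by positivity)
    linarith
  have hW2 : c' * r / (A * r) ≤ ε / 2 := by
    rw [mul_div_mul_right _ _ hr0.ne', hA]
    refine le_of_eq ?_
    field_simp
  refine (measure_mono hsub).trans ((measure_union_le _ _).trans ?_)
  refine (add_le_add (hPV.trans (ENNReal.ofReal_le_ofReal hV2))
    (hPW.trans (ENNReal.ofReal_le_ofReal hW2))).trans_eq ?_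
  rw [← ENNReal.ofReal_add (by positivity) (by positivity), add_halves]

end Rate

/-! ### The balanced cut-off levels. -/

section BalancedCutoffs

theorem IsBigOP.mono {Ω : Type*} [MeasurableSpace Ω] {P : Measure Ω} {Z : ℕ → Ω → ℝ}
    {r r' : ℕ → ℝ} (h : IsBigOP P Z r) {D : ℝ} (hD : 0 < D) (hr : ∀ᶠ n in atTop, r n ≤ D * r' n) :
    IsBigOP P Z r' := by
  intro ε hε
  obtain ⟨M, hM, H⟩ := h ε hε
  refine ⟨M * D, by positivity, ?_⟩
  filter_upwards [H, hr] with n h₁ h₂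
  refine (measure_mono fun ω hω => ?_).trans h₁
  have := mul_le_mul_of_nonneg_left h₂ hM.le
  rw [Set.mem_ofPred_eq] at hω ⊢
  linarith

theorem tendsto_div_log_atTop : Tendsto (fun n : ℕ => (n : ℝ) / Real.log n) atTop atTop := by
  have h : Tendsto (fun x : ℝ => x / Real.log x) atTop atTop := by
    have h₁ := (Real.isLittleO_log_id_atTop).tendsto_div_nhds_zero
    have h₂ : Tendsto (fun x : ℝ => Real.log x / id x) atTop (𝓝[>] 0) := by
      refine tendsto_nhdsWithin_iff.2 ⟨h₁, ?_⟩
      filter_upwards [eventually_gt_atTop 1] with x hx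
      exact div_pos (Real.log_pos hx) (by simp only [id]; linarith)
    refine h₂.inv_tendsto_nhdsGT_zero.congr fun x => ?_
    simp
  exact h.comp tendsto_natCast_atTop_atTop

/-- The ratio is `(log n)^(-e)`: the logarithm is what makes the capped level `m₁` of strictly
smaller order than `n^(1/(2α+2))`. -/
theorem isLittleO_div_log_rpow {e : ℝ} (he : 0 < e) :
    (fun n : ℕ => ((n : ℝ) / Real.log n) ^ e) =o[atTop] fun n : ℕ => (n : ℝ) ^ e := by
  have hlog : Tendsto (fun n : ℕ => Real.log n) atTop atTop :=
    Real.tendsto_log_atTop.comp tendsto_natCast_atTop_atTop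
  have h := (tendsto_rpow_neg_atTop he).comp hlog
  refine isLittleO_iff_tendsto' ?_ |>.2 (h.congr' ?_)
  · filter_upwards [eventually_ge_atTop 1] with n hn h0
    have : (0 : ℝ) < (n : ℝ) ^ e := Real.rpow_pos_of_pos (by exact_mod_cast hn) e
    exact absurd h0 this.ne'
  · filter_upwards [eventually_ge_atTop 1] with n hn
    have hn0 : (0 : ℝ) < n := by exact_mod_cast hn
    have hl : 0 ≤ Real.log n := Real.log_natCast_nonneg n
    have hp : (0 : ℝ) < (n : ℝ) ^ e := Real.rpow_pos_of_pos hn0 e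
    rw [Function.comp_apply, Real.div_rpow hn0.le hl, Real.rpow_neg hl]
    field_simp

theorem isLittleO_natCast_rpow {e f : ℝ} (hef : e < f) :
    (fun n : ℕ => (n : ℝ) ^ e) =o[atTop] fun n : ℕ => (n : ℝ) ^ f := by
  have h := (tendsto_rpow_neg_atTop (sub_pos.2 hef)).comp
    (tendsto_natCast_atTop_atTop (R := ℝ))
  refine isLittleO_iff_tendsto' ?_ |>.2 (h.congr' ?_)
  · filter_upwards [eventually_ge_atTop 1] with n hn h0
    have : (0 : ℝ) < (n : ℝ) ^ f := Real.rpow_pos_of_pos (by exact_mod_cast hn) f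
    exact absurd h0 this.ne'
  · filter_upwards [eventually_ge_atTop 1] with n hn
    have hn0 : (0 : ℝ) < n := by exact_mod_cast hn
    rw [Function.comp_apply, neg_sub, Real.rpow_sub hn0]

theorem tendsto_atTop_of_isBigO {m : ℕ → ℕ} {f : ℕ → ℝ} (hf : Tendsto f atTop atTop)
    (h : f =O[atTop] fun n => (m n : ℝ)) : Tendsto m atTop atTop := by
  obtain ⟨c, hc, hb⟩ := h.exists_pos
  refine tendsto_natCast_atTop_iff.1 (tendsto_atTop_mono' atTop ?_
    (hf.const_mul_atTop (inv_pos.2 hc)))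
  filter_upwards [hb.bound] with n hn
  rw [Real.norm_eq_abs, Real.norm_of_nonneg (Nat.cast_nonneg _)] at hn
  rw [inv_mul_le_iff₀ hc]
  exact (le_abs_self _).trans hn

theorem isLittleO_max_natCast {m₁ m₂ : ℕ → ℕ} {g : ℕ → ℝ}
    (h₁ : (fun n => (m₁ n : ℝ)) =o[atTop] g) (h₂ : (fun n => (m₂ n : ℝ)) =o[atTop] g) :
    (fun n => ((max (m₁ n) (m₂ n) : ℕ) : ℝ)) =o[atTop] g := by
  refine IsBigO.trans_isLittleO (IsBigO.of_norm_le fun n => ?_) (h₁.add h₂)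
  rw [Real.norm_of_nonneg (Nat.cast_nonneg _), Nat.cast_max]
  exact max_le (le_add_of_nonneg_right (Nat.cast_nonneg _))
    (le_add_of_nonneg_left (Nat.cast_nonneg _))

theorem rpow_le_of_le_mul {x y c r : ℝ} (hx : 0 < x) (hc : 0 < c) (hy : 0 < y) (hr : r ≤ 0)
    (h : y ≤ c * x) : x ^ r ≤ c ^ (-r) * y ^ r := by
  have h₁ := Real.rpow_le_rpow_of_nonpos hy h hr
  rw [Real.mul_rpow hc.le hx.le] at h₁
  have h₂ := mul_le_mul_of_nonneg_left h₁ (Real.rpow_nonneg hc.le (-r))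
  rwa [← mul_assoc, ← Real.rpow_add hc, neg_add_cancel, Real.rpow_zero, one_mul] at h₂

/-- The rate for the balanced choice of the cut-off levels. -/
theorem exists_rate_le {α β γ : ℝ} (hα : 1 < α) (hβ : 1 / 2 < β) (hγ : 1 / 2 < γ) {m₁ m₂ : ℕ → ℕ}
    (hm₁ : (fun n => (m₁ n : ℝ)) =Θ[atTop] fun n : ℕ =>
        min ((n : ℝ) ^ (1 / (2 * γ))) (((n : ℝ) / Real.log n) ^ (1 / (2 * α + 2))))
    (hm₂ : (fun n => (m₂ n : ℝ)) =Θ[atTop] fun n : ℕ => (n : ℝ) ^ (1 / (α + 2 * β))) :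
    ∃ D : ℝ, 0 < D ∧ ∀ᶠ n : ℕ in atTop, rate α β γ n (m₁ n) (m₂ n) ≤
      D * max (((n : ℝ) / Real.log n) ^ (-(2 * γ - 1) / (2 * α + 2)))
          (max ((n : ℝ) ^ (-(2 * γ - 1) / (2 * γ)))
            ((n : ℝ) ^ (-(2 * β - 1) / (α + 2 * β)))) := by
  obtain ⟨a, ha, Ha⟩ := hm₁.1.exists_pos
  obtain ⟨a', ha', Ha'⟩ := hm₁.2.exists_pos
  obtain ⟨d, hd, Hd⟩ := hm₂.1.exists_pos
  obtain ⟨d', hd', Hd'⟩ := hm₂.2.exists_pos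
  refine ⟨a + d ^ (α + 1) + a' ^ (-(-2 * γ + 1)) + d' ^ (-(-2 * β + 1)), by positivity, ?_⟩
  filter_upwards [Ha.bound, Ha'.bound, Hd.bound, Hd'.bound, eventually_ge_atTop 3]
    with n h₁ h₂ h₃ h₄ hn
  have hn1 : (1 : ℝ) < n := by exact_mod_cast (show 1 < n by omega)
  have hn0 : (0 : ℝ) < n := by linarith
  have hL : 0 < (n : ℝ) / Real.log n := div_pos hn0 (Real.log_pos hn1)
  set L := (n : ℝ) / Real.log n with hLdef
  set f := min ((n : ℝ) ^ (1 / (2 * γ))) (L ^ (1 / (2 * α + 2))) with hf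
  have hf0 : 0 < f := lt_min (Real.rpow_pos_of_pos hn0 _) (Real.rpow_pos_of_pos hL _)
  have hg0 : (0 : ℝ) < (n : ℝ) ^ (1 / (α + 2 * β)) := Real.rpow_pos_of_pos hn0 _
  rw [Real.norm_of_nonneg (Nat.cast_nonneg _), Real.norm_of_nonneg hf0.le] at h₁ h₂
  rw [Real.norm_of_nonneg (Nat.cast_nonneg _), Real.norm_of_nonneg hg0.le] at h₃ h₄
  have hm₁0 : (0 : ℝ) < m₁ n := pos_of_mul_pos_right (hf0.trans_le h₂) ha'.le
  have hm₂0 : (0 : ℝ) < m₂ n := pos_of_mul_pos_right (hg0.trans_le h₄) hd'.le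
  set T₁ := L ^ (-(2 * γ - 1) / (2 * α + 2)) with hT₁
  set T₂ := (n : ℝ) ^ (-(2 * γ - 1) / (2 * γ)) with hT₂
  set T₃ := (n : ℝ) ^ (-(2 * β - 1) / (α + 2 * β)) with hT₃
  set T := max T₁ (max T₂ T₃) with hT
  have hTT₁ : T₁ ≤ T := le_max_left _ _
  have hTT₂ : T₂ ≤ T := (le_max_left _ _).trans (le_max_right _ _)
  have hTT₃ : T₃ ≤ T := (le_max_right _ _).trans (le_max_right _ _)
  have e₁ : (n : ℝ)⁻¹ * m₁ n ≤ a * T := by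
    have : (n : ℝ)⁻¹ * (n : ℝ) ^ (1 / (2 * γ)) = T₂ := by
      rw [← Real.rpow_neg_one, ← Real.rpow_add hn0, hT₂]
      congr 1
      have : 2 * γ ≠ 0 := by linarith
      field_simp
      ring
    calc (n : ℝ)⁻¹ * m₁ n ≤ (n : ℝ)⁻¹ * (a * (n : ℝ) ^ (1 / (2 * γ))) := by
          gcongr
          exact h₁.trans (mul_le_mul_of_nonneg_left (min_le_left _ _) ha.le)
      _ = a * T₂ := by rw [← this]; ring
      _ ≤ a * T := mul_le_mul_of_nonneg_left hTT₂ ha.le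
  have e₂ : (n : ℝ)⁻¹ * (m₂ n : ℝ) ^ (α + 1) ≤ d ^ (α + 1) * T := by
    have : (n : ℝ)⁻¹ * ((n : ℝ) ^ (1 / (α + 2 * β))) ^ (α + 1) = T₃ := by
      rw [← Real.rpow_neg_one, ← Real.rpow_mul hn0.le, ← Real.rpow_add hn0, hT₃]
      congr 1
      have : α + 2 * β ≠ 0 := by linarith
      field_simp
      ring
    calc (n : ℝ)⁻¹ * (m₂ n : ℝ) ^ (α + 1)
        ≤ (n : ℝ)⁻¹ * (d * (n : ℝ) ^ (1 / (α + 2 * β))) ^ (α + 1) := by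
          gcongr
      _ = d ^ (α + 1) * T₃ := by rw [Real.mul_rpow hd.le hg0.le, ← this]; ring
      _ ≤ d ^ (α + 1) * T := mul_le_mul_of_nonneg_left hTT₃ (by positivity)
  have e₃ : (m₁ n : ℝ) ^ (-2 * γ + 1) ≤ a' ^ (-(-2 * γ + 1)) * T := by
    refine (rpow_le_of_le_mul hm₁0 ha' hf0 (by linarith) h₂).trans
      (mul_le_mul_of_nonneg_left ?_ (by positivity))
    -- Whichever term attains the minimum, raising it to the power `1 - 2γ` gives one of the two
    -- `γ`-terms of the rate.
    rcases min_choice ((n : ℝ) ^ (1 / (2 * γ))) (L ^ (1 / (2 * α + 2))) with h | h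
    · refine le_trans (le_of_eq ?_) hTT₂
      rw [hf, h, ← Real.rpow_mul hn0.le, hT₂]
      congr 1; ring
    · refine le_trans (le_of_eq ?_) hTT₁
      rw [hf, h, ← Real.rpow_mul hL.le, hT₁]
      congr 1; ring
  have e₄ : (m₂ n : ℝ) ^ (-2 * β + 1) ≤ d' ^ (-(-2 * β + 1)) * T := by
    refine (rpow_le_of_le_mul hm₂0 hd' hg0 (by linarith) h₄).trans
      (mul_le_mul_of_nonneg_left ?_ (by positivity))
    refine le_trans (le_of_eq ?_) hTT₃
    rw [← Real.rpow_mul hn0.le, hT₃]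
    congr 1; ring
  rw [rate]
  linarith

/-- The balanced cut-off levels are admissible. -/
theorem balanced_cutoffs_admissible {α β γ : ℝ} (hα : 1 < α) (hβ : α / 2 + 1 < β)
    (hγ : 1 / 2 < γ) {m₁ m₂ : ℕ → ℕ}
    (hm₁ : (fun n => (m₁ n : ℝ)) =Θ[atTop] fun n : ℕ =>
        min ((n : ℝ) ^ (1 / (2 * γ))) (((n : ℝ) / Real.log n) ^ (1 / (2 * α + 2))))
    (hm₂ : (fun n => (m₂ n : ℝ)) =Θ[atTop] fun n : ℕ => (n : ℝ) ^ (1 / (α + 2 * β))) :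
    Tendsto m₁ atTop atTop ∧ Tendsto m₂ atTop atTop ∧
      (fun n => ((max (m₁ n) (m₂ n) : ℕ) : ℝ)) =o[atTop]
        fun n : ℕ => (n : ℝ) ^ (1 / (2 * α + 2)) := by
  have he₀ : 0 < 1 / (2 * α + 2) := by have : 0 < 2 * α + 2 := by linarith
                                       positivity
  have he₁ : 0 < 1 / (2 * γ) := by positivity
  have he₂ : 0 < 1 / (α + 2 * β) := by have : 0 < α + 2 * β := by linarith
                                       positivity
  refine ⟨tendsto_atTop_of_isBigO ?_ hm₁.2, tendsto_atTop_of_isBigO ?_ hm₂.2,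
    isLittleO_max_natCast (hm₁.1.trans_isLittleO ?_)
      (hm₂.1.trans_isLittleO (isLittleO_natCast_rpow ?_))⟩
  · refine tendsto_atTop.2 fun B => ?_
    filter_upwards [((tendsto_rpow_atTop he₁).comp
      (tendsto_natCast_atTop_atTop (R := ℝ))).eventually_ge_atTop B,
      ((tendsto_rpow_atTop he₀).comp tendsto_div_log_atTop).eventually_ge_atTop B] with n h₁ h₂
    exact le_min h₁ h₂
  · exact (tendsto_rpow_atTop he₂).comp tendsto_natCast_atTop_atTop
  · refine IsBigO.trans_isLittleO (IsBigO.of_norm_le fun n => ?_) (isLittleO_div_log_rpow he₀)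
    have hL : 0 ≤ (n : ℝ) / Real.log n := div_nonneg (Nat.cast_nonneg _) (Real.log_natCast_nonneg n)
    rw [Real.norm_of_nonneg (le_min (by positivity) (by positivity))]
    exact min_le_right _ _
  -- `α + 2β > 2α + 2` is the assumption `β > α / 2 + 1`.
  · exact one_div_lt_one_div_of_lt (by linarith) (by linarith)

end BalancedCutoffs

end FunctionalRegression

end

theorem theorem2 {Ω : Type*} [MeasurableSpace Ω] (P : Measure Ω) [IsProbabilityMeasure P]
    (X Y : Ω → FunctionalRegression.L2I) (b : FunctionalRegression.L2II)
    (κ : ℕ → ℝ) (φ : HilbertBasis ℕ ℝ FunctionalRegression.L2I)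
    (α β γ C : ℝ)
    (hmodel : FunctionalRegression.IsLinearModel P X Y b)
    (hspec : FunctionalRegression.IsSpectralSystem (FunctionalRegression.covKernel P X) κ φ)
    (hreg : FunctionalRegression.IsRegular P X Y b κ φ α β γ C)
    (hγ : β / 2 + 1 < γ)
    (Xs Ys : ℕ → Ω → FunctionalRegression.L2I)
    (hsample : FunctionalRegression.IsIIDSample P X Y Xs Ys)
    (κhat : ℕ → Ω → ℕ → ℝ)
    (φhat : ℕ → Ω → HilbertBasis ℕ ℝ FunctionalRegression.L2I)
    (hhat : ∀ n ω, FunctionalRegression.IsSpectralSystem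
      (FunctionalRegression.empCovKernel n (fun i => Xs i ω)) (κhat n ω) (φhat n ω)) :
    (∀ m₁ m₂ : ℕ → ℕ, Tendsto m₁ atTop atTop → Tendsto m₂ atTop atTop →
      ((fun n => ((max (m₁ n) (m₂ n) : ℕ) : ℝ)) =o[atTop]
        fun n : ℕ => (n : ℝ) ^ (1 / (2 * α + 2))) →
      FunctionalRegression.IsBigOP P
        (fun n ω => ‖FunctionalRegression.doubleTruncEst n (m₁ n) (m₂ n)
          (fun i => Xs i ω) (fun i => Ys i ω) (κhat n ω) (φhat n ω) - b‖ ^ 2)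
        (fun n => (n : ℝ)⁻¹ * ((m₁ n : ℝ) + (m₂ n : ℝ) ^ (α + 1))
          + (m₁ n : ℝ) ^ (-2 * γ + 1) + (m₂ n : ℝ) ^ (-2 * β + 1))) ∧
    (∀ m₁ m₂ : ℕ → ℕ,
      ((fun n => (m₁ n : ℝ)) =Θ[atTop] fun n : ℕ =>
        min ((n : ℝ) ^ (1 / (2 * γ))) (((n : ℝ) / Real.log n) ^ (1 / (2 * α + 2)))) →
      ((fun n => (m₂ n : ℝ)) =Θ[atTop] fun n : ℕ => (n : ℝ) ^ (1 / (α + 2 * β))) →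
      FunctionalRegression.IsBigOP P
        (fun n ω => ‖FunctionalRegression.doubleTruncEst n (m₁ n) (m₂ n)
          (fun i => Xs i ω) (fun i => Ys i ω) (κhat n ω) (φhat n ω) - b‖ ^ 2)
        (fun n => max (((n : ℝ) / Real.log n) ^ (-(2 * γ - 1) / (2 * α + 2)))
          (max ((n : ℝ) ^ (-(2 * γ - 1) / (2 * γ)))
            ((n : ℝ) ^ (-(2 * β - 1) / (α + 2 * β)))))) := by
  have hγ' := hreg.lt_gamma
  have hβ' : 1 / 2 < β := by linarith [hreg.one_lt_alpha, hreg.lt_beta]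
  refine ⟨fun m₁ m₂ h₁ h₂ h => FunctionalRegression.isBigOP_doubleTruncEst hmodel hspec hreg
    hsample hhat h₁ h₂ h, fun m₁ m₂ h₁ h₂ => ?_⟩
  obtain ⟨hm₁, hm₂, hm⟩ := FunctionalRegression.balanced_cutoffs_admissible hreg.one_lt_alpha
    hreg.lt_beta hγ' h₁ h₂
  obtain ⟨D, hD, hr⟩ := FunctionalRegression.exists_rate_le hreg.one_lt_alpha hβ' hγ' h₁ h₂
  exact (FunctionalRegression.isBigOP_doubleTruncEst hmodel hspec hreg hsample hhat hm₁ hm₂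
    hm).mono hD hr
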